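/- Let $n\ge 0$ be an integer, $\lambda\in\mathbb R$, $e(t)=e^{2\pi i t}$, $\eta_\lambda(r)=\frac{e^{2\lambda r}-1}{2\lambda}$ (with $\eta_0(r)=r$), and let $\beta$ be the usual inner product of $\mathbb R^n$. Let $\mathcal H=L^2(\mathbb R^n\times\mathbb R^n\times\mathbb R)$, with variables $(x,y,r)$, and let $\Sigma$ be the flip on $\mathcal H\otimes\mathcal H$. Let $U$ be the unitary operator on $\mathcal H\otimes\mathcal H$ and $j$ the involutive unitary operator on $\mathcal H$ given by $$U\xi(x,y,r;x',y',r')=(e^{-\lambda r'})^n\,e\bigl[-\eta_\lambda(r')\beta(e^{-\lambda r'}x,\,y'-e^{-\lambda r'}y)\bigr]\;\xi(e^{-\lambda r'}x,e^{-\lambda r'}y,r+r';\,x'-e^{-\lambda r'}x,\,y'-e^{-\lambda r'}y,\,r'),$$ $$j\xi(x,y,r)=(e^{\lambda r})^n\,e\bigl[-\eta_\lambda(r)\beta(x,y)\bigr]\;\xi(-e^{\lambda r}x,-e^{\lambda r}y,-r).$$ Put $Y=\Sigma(j\otimes1)U(j\otimes1)\Sigma$, $X=\Sigma Y^*\Sigma$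 and $Z=Y^*(j\otimes j)Y(j\otimes j)$. Let $A$ be the norm closure of $\{(\omega\otimes\mathrm{id})(U):\omega\in\mathcal B(\mathcal H)_*\}$ and $\hat A^{\rm op}$ the norm closure of $\{(\mathrm{id}\otimes\omega)(X):\omega\in\mathcal B(\mathcal H)_*\}$. These are $C^*$-algebras. For $a\in A$ put $\Delta(a)=U(a\otimes1)U^*$, for $b\in\hat A^{\rm op}$ put $\hat\Delta(b)=X^*(1\otimes b)X$, and let $\Delta^{\rm cop}(a)=\Sigma\Delta(a)\Sigma$ and $\hat\Delta^{\rm cop}(b)=\Sigma\hat\Delta(b)\Sigma$. A $C^*$-bialgebra is a $C^*$-algebra $C$ with a nondegenerate $*$-homomorphism $\delta:C\to M(C\otimes C)$ such that $(\delta\otimes\mathrm{id})\delta=(\mathrm{id}\otimes\delta)\delta$; here $\otimes$ is the spatial tensor product, $M$ the multiplier algebra, and homomorphisms are extended to multiplier algebras. An inversion on $C^*$-bialgebras $(A,\delta_A)$ and $(B,\delta_B)$ is a $*$-isomorphism $\tau:A\otimes B\to B\otimes A$ such that $$(\tau\otimes\mathrm{id}_A)(\mathrm{id}_A\otimes\tau)(\delta_A\otimes\mathrm{id}_B)=(\mathrm{id}_B\otimes\delta_A)\tau,\qquad(\mathrm{id}_B\otimes\tau)(\tau\otimes\mathrm{id}_B)(\mathrm{id}_A\otimes\delta_B)=(\delta_B\otimes\mathrm{id}_A)\tau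 .$$ Proposition. $(A,\Delta^{\rm cop})$ and $(\hat A^{\rm op},\hat\Delta^{\rm cop})$ are $C^*$-bialgebras, acting nondegenerately on $\mathcal H$. The map $\tau(p)=\Sigma ZpZ^*\Sigma$ is a $*$-isomorphism $A\otimes\hat A^{\rm op}\to\hat A^{\rm op}\otimes A$, and it is an inversion on $(A,\Delta^{\rm cop})$ and $(\hat A^{\rm op},\hat\Delta^{\rm cop})$. Consequently $\delta_\tau=(\mathrm{id}\otimes\tau\otimes\mathrm{id})(\Delta^{\rm cop}\otimes\hat\Delta^{\rm cop})$ is a (nondegenerate) coassociative comultiplication on the $C^*$-algebra $A\otimes\hat A^{\rm op}$, so that $(A\otimes\hat A^{\rm op},\delta_\tau)$ is a $C^*$-bialgebra. -/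

import Mathlib

open MeasureTheory TensorProduct
open scoped ENNReal InnerProductSpace

namespace QuantumHeisenberg
noncomputable section

/-- `L²(X^k)`, the `k`-fold Hilbert space tensor power of `L²(X)`. -/
abbrev L2 (X : Type) [MeasureSpace X] (k : ℕ) : Type := Lp ℂ 2 (volume : Measure (Fin k → X))

/-- Bounded operators on `L²(X^k)`. -/
abbrev Op (X : Type) [MeasureSpace X] (k : ℕ) : Type := L2 X k →L[ℂ] L2 X k

section
variable {X : Type} [MeasureSpace X] [SigmaFinite (volume : Measure X)]

/-- Splitting `X^(a+b)` into `X^a × X^b`. -/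
def split (a b : ℕ) (x : Fin (a + b) → X) : (Fin a → X) × (Fin b → X) :=
  (fun i => x (Fin.castAdd b i), fun j => x (Fin.natAdd a j))

theorem measurePreserving_split (a b : ℕ) :
    MeasurePreserving (split (X := X) a b) volume volume := by
  have h1 := volume_measurePreserving_sumPiEquivProdPi (fun _ : Fin a ⊕ Fin b => X)
  have h2 := (volume_measurePreserving_piCongrLeft (fun _ : Fin (a + b) => X)
    (finSumFinEquiv (m := a) (n := b))).symm
  exact h1.comp h2

theorem memLp_tensor {a b : ℕ} (ξ : L2 X a) (η : L2 X b) :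
    MemLp (fun x : Fin (a + b) → X => ξ (split a b x).1 * η (split a b x).2) 2 volume := by
  have h : MemLp (fun p : (Fin a → X) × (Fin b → X) => ξ p.1 * η p.2) 2 volume := by
    have hξ := Lp.memLp ξ
    have hη := Lp.memLp η
    rw [memLp_two_iff_integrable_sq_norm]
    · have := (hξ.norm.integrable_sq).mul_prod (hη.norm.integrable_sq)
      simp only [norm_mul, mul_pow]
      exact this
    · exact (hξ.1.comp_fst).mul (hη.1.comp_snd)
  exact h.comp_measurePreserving (measurePreserving_split a b)

theorem ae_split_fst {a : ℕ} (b : ℕ) {p : (Fin a → X) → Prop} (h : ∀ᵐ x, p x) :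
    ∀ᵐ x : Fin (a + b) → X, p (split a b x).1 :=
  (Measure.quasiMeasurePreserving_fst.comp
    (measurePreserving_split a b).quasiMeasurePreserving).ae h

theorem ae_split_snd (a : ℕ) {b : ℕ} {p : (Fin b → X) → Prop} (h : ∀ᵐ x, p x) :
    ∀ᵐ x : Fin (a + b) → X, p (split a b x).2 :=
  (Measure.quasiMeasurePreserving_snd.comp
    (measurePreserving_split a b).quasiMeasurePreserving).ae h

/-- The elementary tensor `ξ ⊗ η`, i.e. the function `(x, y) ↦ ξ(x) η(y)`, as a bilinear map. -/
def vecTensor (a b : ℕ) : L2 X a →ₗ[ℂ] L2 X b →ₗ[ℂ] L2 X (a + b) :=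
  LinearMap.mk₂ ℂ (fun ξ η => (memLp_tensor ξ η).toLp _)
    (by
      intro ξ ξ' η
      ext1
      filter_upwards [(memLp_tensor (ξ + ξ') η).coeFn_toLp, (memLp_tensor ξ η).coeFn_toLp,
        (memLp_tensor ξ' η).coeFn_toLp, Lp.coeFn_add ((memLp_tensor ξ η).toLp _)
        ((memLp_tensor ξ' η).toLp _), ae_split_fst b (Lp.coeFn_add ξ ξ')] with x h1 h2 h3 h4 h5
      rw [h1, h4, Pi.add_apply, h2, h3, h5, Pi.add_apply, add_mul])
    (by
      intro c ξ η
      ext1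
      filter_upwards [(memLp_tensor (c • ξ) η).coeFn_toLp, (memLp_tensor ξ η).coeFn_toLp,
        Lp.coeFn_smul c ((memLp_tensor ξ η).toLp _),
        ae_split_fst b (Lp.coeFn_smul c ξ)] with x h1 h2 h4 h5
      rw [h1, h4, Pi.smul_apply, h2, h5, Pi.smul_apply, smul_mul_assoc])
    (by
      intro ξ η η'
      ext1
      filter_upwards [(memLp_tensor ξ (η + η')).coeFn_toLp, (memLp_tensor ξ η).coeFn_toLp,
        (memLp_tensor ξ η').coeFn_toLp, Lp.coeFn_add ((memLp_tensor ξ η).toLp _)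
        ((memLp_tensor ξ η').toLp _), ae_split_snd a (Lp.coeFn_add η η')] with x h1 h2 h3 h4 h5
      rw [h1, h4, Pi.add_apply, h2, h3, h5, Pi.add_apply, mul_add])
    (by
      intro c ξ η
      ext1
      filter_upwards [(memLp_tensor ξ (c • η)).coeFn_toLp, (memLp_tensor ξ η).coeFn_toLp,
        Lp.coeFn_smul c ((memLp_tensor ξ η).toLp _),
        ae_split_snd a (Lp.coeFn_smul c η)] with x h1 h2 h4 h5
      rw [h1, h4, Pi.smul_apply, h2, h5, Pi.smul_apply, mul_smul_comm])

theorem vecTensor_coeFn {a b : ℕ} (ξ : L2 X a) (η : L2 X b) :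
    vecTensor a b ξ η =ᵐ[volume] fun x => ξ (split a b x).1 * η (split a b x).2 :=
  (memLp_tensor ξ η).coeFn_toLp

theorem inner_vecTensor {a b : ℕ} (ξ ξ' : L2 X a) (η η' : L2 X b) :
    ⟪vecTensor a b ξ η, vecTensor a b ξ' η'⟫_ℂ = ⟪ξ, ξ'⟫_ℂ * ⟪η, η'⟫_ℂ := by
  rw [L2.inner_def, L2.inner_def, L2.inner_def, ← integral_prod_mul]
  have hm := measurePreserving_split (X := X) a b
  have hms : AEStronglyMeasurable (fun p : (Fin a → X) × (Fin b → X) =>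
      ⟪ξ p.1, ξ' p.1⟫_ℂ * ⟪η p.2, η' p.2⟫_ℂ) volume :=
    (((Lp.memLp ξ).1.inner (Lp.memLp ξ').1).comp_fst).mul
      (((Lp.memLp η).1.inner (Lp.memLp η').1).comp_snd)
  have := integral_map (μ := (volume : Measure (Fin (a + b) → X))) hm.measurable.aemeasurable
    (by rw [hm.map_eq]; exact hms)
  rw [hm.map_eq] at this
  rw [show (volume : Measure (Fin a → X)).prod (volume : Measure (Fin b → X)) = volume from rfl,
    this]
  apply integral_congr_ae
  filter_upwards [vecTensor_coeFn ξ η, vecTensor_coeFn ξ' η'] with x h1 h2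
  rw [h1, h2]
  simp only [RCLike.inner_apply, map_mul]
  ring

/-- The isometry from the algebraic tensor product `L²(X^a) ⊗ L²(X^b)` into `L²(X^(a+b))`. -/
def tensorIsometry (a b : ℕ) : (L2 X a ⊗[ℂ] L2 X b) →ₗᵢ[ℂ] L2 X (a + b) :=
  (TensorProduct.lift (vecTensor (X := X) a b)).isometryOfInner (by
    intro x y
    induction x using TensorProduct.induction_on with
    | zero => simp
    | add x x' hx hx' => simp only [map_add, inner_add_left, hx, hx']
    | tmul ξ η =>
      induction y using TensorProduct.induction_on with
      | zero => simp
      | add y y' hy hy' => simp only [map_add, inner_add_right, hy, hy']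
      | tmul ξ' η' => simp [inner_vecTensor])

theorem tensorIsometry_tmul {a b : ℕ} (ξ : L2 X a) (η : L2 X b) :
    tensorIsometry a b (ξ ⊗ₜ η) = vecTensor a b ξ η := by
  simp [tensorIsometry]

/-- A square integrable function on a product orthogonal to all elementary tensors vanishes. -/
theorem ae_eq_zero_of_rectangles {α β : Type} [MeasureSpace α] [MeasureSpace β]
    [SigmaFinite (volume : Measure α)] [SigmaFinite (volume : Measure β)] {g : α × β → ℂ}
    (hg : MemLp g 2 volume)
    (h : ∀ s t, MeasurableSet s → MeasurableSet t → volume s < ∞ → volume t < ∞ →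
      ∫ p in s ×ˢ t, g p = 0) : g =ᵐ[volume] 0 := by
  have key : ∀ n, ∀ᵐ p ∂(volume.restrict
      (spanningSets (volume : Measure α) n ×ˢ spanningSets (volume : Measure β) n)), g p = 0 := by
    intro n
    set S := spanningSets (volume : Measure α) n
    set T := spanningSets (volume : Measure β) n
    have hS : MeasurableSet S := measurableSet_spanningSets _ _
    have hT : MeasurableSet T := measurableSet_spanningSets _ _
    have hS' : volume S < ∞ := measure_spanningSets_lt_top _ _
    have hT' : volume T < ∞ := measure_spanningSets_lt_top _ _
    have hfin : volume (S ×ˢ T) < ∞ := by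
      rw [Measure.volume_eq_prod, Measure.prod_prod]; exact ENNReal.mul_lt_top hS' hT'
    have : IsFiniteMeasure (volume.restrict (S ×ˢ T) : Measure (α × β)) :=
      isFiniteMeasure_restrict.2 hfin.ne
    have hint : Integrable g (volume.restrict (S ×ˢ T)) :=
      (hg.restrict _).integrable (by norm_num)
    have hz : ∀ E : Set (α × β), MeasurableSet E → ∫ p in E, g p ∂(volume.restrict (S ×ˢ T)) = 0 := by
      intro E hE
      induction E, hE using MeasurableSpace.induction_on_inter generateFrom_prod.symm
        isPiSystem_prod with
      | empty => simp
      | basic E hE =>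
        obtain ⟨s, hs, t, ht, rfl⟩ := hE
        rw [Measure.restrict_restrict (MeasurableSet.prod hs ht), Set.prod_inter_prod]
        exact h _ _ (MeasurableSet.inter hs hS) (MeasurableSet.inter ht hT)
          ((measure_mono Set.inter_subset_right).trans_lt hS')
          ((measure_mono Set.inter_subset_right).trans_lt hT')
      | compl E hE ih =>
        rw [setIntegral_compl hE hint, ih, sub_zero]
        exact h _ _ hS hT hS' hT'
      | iUnion f hd hf ih =>
        rw [integral_iUnion hf hd hint.integrableOn]
        simp [ih]
    exact hint.ae_eq_zero_of_forall_setIntegral_eq_zero (fun E hE _ => hz E hE)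
  have := (ae_restrict_iUnion_iff (μ := (volume : Measure (α × β)))
    (fun n => spanningSets (volume : Measure α) n ×ˢ spanningSets (volume : Measure β) n)
    (fun p => g p = 0)).2 key
  have hU : (⋃ n, spanningSets (volume : Measure α) n ×ˢ spanningSets (volume : Measure β) n)
      = Set.univ := by
    rw [Set.iUnion_prod_of_monotone (monotone_spanningSets _) (monotone_spanningSets _),
      iUnion_spanningSets, iUnion_spanningSets, Set.univ_prod_univ]
  rw [hU, Measure.restrict_univ] at this
  exact this

theorem denseRange_tensorIsometry (a b : ℕ) :
    DenseRange (tensorIsometry (X := X) a b) := by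
  have hfin : (LinearMap.range (tensorIsometry (X := X) a b).toLinearMap).topologicalClosure = ⊤ := by
    rw [Submodule.topologicalClosure_eq_top_iff, Submodule.eq_bot_iff]
    intro g hg
    rw [Submodule.mem_orthogonal] at hg
    let e : (Fin (a + b) → X) ≃ᵐ (Fin a → X) × (Fin b → X) :=
      (MeasurableEquiv.piCongrLeft (fun _ : Fin (a + b) => X)
        (finSumFinEquiv (m := a) (n := b))).symm.trans
      (MeasurableEquiv.sumPiEquivProdPi (fun _ : Fin a ⊕ Fin b => X))
    have hes : ∀ x, e x = split a b x := fun x => rfl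
    have he : MeasurePreserving e volume volume := measurePreserving_split (X := X) a b
    have hg' : MemLp (fun p => g (e.symm p)) 2 volume :=
      (Lp.memLp g).comp_measurePreserving he.symm
    have hz := ae_eq_zero_of_rectangles hg' (by
      intro s t hs ht hs' ht'
      have h1 := hg _ ⟨indicatorConstLp 2 hs hs'.ne (1 : ℂ) ⊗ₜ indicatorConstLp 2 ht ht'.ne (1 : ℂ), rfl⟩
      rw [← he.setIntegral_preimage_emb e.measurableEmbedding]
      rw [← integral_indicator (e.measurable (hs.prod ht)), ← h1]
      rw [L2.inner_def]
      apply integral_congr_ae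
      filter_upwards [vecTensor_coeFn (indicatorConstLp 2 hs hs'.ne (1 : ℂ))
        (indicatorConstLp 2 ht ht'.ne (1 : ℂ)),
        ae_split_fst b (indicatorConstLp_coeFn (p := 2) (hs := hs) (hμs := hs'.ne) (c := (1 : ℂ))),
        ae_split_snd a (indicatorConstLp_coeFn (p := 2) (hs := ht) (hμs := ht'.ne) (c := (1 : ℂ)))]
        with x h2 h3 h4
      change _ = ⟪(tensorIsometry a b (_ ⊗ₜ _) : L2 X (a + b)) x, _⟫_ℂ
      rw [tensorIsometry_tmul, h2, h3, h4]
      have hx : e.symm (split a b x) = x := by rw [← hes, e.symm_apply_apply]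
      by_cases hx1 : (split a b x).1 ∈ s <;> by_cases hx2 : (split a b x).2 ∈ t <;>
        simp [Set.indicator, hes, hx1, hx2, hx])
    have := he.quasiMeasurePreserving.ae hz
    rw [Lp.eq_zero_iff_ae_eq_zero]
    filter_upwards [this] with x hx
    simpa using hx
  intro v
  have hv : v ∈ (LinearMap.range (tensorIsometry (X := X) a b).toLinearMap).topologicalClosure := by
    rw [hfin]; trivial
  exact hv

/-- The operator `T ⊗ S` on `L²(X^(a+b)) = L²(X^a) ⊗ L²(X^b)`. -/
def opTensor {a b : ℕ} (T : Op X a) (S : Op X b) : Op X (a + b) :=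
  ((tensorIsometry a b).toContinuousLinearMap.comp (TensorProduct.mapL T S)).extend
    (tensorIsometry a b).toContinuousLinearMap

theorem opTensor_vecTensor {a b : ℕ} (T : Op X a) (S : Op X b) (ξ : L2 X a) (η : L2 X b) :
    opTensor T S (vecTensor a b ξ η) = vecTensor a b (T ξ) (S η) := by
  have := ContinuousLinearMap.extend_eq
    ((tensorIsometry (X := X) a b).toContinuousLinearMap.comp (TensorProduct.mapL T S))
    (e := (tensorIsometry a b).toContinuousLinearMap) (denseRange_tensorIsometry a b)
    (tensorIsometry a b).isometry.isUniformInducing (ξ ⊗ₜ η)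
  simpa [tensorIsometry_tmul, opTensor] using this

/-- The operator `ξ ↦ ξ ⊗ ζ`. -/
def tensorRight (a : ℕ) {b : ℕ} (ζ : L2 X b) : L2 X a →L[ℂ] L2 X (a + b) :=
  (tensorIsometry a b).toContinuousLinearMap.comp ((TensorProduct.mkL ℂ (L2 X a) (L2 X b)).flip ζ)

/-- The operator `ξ ↦ ζ ⊗ ξ`. -/
def tensorLeft {a : ℕ} (ζ : L2 X a) (b : ℕ) : L2 X b →L[ℂ] L2 X (a + b) :=
  (tensorIsometry a b).toContinuousLinearMap.comp (TensorProduct.mkL ℂ (L2 X a) (L2 X b) ζ)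

/-- Membership in the predual `B(L²(X^k))_*`: the functional is `T ↦ ∑ ⟨T ξᵢ, ηᵢ⟩` with
`∑ ‖ξᵢ‖² < ∞` and `∑ ‖ηᵢ‖² < ∞`. (Mathlib's inner product is linear in the second variable.) -/
def IsNormalFunctional {k : ℕ} (ω : Op X k →L[ℂ] ℂ) : Prop :=
  ∃ ξ η : ℕ → L2 X k, Summable (fun i => ‖ξ i‖ ^ 2) ∧ Summable (fun i => ‖η i‖ ^ 2) ∧
    ∀ T : Op X k, HasSum (fun i => ⟪η i, T (ξ i)⟫_ℂ) (ω T)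

/-- The slices `(ω ⊗ id)(V)`, `ω ∈ B(L²(X^a))_*`. The slice `S` is determined by
`⟨S ζ, θ⟩ = ω((id ⊗ ω_{ζ,θ})(V))`. -/
def leftSlices {a b : ℕ} (V : Op X (a + b)) : Set (Op X b) :=
  {S | ∃ ω : Op X a →L[ℂ] ℂ, IsNormalFunctional ω ∧ ∀ ζ θ : L2 X b,
    ⟪θ, S ζ⟫_ℂ = ω ((ContinuousLinearMap.adjoint (tensorRight a θ)).comp
      (V.comp (tensorRight a ζ)))}

/-- The slices `(id ⊗ ω)(V)`, `ω ∈ B(L²(X^b))_*`. -/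
def rightSlices {a b : ℕ} (V : Op X (a + b)) : Set (Op X a) :=
  {S | ∃ ω : Op X b →L[ℂ] ℂ, IsNormalFunctional ω ∧ ∀ ζ θ : L2 X a,
    ⟪θ, S ζ⟫_ℂ = ω ((ContinuousLinearMap.adjoint (tensorLeft θ b)).comp
      (V.comp (tensorLeft ζ b)))}

/-- The `C*`-algebra of operators generated by a set. -/
def cstarGenerated {k : ℕ} (s : Set (Op X k)) : NonUnitalStarSubalgebra ℂ (Op X k) :=
  (NonUnitalStarAlgebra.adjoin ℂ s).topologicalClosure

/-- The spatial tensor product `A ⊗ B` of two algebras of operators. -/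
def spatialTensor {a b : ℕ} (A : NonUnitalStarSubalgebra ℂ (Op X a))
    (B : NonUnitalStarSubalgebra ℂ (Op X b)) : NonUnitalStarSubalgebra ℂ (Op X (a + b)) :=
  cstarGenerated {T | ∃ S ∈ A, ∃ R ∈ B, T = opTensor S R}

theorem opTensor_mem {a b : ℕ} {A : NonUnitalStarSubalgebra ℂ (Op X a)}
    {B : NonUnitalStarSubalgebra ℂ (Op X b)} (S : A) (R : B) :
    opTensor (S : Op X a) (R : Op X b) ∈ spatialTensor A B :=
  NonUnitalStarSubalgebra.le_topologicalClosure _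
    (NonUnitalStarAlgebra.subset_adjoin ℂ _ ⟨S, S.2, R, R.2, rfl⟩)

/-- `T` belongs to the multiplier algebra `M(C)`, for a `C*`-algebra `C` of operators that acts
nondegenerately. -/
def IsMultiplier {k : ℕ} (C : NonUnitalStarSubalgebra ℂ (Op X k)) (T : Op X k) : Prop :=
  ∀ c ∈ C, T * c ∈ C ∧ c * T ∈ C

/-- `*`-homomorphisms from an algebra of operators into `B(L²(X^l))`. -/
abbrev OpHom {k : ℕ} (C : NonUnitalStarSubalgebra ℂ (Op X k)) (l : ℕ) : Type :=
  C →⋆ₙₐ[ℂ] Op X l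

/-- `*`-isomorphisms `A ⊗ B → B ⊗ A`. -/
abbrev FlipIso {a b : ℕ} (A : NonUnitalStarSubalgebra ℂ (Op X a))
    (B : NonUnitalStarSubalgebra ℂ (Op X b)) : Type :=
  spatialTensor A B ≃⋆ₐ[ℂ] spatialTensor B A

/-- The inclusion of an algebra of operators. -/
def incl {k : ℕ} (C : NonUnitalStarSubalgebra ℂ (Op X k)) : OpHom C k :=
  NonUnitalStarSubalgebraClass.subtype C

/-- `Φ` is the homomorphism `φ ⊗ ψ` on the spatial tensor product (there is at most one). -/
def IsTensorHom {a b k l : ℕ} {A : NonUnitalStarSubalgebra ℂ (Op X a)}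
    {B : NonUnitalStarSubalgebra ℂ (Op X b)} (φ : OpHom A k) (ψ : OpHom B l)
    (Φ : OpHom (spatialTensor A B) (k + l)) : Prop :=
  ∀ (S : A) (R : B), Φ ⟨opTensor (S : Op X a) (R : Op X b), opTensor_mem S R⟩ =
    opTensor (φ S) (ψ R)

/-- `T` is a multiplier of `C` and `S` is its image under the extension of the nondegenerate
homomorphism `φ` to `M(C)`, which is characterized by `φ(T) φ(c) = φ(T c)`. -/
def ExtendsTo {k l : ℕ} {C : NonUnitalStarSubalgebra ℂ (Op X k)} (φ : OpHom C l)
    (T : Op X k) (S : Op X l) : Prop :=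
  ∃ hT : IsMultiplier C T, ∀ c : C, S * φ c = φ ⟨T * (c : Op X k), (hT c c.2).1⟩

/-- Identification of equal tensor powers, such as `L²(X^((a+b)+c)) = L²(X^(a+(b+c)))`. -/
def opCast {k l : ℕ} (h : k = l) (T : Op X k) : Op X l := h ▸ T

/-- `(C, δ)` is a `C*`-bialgebra: `C` is a `C*`-algebra acting nondegenerately and `δ` is a
nondegenerate coassociative homomorphism `C → M(C ⊗ C)`. -/
structure IsCStarBialgebra {k : ℕ} (C : NonUnitalStarSubalgebra ℂ (Op X k))
    (δ : OpHom C (k + k)) : Prop where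
  isClosed : IsClosed (C : Set (Op X k))
  nondegenerate_action :
    closure (Submodule.span ℂ {v : L2 X k | ∃ c ∈ C, ∃ ξ, v = c ξ} : Set (L2 X k)) = Set.univ
  isMultiplier : ∀ c, IsMultiplier (spatialTensor C C) (δ c)
  nondegenerate :
    closure (Submodule.span ℂ {T : Op X (k + k) | ∃ c : C, ∃ d ∈ spatialTensor C C, T = δ c * d} :
      Set (Op X (k + k))) = spatialTensor C C
  coassoc : ∃ (δι : OpHom (spatialTensor C C) (k + k + k))
      (ιδ : OpHom (spatialTensor C C) (k + (k + k))),
    IsTensorHom δ (incl C) δι ∧ IsTensorHom (incl C) δ ιδ ∧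
      ∀ c, ∃ S, ExtendsTo δι (δ c) S ∧ ExtendsTo ιδ (δ c) (opCast (by omega) S)

section inversion
variable {a b : ℕ} {A : NonUnitalStarSubalgebra ℂ (Op X a)}
  {B : NonUnitalStarSubalgebra ℂ (Op X b)}

/-- A `*`-isomorphism `τ : A ⊗ B → B ⊗ A`, regarded as a homomorphism into bounded operators. -/
def tauHom (τ : FlipIso A B) :
    OpHom (spatialTensor A B) (b + a) :=
  (incl (spatialTensor B A)).comp (τ : spatialTensor A B →⋆ₙₐ[ℂ] spatialTensor B A)

/-- `τ` is an inversion on the `C*`-bialgebras `(A, δA)` and `(B, δB)`: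
`(τ ⊗ id)(id ⊗ τ)(δA ⊗ id) = (id ⊗ δA) τ` and `(id ⊗ τ)(τ ⊗ id)(id ⊗ δB) = (δB ⊗ id) τ`, where
homomorphisms are extended to multiplier algebras. -/
structure IsInversion (δA : OpHom A (a + a)) (δB : OpHom B (b + b))
    (τ : FlipIso A B) : Prop where
  left : IsCStarBialgebra A δA
  right : IsCStarBialgebra B δB
  compat_left : ∃ (δι : OpHom (spatialTensor A B) (a + a + b))
      (ιτ : OpHom (spatialTensor A (spatialTensor A B)) (a + (b + a)))
      (τι : OpHom (spatialTensor (spatialTensor A B) A) (b + a + a))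
      (ιδ : OpHom (spatialTensor B A) (b + (a + a))),
    IsTensorHom δA (incl B) δι ∧ IsTensorHom (incl A) (tauHom τ) ιτ ∧
    IsTensorHom (tauHom τ) (incl A) τι ∧ IsTensorHom (incl B) δA ιδ ∧
    ∀ p, ∃ S : Op X (a + (b + a)), ExtendsTo ιτ (opCast (by omega) (δι p)) S ∧
      ExtendsTo τι (opCast (by omega) S) (opCast (by omega) (ιδ (τ p)))
  compat_right : ∃ (ιδ : OpHom (spatialTensor A B) (a + (b + b)))
      (τι : OpHom (spatialTensor (spatialTensor A B) B) (b + a + b))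
      (ιτ : OpHom (spatialTensor B (spatialTensor A B)) (b + (b + a)))
      (δι : OpHom (spatialTensor B A) (b + b + a)),
    IsTensorHom (incl A) δB ιδ ∧ IsTensorHom (tauHom τ) (incl B) τι ∧
    IsTensorHom (incl B) (tauHom τ) ιτ ∧ IsTensorHom δB (incl A) δι ∧
    ∀ p, ∃ S : Op X (b + a + b), ExtendsTo τι (opCast (by omega) (ιδ p)) S ∧
      ExtendsTo ιτ (opCast (by omega) S) (opCast (by omega) (δι (τ p)))

/-- `δτ` is the comultiplication `(id ⊗ τ ⊗ id)(δA ⊗ δB)` on `A ⊗ B` associated with `τ`. -/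
def IsTwistedComul (δA : OpHom A (a + a)) (δB : OpHom B (b + b))
    (τ : FlipIso A B)
    (δτ : OpHom (spatialTensor A B) (a + b + (a + b))) : Prop :=
  ∃ (δδ : OpHom (spatialTensor A B) (a + a + (b + b)))
    (ιτ : OpHom (spatialTensor A (spatialTensor A B)) (a + (b + a)))
    (ιτι : OpHom (spatialTensor (spatialTensor A (spatialTensor A B)) B) (a + (b + a) + b)),
    IsTensorHom δA δB δδ ∧ IsTensorHom (incl A) (tauHom τ) ιτ ∧ IsTensorHom ιτ (incl B) ιτι ∧
    ∀ p, ExtendsTo ιτι (opCast (by omega) (δδ p)) (opCast (by omega) (δτ p))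
end inversion

theorem measurePreserving_swap :
    MeasurePreserving (fun (p : Fin 2 → X) i => p (Equiv.swap 0 1 i)) volume volume := by
  have h := volume_measurePreserving_piCongrLeft (fun _ : Fin 2 => X) (Equiv.swap 0 1)
  have he : (fun (p : Fin 2 → X) i => p (Equiv.swap 0 1 i)) =
      MeasurableEquiv.piCongrLeft (fun _ : Fin 2 => X) (Equiv.swap 0 1) := by
    funext p i
    have := MeasurableEquiv.piCongrLeft_apply_apply (β := fun _ : Fin 2 => X) (Equiv.swap 0 1) p
      (Equiv.swap 0 1 i)
    rw [Equiv.swap_apply_self] at this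
    exact this.symm
  rw [he]
  exact h

/-- The flip `(Σξ)(p, q) = ξ(q, p)` on `L²(X²) = L²(X) ⊗ L²(X)`. -/
def flipOp : Op X 2 :=
  (Lp.compMeasurePreservingₗᵢ ℂ _ measurePreserving_swap).toContinuousLinearMap

theorem flipOp_coeFn (ξ : L2 X 2) :
    flipOp ξ =ᵐ[volume] fun p => ξ (fun i => p (Equiv.swap 0 1 i)) :=
  Lp.coeFn_compMeasurePreserving ξ measurePreserving_swap

open scoped Classical in
/-- The weighted composition operator `(Wξ)(p) = w(p) ξ(φ(p))`; it is zero by convention if no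
bounded operator on `L²(X^k)` is given by this formula. -/
def weightedComp {k : ℕ} (w : (Fin k → X) → ℂ) (φ : (Fin k → X) → (Fin k → X)) : Op X k :=
  if h : ∃ W : Op X k, ∀ ξ : L2 X k, W ξ =ᵐ[volume] fun p => w p * ξ (φ p) then h.choose else 0

theorem weightedComp_coeFn {k : ℕ} {w : (Fin k → X) → ℂ} {φ : (Fin k → X) → (Fin k → X)}
    (hw : Measurable w) (hφ : Measurable φ) (h0 : ∀ p, w p ≠ 0)
    (hI : ∀ g : (Fin k → X) → ℝ≥0∞, Measurable g → ∫⁻ p, ‖w p‖ₑ ^ 2 * g (φ p) = ∫⁻ p, g p)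
    (ξ : L2 X k) : weightedComp w φ ξ =ᵐ[volume] fun p => w p * ξ (φ p) := by
  have hq : Measure.QuasiMeasurePreserving φ volume volume := by
    refine ⟨hφ, ?_⟩
    refine Measure.AbsolutelyContinuous.mk fun N hN hN0 => ?_
    rw [Measure.map_apply hφ hN]
    have h1 := hI (N.indicator 1) (measurable_one.indicator hN)
    have hm : Measurable fun p => ‖w p‖ₑ ^ 2 * (N.indicator 1 (φ p) : ℝ≥0∞) :=
      (hw.enorm.pow_const 2).mul ((measurable_one.indicator hN).comp hφ)
    rw [lintegral_indicator_one hN, hN0, lintegral_eq_zero_iff hm] at h1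
    rw [measure_eq_zero_iff_ae_notMem]
    filter_upwards [h1] with p hp hpN
    have : φ p ∈ N := hpN
    simp [this, h0] at hp
  have hmem : ∀ ξ : L2 X k, AEStronglyMeasurable (fun p => w p * ξ (φ p)) volume := fun ξ =>
    hw.aestronglyMeasurable.mul ((Lp.aestronglyMeasurable ξ).comp_quasiMeasurePreserving hq)
  have hnorm : ∀ ξ : L2 X k, eLpNorm (fun p => w p * ξ (φ p)) 2 volume = eLpNorm ξ 2 volume := by
    intro ξ
    have h := hI (fun p => ‖ξ p‖ₑ ^ 2) ((Lp.stronglyMeasurable ξ).measurable.enorm.pow_const 2)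
    simp only [eLpNorm_eq_lintegral_rpow_enorm_toReal two_ne_zero ENNReal.ofNat_ne_top,
      ENNReal.toReal_ofNat, ENNReal.rpow_ofNat, enorm_mul, mul_pow, h]
  have hL : ∀ ξ : L2 X k, MemLp (fun p => w p * ξ (φ p)) 2 volume := fun ξ =>
    ⟨hmem ξ, by rw [hnorm ξ]; exact (Lp.memLp ξ).2⟩
  have hex : ∃ W : Op X k, ∀ ξ : L2 X k, W ξ =ᵐ[volume] fun p => w p * ξ (φ p) := by
    let W : L2 X k →ₗᵢ[ℂ] L2 X k :=
      { toFun := fun ξ => (hL ξ).toLp _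
        map_add' := by
          intro ξ η
          ext1
          filter_upwards [(hL (ξ + η)).coeFn_toLp, (hL ξ).coeFn_toLp, (hL η).coeFn_toLp,
            Lp.coeFn_add ((hL ξ).toLp _) ((hL η).toLp _), hq.ae (Lp.coeFn_add ξ η)]
            with p h1 h2 h3 h4 h5
          rw [h1, h4, Pi.add_apply, h2, h3, h5, Pi.add_apply, mul_add]
        map_smul' := by
          intro c ξ
          ext1
          filter_upwards [(hL (c • ξ)).coeFn_toLp, (hL ξ).coeFn_toLp,
            Lp.coeFn_smul c ((hL ξ).toLp _), hq.ae (Lp.coeFn_smul c ξ)]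
            with p h1 h2 h4 h5
          rw [h1, RingHom.id_apply, h4, Pi.smul_apply, h2, h5, Pi.smul_apply, mul_smul_comm]
        norm_map' := by
          intro ξ
          change ‖(hL ξ).toLp _‖ = _
          rw [Lp.norm_toLp, hnorm, Lp.norm_def] }
    exact ⟨W.toContinuousLinearMap, fun ξ => (hL ξ).coeFn_toLp⟩
  rw [weightedComp, dif_pos hex]
  exact hex.choose_spec ξ
end

section
variable (n : ℕ) (lam : ℝ)

/-- The space of the variables `(x, y, r)`, with `x, y ∈ ℝⁿ` and `r ∈ ℝ`, written `((x, y), r)`. -/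
abbrev Phase : Type := ((Fin n → ℝ) × (Fin n → ℝ)) × ℝ

/-- `e(t) = exp(2πit)`. -/
def ee (t : ℝ) : ℂ := Complex.exp (2 * Real.pi * t * Complex.I)

/-- `η_λ(r) = (e^{2λr} - 1) / (2λ)`, and `η_0(r) = r`. -/
def eta (r : ℝ) : ℝ := if lam = 0 then r else (Real.exp (2 * lam * r) - 1) / (2 * lam)

/-- The usual inner product on `ℝⁿ`. -/
def beta {n : ℕ} (x y : Fin n → ℝ) : ℝ := ∑ i, x i * y i

/-- The weight of `U`; the argument is `p = (x, y, r; x', y', r')`. -/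
def weightU (p : Fin 2 → Phase n) : ℂ :=
  let x := (p 0).1.1
  let y := (p 0).1.2
  let y' := (p 1).1.2
  let r' := (p 1).2
  (Real.exp (-lam * r') : ℂ) ^ n *
    ee (-(eta lam r' * beta (Real.exp (-lam * r') • x) (y' - Real.exp (-lam * r') • y)))

/-- The point of phase space at which `U ξ` evaluates `ξ`. -/
def mapU (p : Fin 2 → Phase n) : Fin 2 → Phase n :=
  let x := (p 0).1.1
  let y := (p 0).1.2
  let r := (p 0).2
  let x' := (p 1).1.1
  let y' := (p 1).1.2
  let r' := (p 1).2
  ![((Real.exp (-lam * r') • x, Real.exp (-lam * r') • y), r + r'),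
    ((x' - Real.exp (-lam * r') • x, y' - Real.exp (-lam * r') • y), r')]

/-- The multiplicative unitary `U` of the quantum Heisenberg group algebra:
`(Uξ)(p) = (e^{-λr'})ⁿ e(-η_λ(r') β(e^{-λr'}x, y' - e^{-λr'}y))
  ξ(e^{-λr'}x, e^{-λr'}y, r + r'; x' - e^{-λr'}x, y' - e^{-λr'}y, r')`. -/
def opU : Op (Phase n) 2 := weightedComp (weightU n lam) (mapU n lam)

theorem norm_ee (t : ℝ) : ‖ee t‖ = 1 := by
  rw [ee, show (2 * Real.pi * t * Complex.I : ℂ) = ((2 * Real.pi * t : ℝ) : ℂ) * Complex.I by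
    push_cast; ring]
  exact Complex.norm_exp_ofReal_mul_I _

theorem measurable_ee : Measurable ee := by unfold ee; fun_prop

theorem measurable_eta : Measurable (eta lam) := by
  unfold eta
  split_ifs <;> fun_prop

theorem isAddHaar_plane :
    (volume : Measure ((Fin n → ℝ) × (Fin n → ℝ))).IsAddHaarMeasure :=
  Measure.prod.instIsAddHaarMeasure _ _

theorem measurePreserving_scale (s : ℝ) (hs : s ≠ 0) :
    MeasurePreserving (fun e : (Fin n → ℝ) × (Fin n → ℝ) => s • e)
      (ENNReal.ofReal (|s| ^ (2 * n)) • volume) volume := by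
  have := isAddHaar_plane n
  refine ⟨by fun_prop, ?_⟩
  rw [Measure.map_smul, Measure.map_addHaar_smul _ hs, smul_smul,
    ← ENNReal.ofReal_mul (by positivity)]
  have : Module.finrank ℝ ((Fin n → ℝ) × (Fin n → ℝ)) = 2 * n := by simp [two_mul]
  rw [this, abs_inv, abs_pow, mul_inv_cancel₀ (by positivity)]
  simp

theorem measurePreserving_fiberU (s c : ℝ) (hs : 0 < s) :
    MeasurePreserving (fun q : Phase n × ((Fin n → ℝ) × (Fin n → ℝ)) =>
      (((s • q.1.1, q.1.2 + c) : Phase n), q.2 - s • q.1.1))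
      (ENNReal.ofReal (s ^ (2 * n)) • volume) volume := by
  have := isAddHaar_plane n
  have h1 := measurePreserving_scale n s hs.ne'
  rw [abs_of_pos hs] at h1
  have h2 : MeasurePreserving (fun r : ℝ => r + c) volume volume := measurePreserving_add_right _ c
  have h3 := h1.prod h2
  have h4 := h3.skew_product (μc := (volume : Measure ((Fin n → ℝ) × (Fin n → ℝ))))
    (μd := volume) (g := fun p e' => e' - s • p.1) (by fun_prop)
    (Filter.Eventually.of_forall fun p => (measurePreserving_sub_right _ _).map_eq)
  have h5 : ENNReal.ofReal (s ^ (2 * n)) •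
      (volume : Measure (Phase n × ((Fin n → ℝ) × (Fin n → ℝ)))) =
      ((ENNReal.ofReal (s ^ (2 * n)) • volume).prod volume).prod volume := by
    rw [Measure.prod_smul_left, Measure.prod_smul_left]
    rfl
  rw [h5]
  exact h4

theorem enorm_weight (s t : ℝ) (hs : 0 < s) :
    ‖(s : ℂ) ^ n * ee t‖ₑ ^ 2 = ENNReal.ofReal (s ^ (2 * n)) := by
  rw [← ofReal_norm, ← ENNReal.ofReal_pow (norm_nonneg _), norm_mul, norm_ee, norm_pow,
    Complex.norm_real, Real.norm_of_nonneg hs.le, mul_one, ← pow_mul, mul_comm n]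

theorem measurable_beta {α : Type} [MeasurableSpace α] {f g : α → Fin n → ℝ} (hf : Measurable f)
    (hg : Measurable g) : Measurable fun a => beta (f a) (g a) := by
  unfold beta
  exact Finset.measurable_sum _ fun i _ =>
    ((measurable_pi_apply i).comp hf).mul ((measurable_pi_apply i).comp hg)

theorem measurable_mapU : Measurable (mapU n lam) := by
  refine measurable_pi_lambda _ fun i => ?_
  fin_cases i
  · simp only [mapU]; fun_prop
  · simp only [mapU]; fun_prop

theorem measurable_weightU : Measurable (weightU n lam) := by
  have h1 := measurable_ee
  have h2 := measurable_eta lam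
  have h3 : Measurable fun p : Fin 2 → Phase n => beta (Real.exp (-lam * (p 1).2) • (p 0).1.1)
      ((p 1).1.2 - Real.exp (-lam * (p 1).2) • (p 0).1.2) :=
    measurable_beta n (by fun_prop) (by fun_prop)
  have h4 : Measurable fun p : Fin 2 → Phase n => eta lam (p 1).2 := h2.comp (by fun_prop)
  have h5 : Measurable fun p : Fin 2 → Phase n => (Real.exp (-lam * (p 1).2) : ℂ) ^ n := by fun_prop
  exact h5.mul (h1.comp (h4.mul h3).neg)

theorem lintegral_fst_snd (h : Phase n × Phase n → ℝ≥0∞) (hh : Measurable h) :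
    ∫⁻ p, h p =
      ∫⁻ r' : ℝ, ∫⁻ q : Phase n × ((Fin n → ℝ) × (Fin n → ℝ)), h (q.1, (q.2, r')) := by
  rw [Measure.volume_eq_prod, lintegral_prod_symm _ hh.aemeasurable, Measure.volume_eq_prod,
    lintegral_prod_symm _ hh.lintegral_prod_left'.aemeasurable]
  congr 1
  funext r'
  rw [Measure.volume_eq_prod (Phase n) ((Fin n → ℝ) × (Fin n → ℝ)),
    lintegral_prod_symm _ (by fun_prop)]
  rfl

theorem weightU_lintegral (g : (Fin 2 → Phase n) → ℝ≥0∞) (hg : Measurable g) :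
    ∫⁻ p, ‖weightU n lam p‖ₑ ^ 2 * g (mapU n lam p) = ∫⁻ p, g p := by
  have he := (volume_preserving_piFinTwo (fun _ => Phase n)).symm
  have hmap := measurable_mapU n lam
  have hwt := measurable_weightU n lam
  rw [← he.lintegral_comp_emb (MeasurableEquiv.measurableEmbedding _),
    ← he.lintegral_comp_emb (MeasurableEquiv.measurableEmbedding _),
    lintegral_fst_snd _ _ (by fun_prop), lintegral_fst_snd _ _ (by fun_prop)]
  congr 1
  funext r'
  have hs : 0 < Real.exp (-lam * r') := Real.exp_pos _
  have hf := measurePreserving_fiberU n (Real.exp (-lam * r')) r' hs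
  conv_rhs => rw [← hf.lintegral_comp (by fun_prop), lintegral_smul_measure, smul_eq_mul,
    ← lintegral_const_mul _ (by fun_prop)]
  congr 1
  funext q
  rw [weightU]
  erw [enorm_weight n _ _ hs]
  congr 2

theorem opU_coeFn (ξ : L2 (Phase n) 2) :
    opU n lam ξ =ᵐ[volume] fun p => weightU n lam p * ξ (mapU n lam p) := by
  refine weightedComp_coeFn (measurable_weightU n lam) (measurable_mapU n lam) (fun p => ?_)
    (weightU_lintegral n lam) ξ
  rw [weightU]
  refine mul_ne_zero (pow_ne_zero _ (by exact_mod_cast (Real.exp_pos _).ne')) ?_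
  rw [← norm_ne_zero_iff, norm_ee]
  exact one_ne_zero

/-- The weight of `j`. -/
def weightJ (p : Fin 1 → Phase n) : ℂ :=
  let x := (p 0).1.1
  let y := (p 0).1.2
  let r := (p 0).2
  (Real.exp (lam * r) : ℂ) ^ n * ee (-(eta lam r * beta x y))

/-- The point at which `j ξ` evaluates `ξ`. -/
def mapJ (p : Fin 1 → Phase n) : Fin 1 → Phase n :=
  let x := (p 0).1.1
  let y := (p 0).1.2
  let r := (p 0).2
  ![((-(Real.exp (lam * r) • x), -(Real.exp (lam * r) • y)), -r)]

/-- The involutive unitary `j`: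
`(jξ)(x, y, r) = (e^{λr})ⁿ e(-η_λ(r) β(x, y)) ξ(-e^{λr}x, -e^{λr}y, -r)`. -/
def opJ : Op (Phase n) 1 := weightedComp (weightJ n lam) (mapJ n lam)

theorem weightJ_lintegral (g : (Fin 1 → Phase n) → ℝ≥0∞) (hg : Measurable g) 
    (hmap : Measurable (mapJ n lam)) (hwt : Measurable (weightJ n lam)) :
    ∫⁻ p, ‖weightJ n lam p‖ₑ ^ 2 * g (mapJ n lam p) = ∫⁻ p, g p := by
  have he := (volume_preserving_piUnique (fun _ : Fin 1 => Phase n)).symm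
  have key : ∀ h : Phase n → ℝ≥0∞, Measurable h → ∫⁻ p, h p =
      ∫⁻ r : ℝ, ∫⁻ e : (Fin n → ℝ) × (Fin n → ℝ), h (e, r) := by
    intro h hh
    rw [Measure.volume_eq_prod, lintegral_prod_symm _ hh.aemeasurable]
  rw [← he.lintegral_comp_emb (MeasurableEquiv.measurableEmbedding _),
    ← he.lintegral_comp_emb (MeasurableEquiv.measurableEmbedding _),
    key _ (by fun_prop), key _ (by fun_prop)]
  conv_rhs => rw [← lintegral_neg_eq_self]
  congr 1
  funext r
  have hs : 0 < Real.exp (lam * r) := Real.exp_pos _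
  have hf := measurePreserving_scale n (-Real.exp (lam * r)) (by linarith)
  rw [abs_neg, abs_of_pos hs] at hf
  conv_rhs => rw [← hf.lintegral_comp (by fun_prop), lintegral_smul_measure, smul_eq_mul,
    ← lintegral_const_mul _ (by fun_prop)]
  congr 1
  funext q
  rw [weightJ]
  erw [enorm_weight n _ _ hs]
  congr 2
  funext i
  fin_cases i
  simp [mapJ]
  rfl

theorem opJ_coeFn (ξ : L2 (Phase n) 1) :
    opJ n lam ξ =ᵐ[volume] fun p => weightJ n lam p * ξ (mapJ n lam p) := by
  have hmap : Measurable (mapJ n lam) := by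
    refine measurable_pi_lambda _ fun i => ?_
    fin_cases i
    simp only [mapJ]; fun_prop
  have hwt : Measurable (weightJ n lam) := by
    have h1 := measurable_ee
    have h2 := measurable_eta lam
    have h3 : Measurable fun p : Fin 1 → Phase n => beta (p 0).1.1 (p 0).1.2 :=
      measurable_beta n (by fun_prop) (by fun_prop)
    have h4 : Measurable fun p : Fin 1 → Phase n => eta lam (p 0).2 := h2.comp (by fun_prop)
    have h5 : Measurable fun p : Fin 1 → Phase n => (Real.exp (lam * (p 0).2) : ℂ) ^ n := by fun_prop
    exact h5.mul (h1.comp (h4.mul h3).neg)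
  refine weightedComp_coeFn hwt hmap (fun p => ?_) 
    (fun g hg => weightJ_lintegral n lam g hg hmap hwt) ξ
  rw [weightJ]
  refine mul_ne_zero (pow_ne_zero _ (by exact_mod_cast (Real.exp_pos _).ne')) ?_
  rw [← norm_ne_zero_iff, norm_ee]
  exact one_ne_zero

/-- `Û = Σ (j ⊗ 1) U (j ⊗ 1) Σ`, also denoted `Y`. -/
def opY : Op (Phase n) 2 :=
  flipOp * opTensor (opJ n lam) (1 : Op (Phase n) 1) * opU n lam *
    opTensor (opJ n lam) (1 : Op (Phase n) 1) * flipOp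

/-- `X = Σ Û* Σ`. -/
def opX : Op (Phase n) 2 := flipOp * star (opY n lam) * flipOp

/-- `Z = Y* (j ⊗ j) Y (j ⊗ j)`. -/
def opZ : Op (Phase n) 2 :=
  star (opY n lam) *
    (opTensor (opJ n lam) (opJ n lam) * opY n lam * opTensor (opJ n lam) (opJ n lam))

/-- The `C*`-algebra `A` generated by the left slices of `U`. -/
def algA : NonUnitalStarSubalgebra ℂ (Op (Phase n) 1) :=
  cstarGenerated (leftSlices (a := 1) (b := 1) (opU n lam))

/-- The `C*`-algebra `Âᵒᵖ` generated by the right slices of `X`. -/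
def algHatOp : NonUnitalStarSubalgebra ℂ (Op (Phase n) 1) :=
  cstarGenerated (rightSlices (a := 1) (b := 1) (opX n lam))

/-- `Δ(a) = U (a ⊗ 1) U*`. -/
def comulA (S : Op (Phase n) 1) : Op (Phase n) 2 :=
  opU n lam * opTensor S (1 : Op (Phase n) 1) * star (opU n lam)

/-- `Δ̂(b) = X* (1 ⊗ b) X` on `Âᵒᵖ`. -/
def comulHat (S : Op (Phase n) 1) : Op (Phase n) 2 :=
  star (opX n lam) * opTensor (1 : Op (Phase n) 1) S * opX n lam
end
end
end QuantumHeisenberg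

set_option linter.unusedSectionVars false

namespace QuantumHeisenberg
noncomputable section

section legs
variable {X : Type} [MeasureSpace X] [SigmaFinite (volume : Measure X)]

/-! ### Reindexing of tensor factors -/

/-! Everything in the construction is conjugation by a unitary composed with a permutation of tensor
legs, so the theorem comes down to relations between unitaries and to the way these unitaries
multiply the algebras. Write T_ij for an operator on two legs placed on the legs i, j (`amp`), and K
for the compact operators.

Analytic input. U, Y and their conjugates by j are weighted composition operators. An identity
between products of them is an identity between point maps and weights, in which η_λ enters through
the cocycle relation `eta_add`. In this way U is shown to satisfy the pentagon equation, and so is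
Y, because Y_ij = j_j U_ji j_j (`legY_eq`). Both are regular, that is (K ⊗ 1)V(1 ⊗ K) = K ⊗ K: after
a change of variables, the operators obtained from V by fixing one vector on each side have square
integrable kernels, and these kernels are the images of elementary tensors under a unitary
(`cpt_mul_pt_mul_cpt_of_kernel`).

Algebras from regularity. Following Baaj and Skandalis, let A be the closed span of the left slices
of a regular V, so that (K ⊗ 1)V(K ⊗ 1) = K ⊗ A. Closed spaces of operators form a monoid under the
closed span of products (`OpSpace`), and in this monoid the pentagon and regularity give by pure
word calculations A*A = A, V(K ⊗ A) = K ⊗ A, and V(A ⊗ 1)V*(A ⊗ A) = A ⊗ A. Hence A is a C*-algebra,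
and a ↦ V(a ⊗ 1)V* is a nondegenerate comultiplication whose coassociativity is the pentagon. This
applies to U, with slices A, and to Y, with slices Âᵒᵖ. The right slices of Y are again A, so Y is a
multiplier of A ⊗ Âᵒᵖ (`legY_mul`).

The inversion. One has Z = Y*R with R = (j ⊗ j)Y(j ⊗ j), and R commutes with A ⊗ Âᵒᵖ
(`commute_opR`). So τ(p) = ΣY*pYΣ, which is an isomorphism onto Âᵒᵖ ⊗ A because Y is a multiplier.
Conjugating the pentagon of U by j on one leg gives U_ij Y_ik = Y_ik Y_jk U_ij (`legU_mul_legY`).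
This relation and the pentagon of Y are the two inversion identities. Coassociativity of δ_τ is an
equality of two words of unitaries up to a tail that commutes with the argument (`twist_mul_twist`).
-/

theorem measurePreserving_reindex {k m : ℕ} (e : Fin k ≃ Fin m) :
    MeasurePreserving (fun (x : Fin m → X) i => x (e i)) volume volume :=
  (volume_measurePreserving_piCongrLeft (fun _ : Fin m => X) e).symm

/-- The unitary `(R_e ξ)(x) = ξ(x ∘ e)`. -/
def reindexL2 {k m : ℕ} (e : Fin k ≃ Fin m) : L2 X k →L[ℂ] L2 X m :=
  (Lp.compMeasurePreservingₗᵢ ℂ _ (measurePreserving_reindex e)).toContinuousLinearMap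

theorem reindexL2_coeFn {k m : ℕ} (e : Fin k ≃ Fin m) (ξ : L2 X k) :
    reindexL2 e ξ =ᵐ[volume] fun x => ξ (fun i => x (e i)) :=
  Lp.coeFn_compMeasurePreserving ξ (measurePreserving_reindex e)

theorem reindexL2_reindexL2 {k m p : ℕ} (e : Fin k ≃ Fin m) (e' : Fin m ≃ Fin p) (ξ : L2 X k) :
    reindexL2 e' (reindexL2 e ξ) = reindexL2 (e.trans e') ξ := by
  ext1
  filter_upwards [reindexL2_coeFn e' (reindexL2 e ξ), reindexL2_coeFn (e.trans e') ξ,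
    (measurePreserving_reindex (X := X) e').quasiMeasurePreserving.ae (reindexL2_coeFn e ξ)]
    with x h1 h2 h3
  rw [h1, h2, h3]
  rfl

theorem reindexL2_refl {k : ℕ} (ξ : L2 X k) : reindexL2 (Equiv.refl _) ξ = ξ := by
  ext1
  filter_upwards [reindexL2_coeFn (Equiv.refl _) ξ] with x h
  rw [h]
  rfl

theorem reindexL2_symm_apply {k m : ℕ} (e : Fin k ≃ Fin m) (ξ : L2 X k) :
    reindexL2 e.symm (reindexL2 e ξ) = ξ := by
  rw [reindexL2_reindexL2, Equiv.self_trans_symm, reindexL2_refl]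

theorem reindexL2_apply_symm {k m : ℕ} (e : Fin k ≃ Fin m) (ξ : L2 X m) :
    reindexL2 e (reindexL2 e.symm ξ) = ξ := by
  rw [reindexL2_reindexL2, Equiv.symm_trans_self, reindexL2_refl]

theorem inner_reindexL2 {k m : ℕ} (e : Fin k ≃ Fin m) (ξ η : L2 X k) :
    ⟪reindexL2 e ξ, reindexL2 e η⟫_ℂ = ⟪ξ, η⟫_ℂ :=
  LinearIsometry.inner_map_map (Lp.compMeasurePreservingₗᵢ ℂ _ (measurePreserving_reindex e)) ξ η

theorem inner_reindexL2_left {k m : ℕ} (e : Fin k ≃ Fin m) (ξ : L2 X k) (η : L2 X m) :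
    ⟪reindexL2 e ξ, η⟫_ℂ = ⟪ξ, reindexL2 e.symm η⟫_ℂ := by
  rw [← inner_reindexL2 e ξ, reindexL2_apply_symm]

/-- The sum of two equivalences. -/
def finAddCongr {a b a' b' : ℕ} (e : Fin a ≃ Fin a') (f : Fin b ≃ Fin b') :
    Fin (a + b) ≃ Fin (a' + b') :=
  finSumFinEquiv.symm.trans ((Equiv.sumCongr e f).trans finSumFinEquiv)

@[simp] theorem finAddCongr_castAdd {a b a' b' : ℕ} (e : Fin a ≃ Fin a') (f : Fin b ≃ Fin b')
    (i : Fin a) : finAddCongr e f (Fin.castAdd b i) = Fin.castAdd b' (e i) := by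
  simp [finAddCongr]

@[simp] theorem finAddCongr_natAdd {a b a' b' : ℕ} (e : Fin a ≃ Fin a') (f : Fin b ≃ Fin b')
    (i : Fin b) : finAddCongr e f (Fin.natAdd a i) = Fin.natAdd a' (f i) := by
  simp [finAddCongr]

theorem finAddCongr_symm {a b a' b' : ℕ} (e : Fin a ≃ Fin a') (f : Fin b ≃ Fin b') :
    (finAddCongr e f).symm = finAddCongr e.symm f.symm := rfl

theorem reindexL2_vecTensor {a b a' b' : ℕ} (e : Fin a ≃ Fin a') (f : Fin b ≃ Fin b')
    (ξ : L2 X a) (η : L2 X b) :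
    reindexL2 (finAddCongr e f) (vecTensor a b ξ η) =
      vecTensor a' b' (reindexL2 e ξ) (reindexL2 f η) := by
  ext1
  filter_upwards [reindexL2_coeFn (finAddCongr e f) (vecTensor a b ξ η),
    (measurePreserving_reindex (X := X) (finAddCongr e f)).quasiMeasurePreserving.ae
      (vecTensor_coeFn ξ η), vecTensor_coeFn (reindexL2 e ξ) (reindexL2 f η),
    ae_split_fst b' (reindexL2_coeFn e ξ), ae_split_snd a' (reindexL2_coeFn f η)]
    with x h1 h2 h3 h4 h5
  rw [h1, h2, h3, h4, h5]
  simp [split]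

theorem reindexL2_vecTensor_assoc {a b c : ℕ} (ξ : L2 X a) (η : L2 X b) (ζ : L2 X c) :
    reindexL2 (finCongr (Nat.add_assoc a b c)) (vecTensor (a + b) c (vecTensor a b ξ η) ζ) =
      vecTensor a (b + c) ξ (vecTensor b c η ζ) := by
  ext1
  have hm := (measurePreserving_reindex (X := X)
    (finCongr (Nat.add_assoc a b c))).quasiMeasurePreserving
  filter_upwards [reindexL2_coeFn (finCongr (Nat.add_assoc a b c))
      (vecTensor (a + b) c (vecTensor a b ξ η) ζ),
    hm.ae (vecTensor_coeFn (vecTensor a b ξ η) ζ),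
    hm.ae (ae_split_fst c (vecTensor_coeFn ξ η)),
    vecTensor_coeFn ξ (vecTensor b c η ζ),
    ae_split_snd a (vecTensor_coeFn η ζ)] with x h1 h2 h3 h4 h5
  rw [h1, h2, h3, h4, h5, mul_assoc]
  simp only [split, finCongr_apply, Fin.natAdd_castAdd, Fin.natAdd_natAdd]
  rfl

theorem reindexL2_vecTensor_flip {a b : ℕ} (ξ : L2 X a) (η : L2 X b) :
    reindexL2 finAddFlip (vecTensor a b ξ η) = vecTensor b a η ξ := by
  ext1
  filter_upwards [reindexL2_coeFn finAddFlip (vecTensor a b ξ η),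
    (measurePreserving_reindex (X := X) finAddFlip).quasiMeasurePreserving.ae
      (vecTensor_coeFn ξ η), vecTensor_coeFn η ξ] with x h1 h2 h3
  rw [h1, h2, h3, mul_comm]
  simp [split]

/-! ### Algebra of tensor products of operators -/

/-- Elementary tensors span a dense subspace. Operator identities on tensor products are checked on
them throughout. -/
theorem clm_ext_vecTensor {a b : ℕ} {F : Type*} [NormedAddCommGroup F] [NormedSpace ℂ F]
    {T S : L2 X (a + b) →L[ℂ] F}
    (h : ∀ ξ η, T (vecTensor a b ξ η) = S (vecTensor a b ξ η)) : T = S := by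
  have : (T : L2 X (a + b) → F) = S := by
    refine (denseRange_tensorIsometry (X := X) a b).equalizer T.continuous S.continuous ?_
    have h2 : T.toLinearMap ∘ₗ (tensorIsometry (X := X) a b).toLinearMap =
        S.toLinearMap ∘ₗ (tensorIsometry (X := X) a b).toLinearMap := by
      refine TensorProduct.ext' fun ξ η => ?_
      have := h ξ η
      rw [← tensorIsometry_tmul] at this
      exact this
    funext p
    exact congrArg (fun L => L p) h2
  exact DFunLike.coe_injective this

theorem ext_inner_vecTensor {a b : ℕ} {u v : L2 X (a + b)}
    (h : ∀ ξ η, ⟪vecTensor a b ξ η, u⟫_ℂ = ⟪vecTensor a b ξ η, v⟫_ℂ) : u = v := by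
  have : innerSL ℂ u = innerSL ℂ v := by
    refine clm_ext_vecTensor fun ξ η => ?_
    simp only [innerSL_apply_apply]
    rw [← inner_conj_symm, h, inner_conj_symm]
  refine ext_inner_right ℂ fun w => ?_
  exact congrArg (fun L : L2 X (a + b) →L[ℂ] ℂ => L w) this

section opTensor
variable {a b : ℕ}

theorem opTensor_mul (T T' : Op X a) (S S' : Op X b) :
    opTensor T S * opTensor T' S' = opTensor (T * T') (S * S') := by
  refine clm_ext_vecTensor fun ξ η => ?_
  simp only [mul_apply_eq_comp, opTensor_vecTensor]

theorem opTensor_one : opTensor (1 : Op X a) (1 : Op X b) = 1 := by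
  refine clm_ext_vecTensor fun ξ η => ?_
  simp only [one_apply_eq_self, opTensor_vecTensor]

theorem opTensor_add_left (T T' : Op X a) (S : Op X b) :
    opTensor (T + T') S = opTensor T S + opTensor T' S := by
  refine clm_ext_vecTensor fun ξ η => ?_
  simp only [add_apply, opTensor_vecTensor, map_add, LinearMap.add_apply]

theorem opTensor_smul_left (c : ℂ) (T : Op X a) (S : Op X b) :
    opTensor (c • T) S = c • opTensor T S := by
  refine clm_ext_vecTensor fun ξ η => ?_
  simp only [smul_apply, opTensor_vecTensor, map_smul, LinearMap.smul_apply]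

theorem star_opTensor (T : Op X a) (S : Op X b) :
    star (opTensor T S) = opTensor (star T) (star S) := by
  refine clm_ext_vecTensor fun ξ η => ext_inner_vecTensor fun ξ' η' => ?_
  rw [ContinuousLinearMap.star_eq_adjoint, ContinuousLinearMap.adjoint_inner_right,
    opTensor_vecTensor, opTensor_vecTensor, inner_vecTensor, inner_vecTensor,
    ContinuousLinearMap.star_eq_adjoint, ContinuousLinearMap.star_eq_adjoint,
    ContinuousLinearMap.adjoint_inner_right, ContinuousLinearMap.adjoint_inner_right]

theorem opTensor_commute (T : Op X a) (S : Op X b) :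
    Commute (opTensor T (1 : Op X b)) (opTensor (1 : Op X a) S) := by
  rw [Commute, SemiconjBy, opTensor_mul, opTensor_mul, mul_one, one_mul, one_mul, mul_one]

end opTensor

/-! ### Operators acting on some of the legs -/

/-- Conjugation by a reindexing unitary. -/
def reindexOp {k m : ℕ} (e : Fin k ≃ Fin m) : Op X k →⋆ₐ[ℂ] Op X m where
  toFun T := (reindexL2 e).comp (T.comp (reindexL2 e.symm))
  map_one' := by
    ext1 ξ
    simp [reindexL2_apply_symm]
  map_mul' T S := by
    ext1 ξ
    simp [reindexL2_symm_apply]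
  map_zero' := by ext1 ξ; simp
  map_add' T S := by ext1 ξ; simp
  commutes' c := by
    ext1 ξ
    simp [Algebra.algebraMap_eq_smul_one, reindexL2_apply_symm]
  map_star' T := by
    ext1 ξ
    refine ext_inner_left ℂ fun η => ?_
    simp only [ContinuousLinearMap.star_eq_adjoint, ContinuousLinearMap.adjoint_inner_right,
      ContinuousLinearMap.comp_apply]
    rw [inner_reindexL2_left, ← inner_reindexL2 e.symm η, reindexL2_symm_apply,
      ContinuousLinearMap.adjoint_inner_right]

theorem reindexOp_apply {k m : ℕ} (e : Fin k ≃ Fin m) (T : Op X k) (ξ : L2 X m) :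
    reindexOp e T ξ = reindexL2 e (T (reindexL2 e.symm ξ)) := rfl

theorem reindexOp_reindexOp {k m p : ℕ} (e : Fin k ≃ Fin m) (e' : Fin m ≃ Fin p) (T : Op X k) :
    reindexOp e' (reindexOp e T) = reindexOp (e.trans e') T := by
  ext1 ξ
  simp only [reindexOp_apply, reindexL2_reindexL2]
  rfl

theorem reindexOp_refl {k : ℕ} (T : Op X k) : reindexOp (Equiv.refl _) T = T := by
  ext1 ξ
  simp [reindexOp_apply, reindexL2_refl]

theorem reindexOp_opTensor {a b a' b' : ℕ} (e : Fin a ≃ Fin a') (f : Fin b ≃ Fin b')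
    (T : Op X a) (S : Op X b) :
    reindexOp (finAddCongr e f) (opTensor T S) = opTensor (reindexOp e T) (reindexOp f S) := by
  refine clm_ext_vecTensor fun ξ η => ?_
  simp only [reindexOp_apply, finAddCongr_symm, reindexL2_vecTensor, opTensor_vecTensor]

theorem reindexOp_opTensor_assoc {a b c : ℕ} (T : Op X a) (S : Op X b) (R : Op X c) :
    reindexOp (finCongr (Nat.add_assoc a b c)) (opTensor (opTensor T S) R) =
      opTensor T (opTensor S R) := by
  have h : ∀ ξ η ζ, reindexOp (finCongr (Nat.add_assoc a b c)) (opTensor (opTensor T S) R)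
      (vecTensor a (b + c) ξ (vecTensor b c η ζ)) =
      opTensor T (opTensor S R) (vecTensor a (b + c) ξ (vecTensor b c η ζ)) := by
    intro ξ η ζ
    rw [reindexOp_apply, ← reindexL2_vecTensor_assoc, reindexL2_symm_apply]
    simp only [opTensor_vecTensor, reindexL2_vecTensor_assoc]
  refine clm_ext_vecTensor fun ξ η => ?_
  -- With `ξ` fixed, both sides are operators in the last two factors. Density there passes from
  -- threefold elementary tensors to `ξ ⊗ η` with `η` arbitrary.
  have := clm_ext_vecTensor (T := (reindexOp (finCongr (Nat.add_assoc a b c))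
      (opTensor (opTensor T S) R)).comp (tensorLeft ξ (b + c)))
    (S := (opTensor T (opTensor S R)).comp (tensorLeft ξ (b + c))) (fun η ζ => by
      simpa [tensorLeft, tensorIsometry_tmul] using h ξ η ζ)
  simpa [tensorLeft, tensorIsometry_tmul] using congrArg (fun L => L η) this

theorem reindexOp_opTensor_flip {a b : ℕ} (T : Op X a) (S : Op X b) :
    reindexOp finAddFlip (opTensor T S) = opTensor S T := by
  refine clm_ext_vecTensor fun ξ η => ?_
  rw [reindexOp_apply, ← reindexL2_vecTensor_flip, reindexL2_symm_apply, opTensor_vecTensor,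
    reindexL2_vecTensor_flip, reindexL2_vecTensor_flip, opTensor_vecTensor]

/-- `T ↦ T ⊗ 1`. -/
def tensorOne (k l : ℕ) : Op X k →⋆ₐ[ℂ] Op X (k + l) where
  toFun T := opTensor T 1
  map_one' := opTensor_one
  map_mul' T S := by rw [opTensor_mul, one_mul]
  map_zero' := by simpa using opTensor_smul_left (0 : ℂ) (0 : Op X k) (1 : Op X l)
  map_add' T S := opTensor_add_left T S 1
  commutes' c := by
    rw [Algebra.algebraMap_eq_smul_one, Algebra.algebraMap_eq_smul_one, opTensor_smul_left,
      opTensor_one]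
  map_star' T := by rw [star_opTensor, star_one]

/-- The complement of the range of `f` is enumerated in an arbitrary order. The order is irrelevant
for `amp` by `amp_eq`. -/
theorem exists_equiv_extending {k m : ℕ} (f : Fin k ↪ Fin m) :
    ∃ (l : ℕ) (e : Fin (k + l) ≃ Fin m), ∀ i, e (Fin.castAdd l i) = f i := by
  classical
  let g : Fin (Fintype.card {j // j ∉ Set.range f}) ≃ {j // j ∉ Set.range f} :=
    (Fintype.equivFin _).symm
  refine ⟨_, finSumFinEquiv.symm.trans (((Equiv.ofInjective f f.injective).sumCongr g).trans
    (Equiv.Set.sumCompl (Set.range f))), fun i => ?_⟩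
  simp only [Equiv.trans_apply, finSumFinEquiv_symm_apply_castAdd, Equiv.sumCongr_apply,
    Sum.map_inl, Equiv.ofInjective_apply]
  rfl

/-- `T` acting on the legs selected by `f`. -/
def amp {k m : ℕ} (f : Fin k ↪ Fin m) : Op X k →⋆ₐ[ℂ] Op X m :=
  (reindexOp (exists_equiv_extending f).choose_spec.choose).comp (tensorOne k _)

/-- Two bijections extending `f` differ by a permutation fixing the first `k` legs. Such a
permutation only permutes the remaining legs, where the operator is the identity. -/
theorem amp_eq {k l m : ℕ} {f : Fin k ↪ Fin m} (e : Fin (k + l) ≃ Fin m)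
    (he : ∀ i, e (Fin.castAdd l i) = f i) (T : Op X k) :
    amp f T = reindexOp e (opTensor T 1) := by
  set l' := (exists_equiv_extending f).choose
  set e' : Fin (k + l') ≃ Fin m := (exists_equiv_extending f).choose_spec.choose
  have he' : ∀ i, e' (Fin.castAdd l' i) = f i := (exists_equiv_extending f).choose_spec.choose_spec
  change reindexOp e' (opTensor T 1) = _
  clear_value e'
  clear_value l'
  have hl : l' = l := by
    have h1 := Fintype.card_congr e
    have h2 := Fintype.card_congr e'
    simp only [Fintype.card_fin] at h1 h2
    omega
  subst hl
  -- The comparison `g` fixes the first `k` indices, so by injectivity it maps the last `l'` indices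
  -- to themselves. The resulting permutation of them is `s`.
  let g : Fin (k + l') ≃ Fin (k + l') := e.trans e'.symm
  have hg : ∀ i, g (Fin.castAdd l' i) = Fin.castAdd l' i := fun i => by
    simp [g, he, ← he']
  have hg2 : ∀ j, k ≤ (g (Fin.natAdd k j) : ℕ) := by
    intro j
    by_contra! h
    have h3 := hg ⟨_, h⟩
    have h4 : Fin.castAdd l' ⟨(g (Fin.natAdd k j) : ℕ), h⟩ = g (Fin.natAdd k j) := rfl
    rw [h4] at h3
    have h5 := g.injective h3
    rw [h5] at h
    simp at h
  have hs : Function.Injective (fun j : Fin l' => (⟨(g (Fin.natAdd k j) : ℕ) - k, by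
      have := (g (Fin.natAdd k j)).2; have := hg2 j; omega⟩ : Fin l')) := by
    intro i j hij
    simp only [Fin.mk.injEq] at hij
    have h1 := hg2 i
    have h2 := hg2 j
    have h3 : g (Fin.natAdd k i) = g (Fin.natAdd k j) := by ext; omega
    simpa using g.injective h3
  let s : Fin l' ≃ Fin l' := Equiv.ofBijective _ (Finite.injective_iff_bijective.1 hs)
  have hgs : g = finAddCongr (Equiv.refl _) s := by
    ext1 i
    refine Fin.addCases (fun i => ?_) (fun j => ?_) i
    · rw [hg, finAddCongr_castAdd]; rfl
    · rw [finAddCongr_natAdd]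
      ext
      have := hg2 j
      simp only [s, Equiv.ofBijective_apply, Fin.val_natAdd]
      omega
  have hee : e = (finAddCongr (Equiv.refl _) s).trans e' := by
    rw [← hgs]
    ext1 i
    simp [g]
  rw [hee, ← reindexOp_reindexOp, reindexOp_opTensor, reindexOp_refl, map_one]

/-- Extending `f` and then `g` to bijections yields, after reassociation, a bijection extending the
composite, and `amp_eq` permits this particular choice. -/
theorem amp_amp {k m p : ℕ} {f : Fin k ↪ Fin m} {g : Fin m ↪ Fin p} {h : Fin k ↪ Fin p}
    (hfg : ∀ i, g (f i) = h i) (T : Op X k) : amp g (amp f T) = amp h T := by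
  obtain ⟨l, e, he⟩ := exists_equiv_extending f
  obtain ⟨l', e', he'⟩ := exists_equiv_extending g
  rw [amp_eq e he, amp_eq e' he', ← map_one (reindexOp (X := X) (Equiv.refl (Fin l'))),
    ← reindexOp_opTensor, ← reindexOp_refl (opTensor (opTensor T _) _)]
  have : reindexOp (Equiv.refl _) (opTensor (opTensor T (1 : Op X l)) (1 : Op X l')) =
      reindexOp (finCongr (Nat.add_assoc k l l')).symm (opTensor T (1 : Op X (l + l'))) := by
    rw [← opTensor_one, ← reindexOp_opTensor_assoc, reindexOp_reindexOp, Equiv.self_trans_symm]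
  rw [this, reindexOp_reindexOp, reindexOp_reindexOp]
  symm
  refine amp_eq _ (fun i => ?_) T
  have : (finCongr (Nat.add_assoc k l l')).symm (Fin.castAdd (l + l') i) =
      Fin.castAdd l' (Fin.castAdd l i) := rfl
  rw [Equiv.trans_apply, Equiv.trans_apply, this, finAddCongr_castAdd, he, he', hfg]

theorem amp_castAdd {k l : ℕ} (T : Op X k) : amp (Fin.castAddEmb l) T = opTensor T (1 : Op X l) := by
  rw [amp_eq (Equiv.refl _) (fun i => rfl), reindexOp_refl]

theorem amp_natAdd {k l : ℕ} (T : Op X k) : amp (Fin.natAddEmb l) T = opTensor (1 : Op X l) T := by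
  rw [amp_eq finAddFlip (fun i => by simp), reindexOp_opTensor_flip]

theorem opTensor_eq_amp {k l : ℕ} (T : Op X k) (S : Op X l) :
    opTensor T S = amp (Fin.castAddEmb l) T * amp (Fin.natAddEmb k) S := by
  rw [amp_castAdd, amp_natAdd, opTensor_mul, mul_one, one_mul]

theorem amp_equiv {k m : ℕ} (e : Fin k ≃ Fin m) (T : Op X k) :
    amp e.toEmbedding T = reindexOp e T := by
  rw [amp_eq (l := 0) e (fun i => rfl)]
  congr 1
  refine clm_ext_vecTensor fun ξ η => ?_
  rw [opTensor_vecTensor]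
  -- The space `X^0` is a point, so the second tensor factor is a scalar.
  have : ∀ ζ : L2 X k, vecTensor k 0 ζ η = (η default) • ζ := by
    intro ζ
    ext1
    filter_upwards [vecTensor_coeFn ζ η, Lp.coeFn_smul (η default) ζ] with x h1 h2
    have h3 : (split k 0 x).2 = default := Subsingleton.elim _ _
    refine h1.trans (Eq.trans ?_ h2.symm)
    rw [h3, mul_comm]
    rfl
  rw [one_apply_eq_self, this]
  refine Eq.trans ?_ (congrArg T (this ξ)).symm
  exact (map_smul T _ _).symm

theorem amp_id {k : ℕ} {f : Fin k ↪ Fin k} (hf : ∀ i, f i = i) (T : Op X k) : amp f T = T := by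
  have : f = (Equiv.refl _).toEmbedding := by ext1 i; exact hf i
  rw [this, amp_equiv, reindexOp_refl]

theorem exists_embedding_extending {k l m : ℕ} {f : Fin k ↪ Fin m} {g : Fin l ↪ Fin m}
    (hd : ∀ i j, f i ≠ g j) : ∃ h : Fin (k + l) ↪ Fin m,
      (∀ i, h (Fin.castAdd l i) = f i) ∧ ∀ j, h (Fin.natAdd k j) = g j := by
  have hi : Function.Injective (Fin.addCases (motive := fun _ => Fin m) f g) := by
    intro x y
    refine Fin.addCases (fun i => ?_) (fun i => ?_) x <;>
      refine Fin.addCases (fun j => ?_) (fun j => ?_) y <;>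
      simp only [Fin.addCases_left, Fin.addCases_right] <;> intro h
    · rw [f.injective h]
    · exact absurd h (hd _ _)
    · exact absurd h.symm (hd _ _)
    · rw [g.injective h]
  exact ⟨⟨_, hi⟩, fun i => by simp, fun j => by simp⟩

/-- Disjoint embeddings are the two halves of a single embedding of `Fin (k + l)`. Before it is
applied, the operators are `T ⊗ 1` and `1 ⊗ S`. -/
theorem amp_commute {k l m : ℕ} {f : Fin k ↪ Fin m} {g : Fin l ↪ Fin m}
    (hd : ∀ i j, f i ≠ g j) (T : Op X k) (S : Op X l) : Commute (amp f T) (amp g S) := by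
  obtain ⟨h, h1, h2⟩ := exists_embedding_extending hd
  rw [← amp_amp (g := h) (f := Fin.castAddEmb l) h1, ← amp_amp (g := h) (f := Fin.natAddEmb k) h2,
    amp_castAdd, amp_natAdd]
  exact (opTensor_commute T S).map (amp h)

end legs

/-! ### The monoid of closed subspaces of operators -/

section spaces
variable {X : Type} [MeasureSpace X] [SigmaFinite (volume : Measure X)]

/-- Norm closed subspaces of `B(L²(X^m))`, with the closed span of products as multiplication. -/
abbrev OpSpace (X : Type) [MeasureSpace X] (m : ℕ) : Type := ClosedSubmodule ℂ (Op X m)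

namespace OpSpace

/-- The closed span. -/
def clSpan {m : ℕ} (s : Set (Op X m)) : OpSpace X m := (Submodule.span ℂ s).closure

variable {k l m p : ℕ}

theorem clSpan_le {s : Set (Op X m)} {G : OpSpace X m} : clSpan s ≤ G ↔ s ⊆ G := by
  rw [clSpan, Submodule.closure_le, Submodule.span_le]
  rfl

theorem subset_clSpan (s : Set (Op X m)) : s ⊆ clSpan s := clSpan_le.1 le_rfl

theorem mem_clSpan {s : Set (Op X m)} {T : Op X m} (h : T ∈ s) : T ∈ clSpan s := subset_clSpan s h

theorem clSpan_mono {s t : Set (Op X m)} (h : s ⊆ t) : clSpan s ≤ clSpan t :=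
  clSpan_le.2 (h.trans (subset_clSpan t))

theorem clSpan_coe (E : OpSpace X m) : clSpan (E : Set (Op X m)) = E :=
  le_antisymm (clSpan_le.2 le_rfl) (subset_clSpan _)

theorem coe_clSpan (s : Set (Op X m)) :
    (clSpan s : Set (Op X m)) = closure (Submodule.span ℂ s : Set (Op X m)) := rfl

instance : Mul (OpSpace X m) where
  mul E F := clSpan (Set.image2 (· * ·) (E : Set (Op X m)) F)

instance : One (OpSpace X m) where
  one := clSpan {1}

theorem mul_le {E F G : OpSpace X m} : E * F ≤ G ↔ ∀ x ∈ E, ∀ y ∈ F, x * y ∈ G :=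
  clSpan_le.trans Set.image2_subset_iff

theorem mul_mem_mul {E F : OpSpace X m} {x y : Op X m} (hx : x ∈ E) (hy : y ∈ F) : x * y ∈ E * F :=
  mul_le.1 le_rfl x hx y hy

theorem mul_mono {E E' F F' : OpSpace X m} (h : E ≤ E') (h' : F ≤ F') : E * F ≤ E' * F' :=
  mul_le.2 fun _ hx _ hy => mul_mem_mul (h hx) (h' hy)

/-- Multiplication is linear and continuous in each variable, so generators suffice in one variable
and then in the other. Associativity and the calculations with generating sets rest on this. -/
theorem clSpan_mul_clSpan (s t : Set (Op X m)) :
    clSpan s * clSpan t = clSpan (Set.image2 (· * ·) s t) := by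
  apply le_antisymm
  · rw [mul_le]
    set G := clSpan (Set.image2 (· * ·) s t)
    have h1 : ∀ y ∈ t, clSpan s ≤ G.comap ((ContinuousLinearMap.mul ℂ (Op X m)).flip y) :=
      fun y hy => clSpan_le.2 fun x hx => mem_clSpan (Set.mem_image2_of_mem hx hy)
    have h2 : ∀ x ∈ clSpan s, clSpan t ≤ G.comap (ContinuousLinearMap.mul ℂ (Op X m) x) :=
      fun x hx => clSpan_le.2 fun y hy => h1 y hy hx
    exact fun x hx y hy => h2 x hx hy
  · exact clSpan_le.2 (Set.image2_subset_iff.2 fun x hx y hy =>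
      mul_mem_mul (mem_clSpan hx) (mem_clSpan hy))

instance : Monoid (OpSpace X m) where
  mul_assoc E F G := by
    rw [← clSpan_coe E, ← clSpan_coe F, ← clSpan_coe G]
    simp only [clSpan_mul_clSpan]
    rw [Set.image2_assoc mul_assoc]
  one_mul E := by
    change clSpan {1} * E = E
    rw [← clSpan_coe E]
    simp [clSpan_mul_clSpan]
  mul_one E := by
    change E * clSpan {1} = E
    rw [← clSpan_coe E]
    simp [clSpan_mul_clSpan]

/-- The line spanned by an operator. -/
def pt (T : Op X m) : OpSpace X m := clSpan {T}

theorem mem_pt (T : Op X m) : T ∈ pt T := mem_clSpan rfl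

theorem pt_mul (T S : Op X m) : pt T * pt S = pt (T * S) := by
  simp [pt, clSpan_mul_clSpan]

theorem pt_one : pt (1 : Op X m) = 1 := rfl

theorem pt_mul_clSpan (T : Op X m) (s : Set (Op X m)) :
    pt T * clSpan s = clSpan ((fun x => T * x) '' s) := by
  simp [pt, clSpan_mul_clSpan]

theorem pt_mul_pt_star {T : Op X m} (h : T * star T = 1) : pt T * pt (star T) = 1 := by
  rw [pt_mul, h, pt_one]

theorem pt_star_mul_pt {T : Op X m} (h : star T * T = 1) : pt (star T) * pt T = 1 := by
  rw [pt_mul, h, pt_one]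

/-! #### Adjoints -/

/-- The space of adjoints. -/
def adj (E : OpSpace X m) : OpSpace X m where
  carrier := {T | star T ∈ E}
  add_mem' {x y} hx hy := by
    change star (x + y) ∈ E
    rw [star_add]
    exact add_mem hx hy
  zero_mem' := by
    change star (0 : Op X m) ∈ E
    rw [star_zero]
    exact zero_mem E
  smul_mem' c x hx := by
    change star (c • x) ∈ E
    rw [star_smul]
    exact E.smul_mem _ hx
  isClosed' := E.isClosed.preimage continuous_star

instance : InvolutiveStar (OpSpace X m) where
  star := adj
  star_involutive E := by
    ext T
    change star (star T) ∈ E ↔ T ∈ E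
    rw [star_star]

theorem mem_star {E : OpSpace X m} {T : Op X m} : T ∈ star E ↔ star T ∈ E := Iff.rfl

theorem star_mono {E F : OpSpace X m} (h : E ≤ F) : star E ≤ star F := fun _ hx => h hx

theorem star_le_iff {E F : OpSpace X m} : star E ≤ F ↔ E ≤ star F :=
  ⟨fun h => by simpa using star_mono h, fun h => by simpa using star_mono h⟩

instance : StarMul (OpSpace X m) where
  star_mul := by
    have h : ∀ E F : OpSpace X m, star (E * F) ≤ star F * star E := fun E F =>
      star_le_iff.2 (mul_le.2 fun x hx y hy => by
        rw [mem_star, star_mul]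
        exact mul_mem_mul (by rwa [mem_star, star_star]) (by rwa [mem_star, star_star]))
    refine fun E F => le_antisymm (h E F) ?_
    rw [← star_star (star F * star E), ← star_le_iff, star_star]
    simpa using h (star F) (star E)

theorem star_clSpan (s : Set (Op X m)) : star (clSpan s) = clSpan (star '' s) := by
  apply le_antisymm
  · rw [star_le_iff, clSpan_le]
    exact fun x hx => mem_star.2 (mem_clSpan ⟨x, hx, rfl⟩)
  · rw [clSpan_le]
    rintro _ ⟨x, hx, rfl⟩
    exact mem_star.2 (by simpa using mem_clSpan hx)

@[simp] theorem star_pt (T : Op X m) : star (pt T) = pt (star T) := by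
  simp [pt, star_clSpan]

/-! #### Legs -/

theorem continuous_amp (f : Fin k ↪ Fin m) : Continuous (amp (X := X) f) :=
  AddMonoidHomClass.continuous_of_bound (amp (X := X) f) 1 fun T => by
    simpa using NonUnitalStarAlgHom.norm_apply_le (amp (X := X) f) T

/-- `amp` as a continuous linear map. -/
def ampL (f : Fin k ↪ Fin m) : Op X k →L[ℂ] Op X m :=
  ⟨(amp f : Op X k →⋆ₐ[ℂ] Op X m).toAlgHom.toLinearMap, continuous_amp f⟩

/-- The space of operators `amp f T`, `T ∈ E`. -/
def leg (f : Fin k ↪ Fin m) (E : OpSpace X k) : OpSpace X m := clSpan (amp f '' E)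

theorem leg_le {f : Fin k ↪ Fin m} {E : OpSpace X k} {G : OpSpace X m} :
    leg f E ≤ G ↔ ∀ T ∈ E, amp f T ∈ G := by
  rw [leg, clSpan_le, Set.image_subset_iff]
  rfl

theorem amp_mem_leg (f : Fin k ↪ Fin m) {E : OpSpace X k} {T : Op X k} (h : T ∈ E) :
    amp f T ∈ leg f E := mem_clSpan ⟨T, h, rfl⟩

theorem leg_clSpan (f : Fin k ↪ Fin m) (s : Set (Op X k)) :
    leg f (clSpan s) = clSpan (amp f '' s) := by
  apply le_antisymm
  · rw [leg_le]
    have : clSpan s ≤ (clSpan (amp f '' s)).comap (ampL f) :=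
      clSpan_le.2 fun T hT => mem_clSpan ⟨T, hT, rfl⟩
    exact fun T hT => this hT
  · exact clSpan_mono (Set.image_mono (subset_clSpan s))

theorem leg_mul (f : Fin k ↪ Fin m) (E F : OpSpace X k) :
    leg f (E * F) = leg f E * leg f F := by
  rw [← clSpan_coe E, ← clSpan_coe F, clSpan_mul_clSpan, leg_clSpan, leg_clSpan, leg_clSpan,
    clSpan_mul_clSpan, Set.image_image2, Set.image2_image_left, Set.image2_image_right]
  simp only [map_mul]

@[simp] theorem leg_pt (f : Fin k ↪ Fin m) (T : Op X k) : leg f (pt T) = pt (amp f T) := by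
  simp [pt, leg_clSpan]

theorem leg_mono (f : Fin k ↪ Fin m) {E F : OpSpace X k} (h : E ≤ F) : leg f E ≤ leg f F :=
  leg_le.2 fun _ hT => amp_mem_leg f (h hT)

theorem leg_leg {f : Fin k ↪ Fin m} {g : Fin m ↪ Fin p} {h : Fin k ↪ Fin p}
    (hfg : ∀ i, g (f i) = h i) (E : OpSpace X k) : leg g (leg f E) = leg h E := by
  rw [← clSpan_coe E, leg_clSpan, leg_clSpan, leg_clSpan, Set.image_image]
  simp only [amp_amp hfg]

theorem star_leg (f : Fin k ↪ Fin m) (E : OpSpace X k) : star (leg f E) = leg f (star E) := by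
  rw [← clSpan_coe E, star_clSpan, leg_clSpan, leg_clSpan, star_clSpan, Set.image_image,
    Set.image_image]
  simp only [map_star]

theorem commute_clSpan {s t : Set (Op X m)} (h : ∀ x ∈ s, ∀ y ∈ t, x * y = y * x) :
    Commute (clSpan s) (clSpan t) := by
  rw [Commute, SemiconjBy, clSpan_mul_clSpan, clSpan_mul_clSpan]
  congr 1
  ext T
  constructor
  · rintro ⟨x, hx, y, hy, rfl⟩
    exact ⟨y, hy, x, hx, (h x hx y hy).symm⟩
  · rintro ⟨y, hy, x, hx, rfl⟩
    exact ⟨x, hx, y, hy, h x hx y hy⟩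

theorem leg_commute {f : Fin k ↪ Fin m} {g : Fin l ↪ Fin m} (hd : ∀ i j, f i ≠ g j)
    (E : OpSpace X k) (F : OpSpace X l) : Commute (leg f E) (leg g F) := by
  refine commute_clSpan ?_
  rintro _ ⟨x, -, rfl⟩ _ ⟨y, -, rfl⟩
  exact amp_commute hd x y

theorem leg_commute_pt {f : Fin k ↪ Fin m} {g : Fin l ↪ Fin m} (hd : ∀ i j, f i ≠ g j)
    (E : OpSpace X k) (T : Op X l) : Commute (leg f E) (pt (amp g T)) := by
  rw [← leg_pt]
  exact leg_commute hd E _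

theorem pt_commute {T S : Op X m} (h : Commute T S) : Commute (pt T) (pt S) := by
  rw [Commute, SemiconjBy, pt_mul, pt_mul, h.eq]

/-- The space of operators `W (amp f T) W*`, `T ∈ E`. -/
def adLeg (f : Fin k ↪ Fin m) (W : Op X m) (E : OpSpace X k) : OpSpace X m :=
  pt W * leg f E * pt (star W)

theorem mem_adLeg (f : Fin k ↪ Fin m) (W : Op X m) {E : OpSpace X k} {T : Op X k} (h : T ∈ E) :
    W * amp f T * star W ∈ adLeg f W E :=
  mul_mem_mul (mul_mem_mul (mem_pt W) (amp_mem_leg f h)) (mem_pt _)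

/-! #### Algebras of operators -/

theorem mem_clSpan_iff_of_isClosed {C : NonUnitalStarSubalgebra ℂ (Op X m)}
    (hC : IsClosed (C : Set (Op X m))) {T : Op X m} :
    T ∈ clSpan (C : Set (Op X m)) ↔ T ∈ C := by
  refine ⟨fun h => ?_, fun h => mem_clSpan h⟩
  have : clSpan (C : Set (Op X m)) ≤ ⟨C.toSubmodule, hC⟩ := clSpan_le.2 fun x hx => hx
  exact this h

/-- The closed subspace underlying an algebra of operators. -/
def ofAlg (C : NonUnitalStarSubalgebra ℂ (Op X m)) : OpSpace X m := clSpan (C : Set (Op X m))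

theorem star_ofAlg (C : NonUnitalStarSubalgebra ℂ (Op X m)) : star (ofAlg C) = ofAlg C := by
  rw [ofAlg, star_clSpan]
  congr 1
  ext T
  constructor
  · rintro ⟨S, hS, rfl⟩
    exact star_mem (SetLike.mem_coe.1 hS)
  · exact fun h => ⟨star T, star_mem (SetLike.mem_coe.1 h), star_star T⟩

/-- A star closed subspace that is closed under multiplication is an algebra of operators. -/
def toAlg (E : OpSpace X m) (h1 : E * E ≤ E) (h2 : star E = E) :
    NonUnitalStarSubalgebra ℂ (Op X m) where
  carrier := E
  add_mem' := fun hx hy => E.add_mem hx hy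
  zero_mem' := E.zero_mem
  mul_mem' := fun hx hy => h1 (mul_mem_mul hx hy)
  smul_mem' := fun c _ hx => E.smul_mem c hx
  star_mem' := fun {T} hT => by
    rw [← h2]
    exact mem_star.2 (by simpa using hT)

/-- Under the two conditions no products or adjoints have to be added to the generators. This is how
the closed span of slices is recognised as a whole C*-algebra. -/
theorem coe_cstarGenerated {s : Set (Op X m)} (h1 : clSpan s * clSpan s ≤ clSpan s)
    (h2 : star (clSpan s) = clSpan s) :
    (cstarGenerated s : Set (Op X m)) = clSpan s := by
  apply Set.Subset.antisymm
  · have : NonUnitalStarAlgebra.adjoin ℂ s ≤ toAlg (clSpan s) h1 h2 :=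
      NonUnitalStarAlgebra.adjoin_le (subset_clSpan s)
    exact NonUnitalStarSubalgebra.topologicalClosure_minimal _ this (clSpan s).isClosed
  · have : clSpan s ≤ ⟨(cstarGenerated s).toSubmodule,
        NonUnitalStarSubalgebra.isClosed_topologicalClosure _⟩ :=
      clSpan_le.2 fun x hx => NonUnitalStarSubalgebra.le_topologicalClosure _
        (NonUnitalStarAlgebra.subset_adjoin ℂ s hx)
    exact this

theorem isClosed_cstarGenerated (s : Set (Op X m)) :
    IsClosed (cstarGenerated s : Set (Op X m)) :=
  NonUnitalStarSubalgebra.isClosed_topologicalClosure _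

theorem isClosed_spatialTensor {a b : ℕ} (A : NonUnitalStarSubalgebra ℂ (Op X a))
    (B : NonUnitalStarSubalgebra ℂ (Op X b)) :
    IsClosed (spatialTensor A B : Set (Op X (a + b))) := isClosed_cstarGenerated _

theorem ofAlg_cstarGenerated {s : Set (Op X m)} (h1 : clSpan s * clSpan s ≤ clSpan s)
    (h2 : star (clSpan s) = clSpan s) : ofAlg (cstarGenerated s) = clSpan s := by
  rw [ofAlg, coe_cstarGenerated h1 h2, clSpan_coe]

theorem mem_ofAlg {C : NonUnitalStarSubalgebra ℂ (Op X m)} (hC : IsClosed (C : Set (Op X m)))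
    {T : Op X m} : T ∈ ofAlg C ↔ T ∈ C := mem_clSpan_iff_of_isClosed hC

theorem ofAlg_mul_self_le (C : NonUnitalStarSubalgebra ℂ (Op X m)) :
    ofAlg C * ofAlg C ≤ ofAlg C := by
  rw [ofAlg, clSpan_mul_clSpan]
  refine clSpan_mono ?_
  rintro _ ⟨x, hx, y, hy, rfl⟩
  exact mul_mem (SetLike.mem_coe.1 hx) (SetLike.mem_coe.1 hy)

/-- The two leg spaces commute, so their product is already self-adjoint and closed under
multiplication. This brings spatial tensor products into the monoid of spaces. -/
theorem ofAlg_spatialTensor {a b : ℕ} (A : NonUnitalStarSubalgebra ℂ (Op X a))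
    (B : NonUnitalStarSubalgebra ℂ (Op X b)) :
    ofAlg (spatialTensor A B) =
      leg (Fin.castAddEmb b) (ofAlg A) * leg (Fin.natAddEmb a) (ofAlg B) := by
  have hc := leg_commute (X := X) (f := Fin.castAddEmb b) (g := Fin.natAddEmb a)
    (fun i j h => by
      have := congrArg Fin.val h
      simp only [Fin.castAddEmb_apply, Fin.val_castAdd, Fin.natAddEmb_apply, Fin.val_natAdd] at this
      have := i.2
      omega) (ofAlg A) (ofAlg B)
  have h0 : leg (Fin.castAddEmb b) (ofAlg A) * leg (Fin.natAddEmb a) (ofAlg B) =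
      clSpan {T | ∃ S ∈ A, ∃ R ∈ B, T = opTensor S R} := by
    rw [ofAlg, ofAlg, leg_clSpan, leg_clSpan, clSpan_mul_clSpan, Set.image2_image_left,
      Set.image2_image_right]
    congr 1
    ext T
    constructor
    · rintro ⟨S, hS, R, hR, rfl⟩
      exact ⟨S, hS, R, hR, (opTensor_eq_amp S R).symm⟩
    · rintro ⟨S, hS, R, hR, rfl⟩
      exact ⟨S, hS, R, hR, (opTensor_eq_amp S R).symm⟩
  rw [h0, spatialTensor, ofAlg_cstarGenerated]
  · rw [← h0]
    calc _ = leg (Fin.castAddEmb b) (ofAlg A * ofAlg A) * leg (Fin.natAddEmb a) (ofAlg B * ofAlg B) := by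
          rw [leg_mul, leg_mul]
          simp only [mul_assoc]
          rw [← mul_assoc (leg (Fin.natAddEmb a) (ofAlg B)), ← hc.eq]
          simp only [mul_assoc]
      _ ≤ _ := mul_mono (leg_mono _ (ofAlg_mul_self_le A)) (leg_mono _ (ofAlg_mul_self_le B))
  · rw [← h0, star_mul, star_leg, star_leg, star_ofAlg, star_ofAlg, hc.eq]

/-- A criterion for multipliers. -/
theorem isMultiplier_of_mul_le {C : NonUnitalStarSubalgebra ℂ (Op X m)}
    (hC : IsClosed (C : Set (Op X m))) {D : OpSpace X m} (hD : star D = D)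
    (h : D * ofAlg C ≤ ofAlg C) {T : Op X m} (hT : T ∈ D) : IsMultiplier C T := by
  have key : ∀ T ∈ D, ∀ c ∈ C, T * c ∈ C := fun T hT c hc =>
    (mem_ofAlg hC).1 (h (mul_mem_mul hT ((mem_ofAlg hC).2 hc)))
  refine fun c hc => ⟨key T hT c hc, ?_⟩
  have h1 := key (star T) (by rw [← hD]; exact mem_star.2 (by simpa using hT)) (star c) (star_mem hc)
  simpa using star_mem h1

end OpSpace
end spaces

section slices
variable {X : Type} [MeasureSpace X] [SigmaFinite (volume : Measure X)]

open InnerProductSpace (rankOne)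

/-! ### Compact operators and slices -/

theorem tensorLeft_apply {a b : ℕ} (ζ : L2 X a) (ξ : L2 X b) :
    tensorLeft ζ b ξ = vecTensor a b ζ ξ := by
  simp [tensorLeft, tensorIsometry_tmul]

theorem tensorRight_apply {a b : ℕ} (ζ : L2 X b) (ξ : L2 X a) :
    tensorRight a ζ ξ = vecTensor a b ξ ζ := by
  simp [tensorRight, tensorIsometry_tmul]

theorem adjoint_tensorLeft_vecTensor {a b : ℕ} (ζ α : L2 X a) (β : L2 X b) :
    ContinuousLinearMap.adjoint (tensorLeft ζ b) (vecTensor a b α β) = ⟪ζ, α⟫_ℂ • β := by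
  refine ext_inner_left ℂ fun η => ?_
  rw [ContinuousLinearMap.adjoint_inner_right, tensorLeft_apply, inner_vecTensor, inner_smul_right]

/-- The slice `(ω ⊗ id)(V)` for the functional `ω(T) = ⟪η, T ξ⟫`. -/
def sliceL (a b : ℕ) (η ξ : L2 X a) : Op X (a + b) →L[ℂ] Op X b :=
  (ContinuousLinearMap.compL ℂ (L2 X b) (L2 X (a + b)) (L2 X b)
    (ContinuousLinearMap.adjoint (tensorLeft η b))).comp
  ((ContinuousLinearMap.compL ℂ (L2 X b) (L2 X (a + b)) (L2 X (a + b))).flip (tensorLeft ξ b))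

theorem sliceL_apply {a b : ℕ} (η ξ : L2 X a) (V : Op X (a + b)) (ζ : L2 X b) :
    sliceL a b η ξ V ζ =
      ContinuousLinearMap.adjoint (tensorLeft η b) (V (vecTensor a b ξ ζ)) := by
  simp [sliceL, tensorLeft_apply]

theorem inner_sliceL {a b : ℕ} (η ξ : L2 X a) (V : Op X (a + b)) (ζ θ : L2 X b) :
    ⟪θ, sliceL a b η ξ V ζ⟫_ℂ = ⟪vecTensor a b η θ, V (vecTensor a b ξ ζ)⟫_ℂ := by
  rw [sliceL_apply, ContinuousLinearMap.adjoint_inner_right, tensorLeft_apply]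

theorem sliceL_opTensor {a b : ℕ} (η ξ : L2 X a) (T : Op X a) (S : Op X b) :
    sliceL a b η ξ (opTensor T S) = ⟪η, T ξ⟫_ℂ • S := by
  ext1 ζ
  rw [sliceL_apply, opTensor_vecTensor, adjoint_tensorLeft_vecTensor]
  rfl

theorem opTensor_rankOne_one {a b : ℕ} (u η : L2 X a) (w : L2 X (a + b)) :
    opTensor (rankOne ℂ u η) (1 : Op X b) w =
      vecTensor a b u (ContinuousLinearMap.adjoint (tensorLeft η b) w) := by
  have : opTensor (rankOne ℂ u η) (1 : Op X b) =
      (tensorLeft u b).comp (ContinuousLinearMap.adjoint (tensorLeft η b)) := by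
    refine clm_ext_vecTensor fun α β => ?_
    rw [opTensor_vecTensor, ContinuousLinearMap.comp_apply, adjoint_tensorLeft_vecTensor,
      tensorLeft_apply]
    simp
  rw [this, ContinuousLinearMap.comp_apply, tensorLeft_apply]

/-- Rank-one operators on both sides of the first leg evaluate it against `η` and `ξ`. Slices are
thereby expressed through products of operators. -/
theorem rankOne_mul_mul_rankOne {a b : ℕ} (u η ξ v : L2 X a) (V : Op X (a + b)) :
    opTensor (rankOne ℂ u η) (1 : Op X b) * V * opTensor (rankOne ℂ ξ v) (1 : Op X b) =
      opTensor (rankOne ℂ u v) (sliceL a b η ξ V) := by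
  refine clm_ext_vecTensor fun α β => ?_
  rw [mul_apply_eq_comp, mul_apply_eq_comp, opTensor_vecTensor, opTensor_vecTensor,
    opTensor_rankOne_one, sliceL_apply]
  simp

theorem opTensor_rankOne {a b : ℕ} (x y : L2 X a) (x' y' : L2 X b) :
    opTensor (rankOne ℂ x y) (rankOne ℂ x' y') =
      rankOne ℂ (vecTensor a b x x') (vecTensor a b y y') := by
  refine clm_ext_vecTensor fun α β => ?_
  rw [opTensor_vecTensor]
  simp [inner_vecTensor, smul_smul, mul_comm]

theorem mul_rankOne {k : ℕ} (T : Op X k) (x y : L2 X k) :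
    T * rankOne ℂ x y = rankOne ℂ (T x) y := by
  ext1 z
  simp

theorem star_rankOne {k : ℕ} (x y : L2 X k) : star (rankOne ℂ x y) = rankOne ℂ y x := by
  rw [ContinuousLinearMap.star_eq_adjoint, InnerProductSpace.adjoint_rankOne]

theorem closedSubmodule_eq_top {a b : ℕ} {M : ClosedSubmodule ℂ (L2 X (a + b))}
    (h : ∀ ξ η, vecTensor a b ξ η ∈ M) : M = ⊤ := by
  rw [eq_top_iff]
  intro v _
  have h1 : Set.range (tensorIsometry (X := X) a b) ⊆ M := by
    rintro _ ⟨p, rfl⟩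
    induction p using TensorProduct.induction_on with
    | zero => rw [map_zero]; exact M.zero_mem
    | tmul ξ η => rw [tensorIsometry_tmul]; exact h ξ η
    | add p q hp hq => rw [map_add]; exact M.add_mem hp hq
  exact M.isClosed.closure_subset_iff.2 h1 (denseRange_tensorIsometry a b v)

namespace OpSpace

variable {k l m p : ℕ}

/-- The compact operators. -/
def cpt (k : ℕ) : OpSpace X k := clSpan {T | ∃ x y : L2 X k, T = rankOne ℂ x y}

theorem rankOne_mem_cpt {k : ℕ} (x y : L2 X k) : rankOne ℂ x y ∈ cpt (X := X) k :=
  mem_clSpan ⟨x, y, rfl⟩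

theorem pt_mul_cpt_le (T : Op X k) : pt T * cpt k ≤ cpt k := by
  rw [cpt, pt_mul_clSpan]
  refine clSpan_mono ?_
  rintro _ ⟨_, ⟨x, y, rfl⟩, rfl⟩
  exact ⟨T x, y, mul_rankOne T x y⟩

theorem pt_mul_cpt {T S : Op X k} (h : T * S = 1) : pt T * cpt k = cpt k := by
  refine le_antisymm (pt_mul_cpt_le T) ?_
  calc cpt k = pt T * (pt S * cpt k) := by rw [← mul_assoc, pt_mul, h, pt_one, one_mul]
    _ ≤ _ := mul_mono le_rfl (pt_mul_cpt_le S)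

theorem star_cpt : star (cpt (X := X) k) = cpt k := by
  rw [cpt, star_clSpan]
  congr 1
  ext T
  constructor
  · rintro ⟨_, ⟨x, y, rfl⟩, rfl⟩
    exact ⟨y, x, star_rankOne x y⟩
  · rintro ⟨x, y, rfl⟩
    exact ⟨_, ⟨y, x, rfl⟩, star_rankOne y x⟩

theorem cpt_mul_pt {T S : Op X k} (h : S * T = 1) : cpt k * pt T = cpt k := by
  have := congrArg star (pt_mul_cpt (T := star T) (S := star S) (by rw [← star_mul, h, star_one]))
  simpa [star_cpt] using this

theorem cpt_mul_cpt : cpt (X := X) k * cpt k = cpt k := by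
  apply le_antisymm
  · rw [cpt, clSpan_mul_clSpan]
    refine clSpan_mono ?_
    rintro _ ⟨T, -, _, ⟨x, y, rfl⟩, rfl⟩
    exact ⟨T x, y, mul_rankOne T x y⟩
  · change clSpan _ ≤ _
    rw [clSpan_le]
    rintro _ ⟨x, y, rfl⟩
    by_cases hy : y = 0
    · simp [hy, zero_mem]
    · have h : rankOne ℂ x y =
          (((‖y‖ : ℂ) ^ 2)⁻¹ • rankOne ℂ x y) * rankOne ℂ y y := by
        rw [mul_rankOne]
        simp [inner_self_eq_norm_sq_to_K, smul_smul, hy]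
      rw [h]
      exact mul_mem_mul ((cpt k).smul_mem _ (rankOne_mem_cpt _ _)) (rankOne_mem_cpt _ _)

theorem leg_cpt_mul_leg_cpt (a b : ℕ) :
    leg (Fin.castAddEmb b) (cpt (X := X) a) * leg (Fin.natAddEmb a) (cpt b) = cpt (a + b) := by
  have h0 : leg (Fin.castAddEmb b) (cpt (X := X) a) * leg (Fin.natAddEmb a) (cpt b) =
      clSpan {T | ∃ x y x' y', T = rankOne ℂ (vecTensor a b x x') (vecTensor a b y y')} := by
    rw [cpt, cpt, leg_clSpan, leg_clSpan, clSpan_mul_clSpan, Set.image2_image_left,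
      Set.image2_image_right]
    congr 1
    ext T
    constructor
    · rintro ⟨_, ⟨x, y, rfl⟩, _, ⟨x', y', rfl⟩, rfl⟩
      exact ⟨x, y, x', y', (opTensor_eq_amp _ _).symm.trans (opTensor_rankOne x y x' y')⟩
    · rintro ⟨x, y, x', y', rfl⟩
      exact ⟨_, ⟨x, y, rfl⟩, _, ⟨x', y', rfl⟩,
        (opTensor_eq_amp _ _).symm.trans (opTensor_rankOne x y x' y')⟩
  rw [h0]
  apply le_antisymm
  · refine clSpan_mono ?_
    rintro _ ⟨x, y, x', y', rfl⟩
    exact ⟨_, _, rfl⟩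
  · set G : OpSpace X (a + b) :=
      clSpan {T | ∃ x y x' y', T = rankOne ℂ (vecTensor a b x x') (vecTensor a b y y')} with hG
    have hs : star G = G := by
      rw [hG, star_clSpan]
      congr 1
      ext T
      constructor
      · rintro ⟨_, ⟨x, y, x', y', rfl⟩, rfl⟩
        exact ⟨y, x, y', x', star_rankOne _ _⟩
      · rintro ⟨x, y, x', y', rfl⟩
        exact ⟨_, ⟨y, x, y', x', rfl⟩, star_rankOne _ _⟩
    -- A rank-one operator depends linearly and continuously on its first vector, so density frees
    -- that vector. Since `G` is self-adjoint, the second vector is freed in the same way after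
    -- taking adjoints.
    have h1 : ∀ u (y : L2 X a) (y' : L2 X b), rankOne ℂ u (vecTensor a b y y') ∈ G := by
      intro u y y'
      have : G.comap ((ContinuousLinearMap.smulRightL ℂ (L2 X (a + b)) (L2 X (a + b)))
          (innerSL ℂ (vecTensor a b y y'))) = ⊤ :=
        closedSubmodule_eq_top fun x x' => mem_clSpan ⟨x, y, x', y', rfl⟩
      have h := (eq_top_iff.1 this) (ClosedSubmodule.mem_top (x := u))
      exact h
    rw [cpt, clSpan_le]
    rintro _ ⟨u, v, rfl⟩
    have : G.comap ((ContinuousLinearMap.smulRightL ℂ (L2 X (a + b)) (L2 X (a + b)))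
          (innerSL ℂ v)) = ⊤ := closedSubmodule_eq_top fun x x' => by
        have h := h1 v x x'
        rw [← hs, mem_star, star_rankOne] at h
        exact h
    exact (eq_top_iff.1 this) (ClosedSubmodule.mem_top (x := u))

/-- Tensoring with the compact operators reflects the order. -/
theorem le_of_cpt_mul_le [Nontrivial (L2 X k)] {E F : OpSpace X l}
    (h : leg (Fin.castAddEmb l) (cpt k) * leg (Fin.natAddEmb k) E ≤
      leg (Fin.castAddEmb l) (cpt k) * leg (Fin.natAddEmb k) F) : E ≤ F := by
  obtain ⟨ξ, hξ⟩ := exists_ne (0 : L2 X k)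
  -- Slicing the first leg with `ξ` on both sides maps `K ⊗ F` into `F`, and it maps `|ξ⟩⟨ξ| ⊗ y` to
  -- a nonzero multiple of `y`.
  have h1 : leg (Fin.castAddEmb l) (cpt k) * leg (Fin.natAddEmb k) F ≤
      F.comap (sliceL k l ξ ξ) := by
    rw [mul_le]
    intro x hx y hy
    have h2 : leg (Fin.natAddEmb k) F ≤ (F.comap (sliceL k l ξ ξ)).comap
        (ContinuousLinearMap.mul ℂ _ x) := by
      have h3 : leg (Fin.castAddEmb l) (cpt k) ≤ ⨅ y : F, ((F.comap (sliceL k l ξ ξ)).comap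
        ((ContinuousLinearMap.mul ℂ _).flip (amp (Fin.natAddEmb k) (y : Op X l)))) := by
        rw [leg_le]
        intro T _
        rw [ClosedSubmodule.mem_iInf]
        intro y
        change sliceL k l ξ ξ (amp (Fin.castAddEmb l) T * amp (Fin.natAddEmb k) (y : Op X l)) ∈ F
        rw [← opTensor_eq_amp, sliceL_opTensor]
        exact F.smul_mem _ y.2
      rw [leg_le]
      intro y hy
      have h4 := h3 hx
      rw [ClosedSubmodule.mem_iInf] at h4
      exact h4 ⟨y, hy⟩
    exact h2 hy
  intro y hy
  have h5 := h1 (h (mul_mem_mul (amp_mem_leg _ (rankOne_mem_cpt ξ ξ)) (amp_mem_leg _ hy)))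
  rw [ClosedSubmodule.mem_comap, ← opTensor_eq_amp, sliceL_opTensor] at h5
  have h6 : ⟪ξ, rankOne ℂ ξ ξ ξ⟫_ℂ ≠ 0 := by
    simp [inner_smul_right, hξ]
  have := F.smul_mem (⟪ξ, rankOne ℂ ξ ξ ξ⟫_ℂ)⁻¹ h5
  rwa [smul_smul, inv_mul_cancel₀ h6, one_smul] at this

/-- The closed span of the slices `(ω ⊗ id)(V)`. -/
def leftSpan (a b : ℕ) (V : Op X (a + b)) : OpSpace X b :=
  clSpan {T | ∃ η ξ : L2 X a, T = sliceL a b η ξ V}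

/-- In `rankOne_mul_mul_rankOne` the outer vectors `u`, `v` are free and generate the compact leg,
while `η`, `ξ` run through all slices. -/
theorem cpt_mul_pt_mul_cpt (a b : ℕ) (V : Op X (a + b)) :
    leg (Fin.castAddEmb b) (cpt a) * pt V * leg (Fin.castAddEmb b) (cpt a) =
      leg (Fin.castAddEmb b) (cpt a) * leg (Fin.natAddEmb a) (leftSpan a b V) := by
  rw [leftSpan, cpt, leg_clSpan, leg_clSpan, pt, clSpan_mul_clSpan, clSpan_mul_clSpan,
    clSpan_mul_clSpan, Set.image2_image_left, Set.image2_image_left, Set.image2_image_right,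
    Set.image2_singleton_right, Set.image2_image_left, Set.image2_image_right]
  congr 1
  ext T
  constructor
  · rintro ⟨_, ⟨u, η, rfl⟩, _, ⟨ξ, v, rfl⟩, rfl⟩
    refine ⟨_, ⟨u, v, rfl⟩, _, ⟨η, ξ, rfl⟩, ?_⟩
    simp only [amp_castAdd, amp_natAdd, rankOne_mul_mul_rankOne, opTensor_mul, mul_one, one_mul]
  · rintro ⟨_, ⟨u, v, rfl⟩, _, ⟨η, ξ, rfl⟩, rfl⟩
    refine ⟨_, ⟨u, η, rfl⟩, _, ⟨ξ, v, rfl⟩, ?_⟩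
    simp only [amp_castAdd, amp_natAdd, rankOne_mul_mul_rankOne, opTensor_mul, mul_one, one_mul]

end OpSpace
end slices

section multiplicative
variable {X : Type} [MeasureSpace X] [SigmaFinite (volume : Measure X)]

/-! ### Named legs -/

section named
variable {m p : ℕ}

/-- The leg `i`. -/
def single (i : Fin m) : Fin 1 ↪ Fin m := ⟨fun _ => i, fun _ _ _ => Subsingleton.elim _ _⟩

/-- The legs `i, j`. -/
def pair (i j : Fin m) (h : i ≠ j) : Fin 2 ↪ Fin m :=
  ⟨![i, j], by
    intro a b hab
    fin_cases a <;> fin_cases b <;> simp_all [eq_comm]⟩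

/-- The legs `i, j, k`. -/
def triple (i j k : Fin m) (hij : i ≠ j) (hik : i ≠ k) (hjk : j ≠ k) : Fin 3 ↪ Fin m :=
  ⟨![i, j, k], by
    intro a b hab
    fin_cases a <;> fin_cases b <;> simp_all [eq_comm]⟩

@[simp] theorem single_apply (i : Fin m) (a : Fin 1) : single i a = i := rfl
@[simp] theorem pair_zero (i j : Fin m) (h : i ≠ j) : pair i j h 0 = i := rfl
@[simp] theorem pair_one (i j : Fin m) (h : i ≠ j) : pair i j h 1 = j := rfl
@[simp] theorem triple_zero (i j k : Fin m) (hij : i ≠ j) (hik : i ≠ k) (hjk : j ≠ k) :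
    triple i j k hij hik hjk 0 = i := rfl
@[simp] theorem triple_one (i j k : Fin m) (hij : i ≠ j) (hik : i ≠ k) (hjk : j ≠ k) :
    triple i j k hij hik hjk 1 = j := rfl
@[simp] theorem triple_two (i j k : Fin m) (hij : i ≠ j) (hik : i ≠ k) (hjk : j ≠ k) :
    triple i j k hij hik hjk 2 = k := rfl

@[simp] theorem amp_single (f : Fin m ↪ Fin p) (i : Fin m) (T : Op X 1) :
    amp f (amp (single i) T) = amp (single (f i)) T := amp_amp (fun _ => rfl) T

@[simp] theorem amp_pair (f : Fin m ↪ Fin p) (i j : Fin m) (h : i ≠ j) (T : Op X 2) :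
    amp f (amp (pair i j h) T) = amp (pair (f i) (f j) (f.injective.ne h)) T :=
  amp_amp (fun a => by fin_cases a <;> rfl) T

namespace OpSpace

@[simp] theorem leg_single (f : Fin m ↪ Fin p) (i : Fin m) (E : OpSpace X 1) :
    leg f (leg (single i) E) = leg (single (f i)) E := leg_leg (fun _ => rfl) E

theorem single_commute_single {i j : Fin m} (h : i ≠ j) (E F : OpSpace X 1) :
    leg (single i) E * leg (single j) F = leg (single j) F * leg (single i) E :=
  (leg_commute (fun _ _ => h) E F).eq

theorem single_commute_pair {i j k : Fin m} (hjk : j ≠ k) (h1 : i ≠ j) (h2 : i ≠ k)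
    (E : OpSpace X 1) (T : Op X 2) :
    leg (single i) E * pt (amp (pair j k hjk) T) = pt (amp (pair j k hjk) T) * leg (single i) E :=
  (leg_commute_pt (fun _ b => by fin_cases b <;> assumption) E T).eq

theorem cpt_mul_cpt_pair {i j : Fin m} (h : i ≠ j) :
    leg (single i) (cpt 1) * leg (single j) (cpt 1) = leg (pair i j h) (cpt (X := X) 2) := by
  have h0 := congrArg (leg (pair i j h)) (leg_cpt_mul_leg_cpt (X := X) 1 1)
  rw [leg_mul, leg_leg (h := single i) (fun a => by fin_cases a; rfl),
    leg_leg (h := single j) (fun a => by fin_cases a; rfl)] at h0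
  exact h0

theorem le_of_cpt_mul_le_two [Nontrivial (L2 X 1)] {E F : OpSpace X 1}
    (h : leg (single (0 : Fin 2)) (cpt 1) * leg (single 1) E ≤
      leg (single 0) (cpt 1) * leg (single 1) F) : E ≤ F := by
  have h1 : (Fin.castAddEmb 1 : Fin 1 ↪ Fin 2) = single 0 := by
    ext a; fin_cases a; rfl
  have h2 : (Fin.natAddEmb 1 : Fin 1 ↪ Fin 2) = single 1 := by
    ext a; fin_cases a; rfl
  rw [← h1, ← h2] at h
  exact le_of_cpt_mul_le h

theorem le_of_cpt_mul_le_three [Nontrivial (L2 X 1)] {i j k : Fin 3} (hij : i ≠ j) (hik : i ≠ k)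
    (hjk : j ≠ k) {E F : OpSpace X 2}
    (h : leg (single i) (cpt 1) * leg (pair j k hjk) E ≤
      leg (single i) (cpt 1) * leg (pair j k hjk) F) : E ≤ F := by
  -- The permutation inverse to `f` carries the legs `i`, `j`, `k` to 0, 1, 2, where the two-factor
  -- cancellation applies.
  let f : Fin 3 ↪ Fin 3 := triple i j k hij hik hjk
  let e : Fin 3 ≃ Fin 3 := Equiv.ofBijective f (Finite.injective_iff_bijective.1 f.injective)
  have he : ∀ a, e.symm (f a) = a := fun a => e.symm_apply_apply a
  have h1 : ∀ E : OpSpace X 1, leg e.symm.toEmbedding (leg (single i) E) =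
      leg (Fin.castAddEmb 2 : Fin 1 ↪ Fin 3) E := fun E => leg_leg (fun a => by
    fin_cases a
    exact he 0) E
  have h2 : ∀ E : OpSpace X 2, leg e.symm.toEmbedding (leg (pair j k hjk) E) =
      leg (Fin.natAddEmb 1 : Fin 2 ↪ Fin 3) E := fun E => leg_leg (fun a => by
    fin_cases a
    · exact he 1
    · exact he 2) E
  have h3 := leg_mono e.symm.toEmbedding h
  rw [leg_mul, leg_mul, h1, h2, h2] at h3
  exact le_of_cpt_mul_le h3

theorem eq_of_cpt_mul_eq_three [Nontrivial (L2 X 1)] {i j k : Fin 3} (hij : i ≠ j) (hik : i ≠ k)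
    (hjk : j ≠ k) {E F : OpSpace X 2}
    (h : leg (single i) (cpt 1) * leg (pair j k hjk) E =
      leg (single i) (cpt 1) * leg (pair j k hjk) F) : E = F :=
  le_antisymm (le_of_cpt_mul_le_three hij hik hjk h.le) (le_of_cpt_mul_le_three hij hik hjk h.ge)

theorem eq_of_cpt_mul_cpt_mul_eq [Nontrivial (L2 X 1)] {E F : OpSpace X 1}
    (h : leg (single (0 : Fin 3)) (cpt 1) * leg (single 1) (cpt 1) * leg (single 2) E =
      leg (single 0) (cpt 1) * leg (single 1) (cpt 1) * leg (single 2) F) : E = F := by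
  have h1 := eq_of_cpt_mul_eq_three (X := X) (i := 0) (j := 1) (k := 2) (by decide) (by decide)
    (by decide) (E := leg (single (0 : Fin 2)) (cpt 1) * leg (single 1) E)
    (F := leg (single (0 : Fin 2)) (cpt 1) * leg (single 1) F)
    (by simpa [leg_mul, mul_assoc] using h)
  exact le_antisymm (le_of_cpt_mul_le_two h1.le) (le_of_cpt_mul_le_two h1.ge)

end OpSpace
end named

/-! ### Regular multiplicative unitaries -/

/-- Associativity: rewriting a product inside a longer one. -/
theorem mul_asc {M : Type*} [Semigroup M] {a b c : M} (h : a * b = c) (z : M) :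
    a * (b * z) = c * z := by
  rw [← mul_assoc, h]

section monoid
variable {M : Type*} [Monoid M] {K₀ K₁ A₁ A B V W V₀₂ V₁₂ W₀₁ V₀₁ W₀₂ W₁₂ : M}

/-- In this and the next three lemmas subscripts are legs, K is the space of compact operators, and
W is the adjoint of V. Here `A` and `B` are the slices of V and of V* on leg 2. Written as
sandwiches, `B` and `A` give `W₀₂` and `V₁₂` separated by `K₀ * K₁`. Regularity `r` replaces this by
a product containing `W₀₁`, the pentagon `q` then removes `W₀₂`, and `u` absorbs `W₀₁` into the
compacts. -/
theorem star_slices_mul_slices (c₁ : K₁ * W₀₂ = W₀₂ * K₁) (c₂ : K₀ * V₁₂ = V₁₂ * K₀)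
    (c₃ : K₁ * K₀ = K₀ * K₁) (k : K₀ * K₀ = K₀) (s₀ : K₀ * W₀₂ * K₀ = K₀ * B)
    (s₁ : K₁ * V₁₂ * K₁ = K₁ * A) (c₄ : K₁ * B = B * K₁) (c₅ : K₀ * A = A * K₀)
    (r : K₁ * W₀₁ * K₀ = K₀ * K₁) (q : W₀₂ * W₀₁ * V₁₂ = V₁₂ * W₀₁)
    (u : W₀₁ * (K₀ * K₁) = K₀ * K₁) : K₀ * K₁ * (B * A) = K₀ * K₁ * A := by
  calc K₀ * K₁ * (B * A) = K₀ * B * (K₁ * A) := by simp only [mul_assoc, mul_asc c₄]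
    _ = K₀ * W₀₂ * K₀ * (K₁ * V₁₂ * K₁) := by rw [s₀, s₁]
    _ = K₀ * W₀₂ * (K₀ * K₁) * V₁₂ * K₁ := by simp only [mul_assoc]
    _ = K₀ * W₀₂ * (K₁ * W₀₁ * K₀) * V₁₂ * K₁ := by rw [r]
    _ = K₀ * K₁ * (W₀₂ * W₀₁ * V₁₂) * (K₀ * K₁) := by
        simp only [mul_assoc, mul_asc c₁, mul_asc c₂]
    _ = K₀ * K₁ * V₁₂ * (W₀₁ * (K₀ * K₁)) := by rw [q]; simp only [mul_assoc]
    _ = K₀ * (K₁ * V₁₂ * K₁) * K₀ := by rw [u]; simp only [mul_assoc, c₃]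
    _ = K₀ * (K₁ * A) * K₀ := by rw [s₁]
    _ = K₁ * (K₀ * A) * K₀ := by simp only [← mul_assoc, c₃]
    _ = K₁ * (A * (K₀ * K₀)) := by rw [c₅]; simp only [mul_assoc]
    _ = K₀ * K₁ * A := by rw [k, ← c₅, ← c₃, mul_assoc]

/-- Leg 1 is auxiliary. Writing `A` as a sandwich of `V₁₂`, the pentagon turns `V₀₂ * V₁₂` into `W₀₁
* V₁₂ * V₀₁`. The right factor is absorbed by the compacts and the left one disappears by
regularity. -/
theorem unitary_mul_cpt_slices (c₁ : K₁ * V₀₂ = V₀₂ * K₁) (c₂ : K₀ * V₁₂ = V₁₂ * K₀)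
    (c₃ : K₁ * K₀ = K₀ * K₁) (s₁ : K₁ * V₁₂ * K₁ = K₁ * A)
    (r : K₁ * W₀₁ * K₀ = K₀ * K₁) (q : V₀₂ * V₁₂ = W₀₁ * V₁₂ * V₀₁)
    (u : V₀₁ * (K₀ * K₁) = K₀ * K₁) : K₁ * (V₀₂ * (K₀ * A)) = K₁ * (K₀ * A) := by
  calc K₁ * (V₀₂ * (K₀ * A)) = V₀₂ * (K₀ * (K₁ * A)) := by
        rw [mul_asc c₁, mul_assoc, mul_asc c₃, mul_assoc]
    _ = V₀₂ * (K₁ * K₀) * V₁₂ * K₁ := by rw [← s₁, c₃]; simp only [mul_assoc]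
    _ = K₁ * (V₀₂ * V₁₂) * (K₀ * K₁) := by simp only [mul_assoc, mul_asc c₁, mul_asc c₂]
    _ = K₁ * W₀₁ * V₁₂ * (V₀₁ * (K₀ * K₁)) := by rw [q]; simp only [mul_assoc]
    _ = K₁ * W₀₁ * K₀ * V₁₂ * K₁ := by rw [u]; simp only [mul_assoc, mul_asc c₂]
    _ = K₀ * (K₁ * V₁₂ * K₁) := by rw [r]; simp only [mul_assoc]
    _ = K₁ * (K₀ * A) := by rw [s₁, ← mul_assoc, ← c₃, mul_assoc]

/-- The space `A₁` on leg 1 is a sandwich of `V₀₁`, and conjugation by `V₁₂` turns `V₀₁` into `V₀₁ *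
V₀₂`. These two factors are absorbed by `K₀ * A₁` and by `K₀ * A`. -/
theorem comul_mul_slices (c₂ : K₀ * V₁₂ = V₁₂ * K₀) (c₂' : K₀ * W₁₂ = W₁₂ * K₀)
    (k : K₀ * K₀ = K₀) (s₀ : K₀ * V₀₁ * K₀ = K₀ * A₁) (cA : A₁ * A = A * A₁)
    (q : V₁₂ * V₀₁ * W₁₂ = V₀₁ * V₀₂) (i₁ : V₀₁ * (K₀ * A₁) = K₀ * A₁)
    (i₂ : V₀₂ * (K₀ * A) = K₀ * A) :
    K₀ * (V₁₂ * A₁ * W₁₂ * (A₁ * A)) = K₀ * (A₁ * A) := by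
  calc K₀ * (V₁₂ * A₁ * W₁₂ * (A₁ * A)) = V₁₂ * (K₀ * A₁) * W₁₂ * (A₁ * A) := by
        simp only [mul_assoc, mul_asc c₂]
    _ = V₁₂ * (K₀ * V₀₁ * K₀) * W₁₂ * (A₁ * A) := by rw [s₀]
    _ = K₀ * (V₁₂ * V₀₁ * W₁₂) * K₀ * (A₁ * A) := by
        simp only [mul_assoc, mul_asc c₂, mul_asc c₂']
    _ = K₀ * V₀₁ * (V₀₂ * (K₀ * A)) * A₁ := by rw [q, cA]; simp only [mul_assoc]
    _ = K₀ * (V₀₁ * (K₀ * A₁)) * A := by rw [i₂, mul_assoc _ (K₀ * A), mul_assoc K₀ A, ← cA]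
                                         simp only [mul_assoc]
    _ = K₀ * (A₁ * A) := by rw [i₁, ← mul_assoc K₀ K₀, k, mul_assoc]

/-- Now `A₁` lies on leg 0 and is obtained by slicing leg 1. Idempotence supplies a second copy of
`A₁`, which becomes a sandwich of `W₀₁`. The relation `q` trades `W₀₂ * W₀₁` for three factors, each
of which is absorbed. -/
theorem unitary_mul_slices_slices (c₁ : K₁ * W₀₂ = W₀₂ * K₁) (k : K₁ * K₁ = K₁)
    (cA : A₁ * B = B * A₁) (cB : K₁ * A₁ = A₁ * K₁)
    (s : K₁ * W₀₁ * K₁ = K₁ * A₁)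
    (idem : A₁ * A₁ = A₁) (q : W₀₂ * W₀₁ = V₁₂ * W₀₁ * W₁₂)
    (i₁ : W₁₂ * (K₁ * B) = K₁ * B) (i₂ : W₀₁ * (A₁ * K₁) = A₁ * K₁)
    (i₃ : V₁₂ * (K₁ * B) = K₁ * B) :
    K₁ * (W₀₂ * (A₁ * B)) = K₁ * (A₁ * B) := by
  calc K₁ * (W₀₂ * (A₁ * B)) = W₀₂ * (K₁ * A₁) * (A₁ * B) := by
        conv_lhs => rw [← idem]
        simp only [mul_assoc, mul_asc c₁]
    _ = W₀₂ * (K₁ * W₀₁ * K₁) * (A₁ * B) := by rw [s]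
    _ = K₁ * (W₀₂ * W₀₁) * K₁ * (A₁ * B) := by simp only [mul_assoc, mul_asc c₁]
    _ = K₁ * V₁₂ * W₀₁ * (W₁₂ * (K₁ * B)) * A₁ := by rw [q, cA]; simp only [mul_assoc]
    _ = K₁ * V₁₂ * (W₀₁ * (A₁ * K₁)) * B := by
        rw [i₁, ← cB, mul_assoc _ (K₁ * B), mul_assoc K₁ B, ← cA]
        simp only [mul_assoc]
    _ = K₁ * (V₁₂ * (K₁ * B)) * A₁ := by
        rw [i₂, ← cB, mul_assoc _ (K₁ * A₁), mul_assoc K₁ A₁, cA]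
        simp only [mul_assoc]
    _ = K₁ * (A₁ * B) := by rw [i₃, ← mul_assoc K₁ K₁, k, mul_assoc, cA]

end monoid

end multiplicative

/-! ### The algebra of slices of a regular multiplicative unitary -/

section regular
variable {X : Type} [MeasureSpace X] [SigmaFinite (volume : Measure X)]
open OpSpace

/-- Regular multiplicative unitaries. -/
structure IsRegularMU (V : Op X 2) : Prop where
  star_mul_self : star V * V = 1
  mul_star_self : V * star V = 1
  pentagon : amp (pair (0 : Fin 3) 1 (by decide)) V * amp (pair 0 2 (by decide)) V *
    amp (pair 1 2 (by decide)) V = amp (pair 1 2 (by decide)) V * amp (pair 0 1 (by decide)) V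
  regular : leg (single (1 : Fin 2)) (cpt 1) * pt (star V) * leg (single 0) (cpt 1) =
    leg (single 0) (cpt 1) * leg (single 1) (cpt 1)

/-- The closed span of the left slices. -/
def slices (V : Op X 2) : OpSpace X 1 := leftSpan 1 1 V

theorem cpt_mul_pt_mul_cpt_two (V : Op X 2) :
    leg (single (0 : Fin 2)) (cpt 1) * pt V * leg (single 0) (cpt 1) =
      leg (single 0) (cpt 1) * leg (single 1) (slices V) := by
  have h1 : (Fin.castAddEmb 1 : Fin 1 ↪ Fin 2) = single 0 := by
    ext a; fin_cases a; rfl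
  have h2 : (Fin.natAddEmb 1 : Fin 1 ↪ Fin 2) = single 1 := by
    ext a; fin_cases a; rfl
  have := cpt_mul_pt_mul_cpt 1 1 V
  rw [← h1, ← h2]
  exact this

section general
variable {m : ℕ} {i j : Fin m} (h : i ≠ j) {V : Op X 2}

theorem cpt_mul_amp_mul_cpt (V : Op X 2) :
    leg (single i) (cpt 1) * pt (amp (pair i j h) V) * leg (single i) (cpt 1) =
      leg (single i) (cpt 1) * leg (single j) (slices V) := by
  simpa [leg_mul] using congrArg (leg (pair i j h)) (cpt_mul_pt_mul_cpt_two V)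

theorem cpt_mul_amp_star_mul_cpt (V : Op X 2) :
    leg (single i) (cpt 1) * pt (star (amp (pair i j h) V)) * leg (single i) (cpt 1) =
      leg (single i) (cpt 1) * leg (single j) (star (slices V)) := by
  have := congrArg star (cpt_mul_amp_mul_cpt h V)
  simp only [star_mul, star_leg, star_cpt, star_pt] at this
  rw [single_commute_single h, ← this, mul_assoc]

namespace IsRegularMU

variable (hV : IsRegularMU V)
include hV

theorem amp_mul_star : amp (pair i j h) V * star (amp (pair i j h) V) = 1 := by
  rw [← map_star, ← map_mul, hV.mul_star_self, map_one]

theorem star_mul_amp : star (amp (pair i j h) V) * amp (pair i j h) V = 1 := by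
  rw [← map_star, ← map_mul, hV.star_mul_self, map_one]

theorem regular_amp :
    leg (single j) (cpt 1) * pt (star (amp (pair i j h) V)) * leg (single i) (cpt 1) =
      leg (single i) (cpt 1) * leg (single j) (cpt 1) := by
  simpa [leg_mul, map_star] using congrArg (leg (pair i j h)) hV.regular

theorem amp_mul_cpt : pt (amp (pair i j h) V) *
    (leg (single i) (cpt 1) * leg (single j) (cpt 1)) =
      leg (single i) (cpt 1) * leg (single j) (cpt 1) := by
  rw [cpt_mul_cpt_pair h, ← leg_pt, ← leg_mul, pt_mul_cpt hV.mul_star_self]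

theorem star_amp_mul_cpt : pt (star (amp (pair i j h) V)) *
    (leg (single i) (cpt 1) * leg (single j) (cpt 1)) =
      leg (single i) (cpt 1) * leg (single j) (cpt 1) := by
  rw [cpt_mul_cpt_pair h, ← map_star, ← leg_pt, ← leg_mul, pt_mul_cpt hV.star_mul_self]

theorem pentagon_amp {i j k : Fin m} (hij : i ≠ j) (hik : i ≠ k) (hjk : j ≠ k) :
    amp (pair i j hij) V * amp (pair i k hik) V * amp (pair j k hjk) V =
      amp (pair j k hjk) V * amp (pair i j hij) V := by
  simpa only [map_mul, amp_pair, triple_zero, triple_one, triple_two] using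
    congrArg (amp (triple i j k hij hik hjk)) hV.pentagon

end IsRegularMU
end general

theorem single_commute_pair_star {m : ℕ} {i j k : Fin m} (hjk : j ≠ k) (h1 : i ≠ j) (h2 : i ≠ k)
    (E : OpSpace X 1) (T : Op X 2) : leg (single i) E * pt (star (amp (pair j k hjk) T)) =
      pt (star (amp (pair j k hjk) T)) * leg (single i) E := by
  rw [← map_star]
  exact single_commute_pair hjk h1 h2 E _

theorem leg_cpt_mul_leg_cpt_self {m : ℕ} (i : Fin m) :
    leg (single i) (cpt (X := X) 1) * leg (single i) (cpt 1) = leg (single i) (cpt 1) := by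
  rw [← leg_mul, cpt_mul_cpt]

/-- The pentagon solved for the adjoint of `a`. Both the slice calculations and the inversion
identities need it in this form. -/
theorem star_mul_star_mul_of_pentagon {R : Type*} [Monoid R] [StarMul R] {a b c : R}
    (q : a * b * c = c * a) (ha : star a * a = 1) (ha' : a * star a = 1) (hb : star b * b = 1) :
    star b * star a * c = c * star a := by
  calc star b * star a * c = star b * (star a * (c * a)) * star a := by
        simp only [mul_assoc, ha', mul_one]
    _ = star b * (star a * a) * b * c * star a := by rw [← q]; simp only [mul_assoc]
    _ = c * star a := by rw [ha, mul_one, hb, one_mul]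

namespace IsRegularMU
variable {V : Op X 2} (hV : IsRegularMU V) [Nontrivial (L2 X 1)]
include hV

theorem pt_pentagon₁ : pt (amp (pair (0 : Fin 3) 2 (by decide)) V) *
      pt (amp (pair 1 2 (by decide)) V) = pt (star (amp (pair 0 1 (by decide)) V)) *
      pt (amp (pair 1 2 (by decide)) V) * pt (amp (pair 0 1 (by decide)) V) := by
  rw [pt_mul, pt_mul, pt_mul, mul_assoc (star _), ← hV.pentagon, mul_assoc, ← mul_assoc (star _),
    hV.star_mul_amp, one_mul]

/-- The left side is self-adjoint, so this one equality yields both self-adjointness of the slices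
and their closure under products. -/
theorem star_slices_mul_slices : star (slices V) * slices V = slices V := by
  refine eq_of_cpt_mul_cpt_mul_eq ?_
  rw [leg_mul]
  refine QuantumHeisenberg.star_slices_mul_slices
    (W₀₂ := pt (star (amp (pair 0 2 (by decide)) V))) (V₁₂ := pt (amp (pair 1 2 (by decide)) V))
    (W₀₁ := pt (star (amp (pair 0 1 (by decide)) V)))
    (single_commute_pair_star _ (by decide) (by decide) _ _)
    (single_commute_pair _ (by decide) (by decide) _ _)
    (single_commute_single (by decide) _ _) (leg_cpt_mul_leg_cpt_self _)
    (cpt_mul_amp_star_mul_cpt _ V) (cpt_mul_amp_mul_cpt _ V)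
    (single_commute_single (by decide) _ _) (single_commute_single (by decide) _ _)
    (hV.regular_amp _) ?_ (hV.star_amp_mul_cpt _)
  rw [pt_mul, pt_mul, pt_mul, star_mul_star_mul_of_pentagon hV.pentagon (hV.star_mul_amp _)
    (hV.amp_mul_star _) (hV.star_mul_amp _)]

theorem star_slices : star (slices V) = slices V := by
  conv_lhs => rw [← hV.star_slices_mul_slices]
  rw [star_mul, star_star, hV.star_slices_mul_slices]

theorem slices_mul_slices : slices V * slices V = slices V := by
  have := hV.star_slices_mul_slices
  rwa [hV.star_slices] at this

theorem pt_mul_cpt_slices :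
    pt V * (leg (single (0 : Fin 2)) (cpt 1) * leg (single 1) (slices V)) =
      leg (single 0) (cpt 1) * leg (single 1) (slices V) := by
  refine eq_of_cpt_mul_eq_three (X := X) (i := 1) (j := 0) (k := 2) (by decide) (by decide)
    (by decide) ?_
  simp only [leg_mul, leg_single, leg_pt, pair_zero, pair_one]
  exact unitary_mul_cpt_slices (single_commute_pair _ (by decide) (by decide) _ _)
    (single_commute_pair _ (by decide) (by decide) _ _)
    (single_commute_single (by decide) _ _) (cpt_mul_amp_mul_cpt _ V) (hV.regular_amp _)
    hV.pt_pentagon₁ (hV.amp_mul_cpt _)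

theorem amp_mul_cpt_slices {m : ℕ} {i j : Fin m} (h : i ≠ j) :
    pt (amp (pair i j h) V) * (leg (single i) (cpt 1) * leg (single j) (slices V)) =
      leg (single i) (cpt 1) * leg (single j) (slices V) := by
  simpa [leg_mul] using congrArg (leg (pair i j h)) hV.pt_mul_cpt_slices

theorem star_amp_mul_cpt_slices {m : ℕ} {i j : Fin m} (h : i ≠ j) :
    pt (star (amp (pair i j h) V)) * (leg (single i) (cpt 1) * leg (single j) (slices V)) =
      leg (single i) (cpt 1) * leg (single j) (slices V) := by
  conv_lhs => rw [← hV.amp_mul_cpt_slices h]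
  rw [← mul_assoc, pt_star_mul_pt (hV.star_mul_amp h), one_mul]

theorem comul_mul_slices :
    pt V * leg (single (0 : Fin 2)) (slices V) * pt (star V) *
      (leg (single 0) (slices V) * leg (single 1) (slices V)) =
      leg (single 0) (slices V) * leg (single 1) (slices V) := by
  refine eq_of_cpt_mul_eq_three (X := X) (i := 0) (j := 1) (k := 2) (by decide) (by decide)
    (by decide) ?_
  simp only [leg_mul, leg_single, leg_pt, pair_zero, pair_one, map_star]
  refine QuantumHeisenberg.comul_mul_slices (single_commute_pair _ (by decide) (by decide) _ _)
    (single_commute_pair_star _ (by decide) (by decide) _ _) (leg_cpt_mul_leg_cpt_self _)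
    (cpt_mul_amp_mul_cpt (by decide) V) (single_commute_single (by decide) _ _) ?_
    (hV.amp_mul_cpt_slices _) (hV.amp_mul_cpt_slices (j := 2) (by decide))
  rw [pt_mul, pt_mul, ← hV.pentagon, pt_mul, mul_assoc, hV.amp_mul_star, mul_one]

/-- If `A` is the algebra of right slices of `V`, then `V` is a multiplier of `A ⊗ B`. -/
theorem star_pt_mul_slices_slices {A : OpSpace X 1} (hA : star A = A) (hAA : A * A = A)
    (hs : leg (single (1 : Fin 2)) (cpt 1) * pt V * leg (single 1) (cpt 1) =
      leg (single 1) (cpt 1) * leg (single 0) A)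
    (hi : pt V * (leg (single (0 : Fin 2)) A * leg (single 1) (cpt 1)) =
      leg (single 0) A * leg (single 1) (cpt 1)) :
    pt (star V) * (leg (single (0 : Fin 2)) A * leg (single 1) (slices V)) =
      leg (single 0) A * leg (single 1) (slices V) := by
  refine eq_of_cpt_mul_eq_three (X := X) (i := 1) (j := 0) (k := 2) (by decide) (by decide)
    (by decide) ?_
  simp only [leg_mul, leg_single, leg_pt, pair_zero, pair_one, map_star]
  have hs' : leg (single (1 : Fin 2)) (cpt 1) * pt (star V) * leg (single 1) (cpt 1) =
      leg (single 1) (cpt 1) * leg (single 0) A := by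
    have := congrArg star hs
    simp only [star_mul, star_leg, star_cpt, star_pt, hA] at this
    rw [single_commute_single (by decide), ← this, mul_assoc]
  have hi' : pt (star V) * (leg (single (0 : Fin 2)) A * leg (single 1) (cpt 1)) =
      leg (single 0) A * leg (single 1) (cpt 1) := by
    conv_lhs => rw [← hi]
    rw [← mul_assoc, pt_star_mul_pt hV.star_mul_self, one_mul]
  refine unitary_mul_slices_slices (W₀₁ := pt (star (amp (pair 0 1 (by decide)) V)))
    (V₁₂ := pt (amp (pair 1 2 (by decide)) V)) (W₁₂ := pt (star (amp (pair 1 2 (by decide)) V)))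
    (single_commute_pair_star _ (by decide) (by decide) _ _) (leg_cpt_mul_leg_cpt_self _)
    (single_commute_single (by decide) _ _) (single_commute_single (by decide) _ _) ?_ ?_ ?_
    (hV.star_amp_mul_cpt_slices _) ?_ (hV.amp_mul_cpt_slices _)
  · simpa [leg_mul, map_star] using congrArg (leg (pair (0 : Fin 3) 1 (by decide))) hs'
  · rw [← leg_mul, hAA]
  · rw [pt_mul, pt_mul, pt_mul, ← star_mul_star_mul_of_pentagon hV.pentagon (hV.star_mul_amp _)
      (hV.amp_mul_star _) (hV.star_mul_amp _), mul_assoc, hV.amp_mul_star, mul_one]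
  · simpa [leg_mul, map_star] using congrArg (leg (pair (0 : Fin 3) 1 (by decide))) hi'

end IsRegularMU

end regular

section weighted
variable {X : Type} [MeasureSpace X] [SigmaFinite (volume : Measure X)]

/-! ### Weighted composition operators -/

/-- A weight and a map that define an isometric weighted composition operator. -/
structure IsWeightedMap {k : ℕ} (w : (Fin k → X) → ℂ) (φ : (Fin k → X) → (Fin k → X)) : Prop where
  measurable_weight : Measurable w
  measurable_map : Measurable φ
  weight_ne_zero : ∀ p, w p ≠ 0
  lintegral_eq : ∀ g : (Fin k → X) → ℝ≥0∞, Measurable g →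
    ∫⁻ p, ‖w p‖ₑ ^ 2 * g (φ p) = ∫⁻ p, g p

/-- `T` is the operator `(Tξ)(p) = w(p) ξ(φ(p))`. -/
structure IsWeightedComp {k : ℕ} (T : Op X k) (w : (Fin k → X) → ℂ)
    (φ : (Fin k → X) → (Fin k → X)) : Prop extends IsWeightedMap w φ where
  coeFn : ∀ ξ : L2 X k, T ξ =ᵐ[volume] fun p => w p * ξ (φ p)

namespace IsWeightedMap
variable {k : ℕ} {w v : (Fin k → X) → ℂ} {φ ψ : (Fin k → X) → (Fin k → X)}

theorem isWeightedComp (h : IsWeightedMap w φ) : IsWeightedComp (weightedComp w φ) w φ :=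
  ⟨h, weightedComp_coeFn h.1 h.2 h.3 h.4⟩

theorem quasiMeasurePreserving (h : IsWeightedMap w φ) :
    Measure.QuasiMeasurePreserving φ volume volume := by
  refine ⟨h.measurable_map, Measure.AbsolutelyContinuous.mk fun N hN hN0 => ?_⟩
  rw [Measure.map_apply h.measurable_map hN]
  have h1 := h.lintegral_eq (N.indicator 1) (measurable_one.indicator hN)
  have hm : Measurable fun p => ‖w p‖ₑ ^ 2 * (N.indicator 1 (φ p) : ℝ≥0∞) :=
    (h.measurable_weight.enorm.pow_const 2).mul
      ((measurable_one.indicator hN).comp h.measurable_map)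
  rw [lintegral_indicator_one hN, hN0, lintegral_eq_zero_iff hm] at h1
  rw [measure_eq_zero_iff_ae_notMem]
  filter_upwards [h1] with p hp hpN
  have : φ p ∈ N := hpN
  simp [this, h.weight_ne_zero] at hp

theorem comp (h : IsWeightedMap w φ) (h' : IsWeightedMap v ψ) :
    IsWeightedMap (fun p => w p * v (φ p)) (fun p => ψ (φ p)) where
  measurable_weight := h.1.mul (h'.1.comp h.2)
  measurable_map := h'.2.comp h.2
  weight_ne_zero p := mul_ne_zero (h.3 _) (h'.3 _)
  lintegral_eq g hg := by
    rw [← h'.lintegral_eq g hg, ← h.lintegral_eq (fun p => ‖v p‖ₑ ^ 2 * g (ψ p))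
      ((h'.1.enorm.pow_const 2).mul (hg.comp h'.2))]
    simp only [enorm_mul, mul_pow, mul_assoc]

/-- Only the modulus of the weight enters the change of variables, so phases may be altered freely.
-/
theorem congr_norm (h : IsWeightedMap w φ) (hv : Measurable v) (hvw : ∀ p, ‖v p‖ = ‖w p‖) :
    IsWeightedMap v φ where
  measurable_weight := hv
  measurable_map := h.2
  weight_ne_zero p := by
    rw [← norm_ne_zero_iff, hvw, norm_ne_zero_iff]
    exact h.3 p
  lintegral_eq g hg := by
    rw [← h.lintegral_eq g hg]
    simp only [← ofReal_norm, hvw]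

/-- The change of variables for `φ`, applied to the integrand that belongs to `ψ`, cancels the two
weights. -/
theorem inverse (h : IsWeightedMap w φ) (hψ : Measurable ψ) (h1 : ∀ p, ψ (φ p) = p) :
    IsWeightedMap (fun p => (w (ψ p))⁻¹) ψ where
  measurable_weight := (h.1.comp hψ).inv
  measurable_map := hψ
  weight_ne_zero p := inv_ne_zero (h.3 _)
  lintegral_eq g hg := by
    rw [← h.lintegral_eq (fun p => ‖(w (ψ p))⁻¹‖ₑ ^ 2 * g (ψ p))
      (((h.1.comp hψ).inv.enorm.pow_const 2).mul (hg.comp hψ))]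
    simp only [h1]
    congr 1
    funext p
    rw [← mul_assoc, ← mul_pow, ← enorm_mul, mul_inv_cancel₀ (h.3 p)]
    simp

end IsWeightedMap

namespace IsWeightedComp
variable {k : ℕ} {T S : Op X k} {w v : (Fin k → X) → ℂ} {φ ψ : (Fin k → X) → (Fin k → X)}

theorem mul (h : IsWeightedComp T w φ) (h' : IsWeightedComp S v ψ) :
    IsWeightedComp (T * S) (fun p => w p * v (φ p)) (fun p => ψ (φ p)) where
  toIsWeightedMap := h.toIsWeightedMap.comp h'.toIsWeightedMap
  coeFn ξ := by
    filter_upwards [h.coeFn (S ξ), h.quasiMeasurePreserving.ae (h'.coeFn ξ)] with p h1 h2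
    rw [mul_apply_eq_comp, h1, h2, mul_assoc]

theorem ext (h : IsWeightedComp T w φ) (h' : IsWeightedComp S v ψ) (hw : ∀ p, w p = v p)
    (hφ : ∀ p, φ p = ψ p) : T = S := by
  ext1 ξ
  ext1
  filter_upwards [h.coeFn ξ, h'.coeFn ξ] with p h1 h2
  rw [h1, h2, hw, hφ]

theorem congr (h : IsWeightedComp T w φ) (hw : ∀ p, v p = w p) (hφ : ∀ p, ψ p = φ p) :
    IsWeightedComp T v ψ := by
  rw [funext hw, funext hφ]
  exact h

theorem one : IsWeightedComp (1 : Op X k) (fun _ => 1) id where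
  measurable_weight := measurable_const
  measurable_map := measurable_id
  weight_ne_zero _ := one_ne_zero
  lintegral_eq g _ := by simp
  coeFn ξ := by simp

theorem norm_apply (h : IsWeightedComp T w φ) (ξ : L2 X k) : ‖T ξ‖ = ‖ξ‖ := by
  rw [Lp.norm_def, Lp.norm_def, eLpNorm_congr_ae (h.coeFn ξ)]
  congr 1
  have := h.lintegral_eq (fun p => ‖ξ p‖ₑ ^ 2)
    ((Lp.stronglyMeasurable ξ).measurable.enorm.pow_const 2)
  simp only [eLpNorm_eq_lintegral_rpow_enorm_toReal two_ne_zero ENNReal.ofNat_ne_top,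
    ENNReal.toReal_ofNat, ENNReal.rpow_ofNat, enorm_mul, mul_pow, this]

theorem star_mul_self (h : IsWeightedComp T w φ) : star T * T = 1 :=
  (ContinuousLinearMap.norm_map_iff_adjoint_comp_self T).1 h.norm_apply

theorem inner_apply_apply (h : IsWeightedComp T w φ) (ξ η : L2 X k) :
    ⟪T ξ, T η⟫_ℂ = ⟪ξ, η⟫_ℂ := by
  rw [← ContinuousLinearMap.adjoint_inner_right, ← ContinuousLinearMap.star_eq_adjoint,
    ← mul_apply_eq_comp, h.star_mul_self, one_apply_eq_self]

theorem mul_inverse (h : IsWeightedComp T w φ) (hψ : Measurable ψ) (h1 : ∀ p, ψ (φ p) = p) :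
    T * weightedComp (fun p => (w (ψ p))⁻¹) ψ = 1 :=
  (h.mul (h.inverse hψ h1).isWeightedComp).ext one
    (fun p => by rw [h1, mul_inv_cancel₀ (h.weight_ne_zero p)]) h1

/-- The weighted composition along a left inverse of `φ` is a right inverse of the isometry `T`, and
a right inverse of an isometry equals its adjoint. -/
theorem mul_star_self (h : IsWeightedComp T w φ) (hψ : Measurable ψ) (h1 : ∀ p, ψ (φ p) = p) :
    T * star T = 1 := by
  have h3 := h.mul_inverse hψ h1
  have h4 : star T = weightedComp (fun p => (w (ψ p))⁻¹) ψ := by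
    rw [← mul_one (star T), ← h3, ← mul_assoc, h.star_mul_self, one_mul]
  rw [h4, h3]

theorem reindexOp {m : ℕ} (e : Fin k ≃ Fin m) (h : IsWeightedComp T w φ) :
    IsWeightedComp (reindexOp e T) (fun x => w (fun a => x (e a)))
      (fun x i => φ (fun a => x (e a)) (e.symm i)) where
  measurable_weight := h.measurable_weight.comp (measurePreserving_reindex e).measurable
  measurable_map := (measurePreserving_reindex e.symm).measurable.comp
    (h.measurable_map.comp (measurePreserving_reindex e).measurable)
  weight_ne_zero p := h.weight_ne_zero _
  lintegral_eq g hg := by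
    have hg' : Measurable fun y : Fin k → X => g (fun i => y (e.symm i)) :=
      hg.comp (measurePreserving_reindex e.symm).measurable
    have h1 := (measurePreserving_reindex (X := X) e).lintegral_comp
      (f := fun y => ‖w y‖ₑ ^ 2 * g (fun i => φ y (e.symm i)))
      ((h.measurable_weight.enorm.pow_const 2).mul (hg'.comp h.measurable_map))
    rw [h1, h.lintegral_eq _ hg', ← (measurePreserving_reindex (X := X) e.symm).lintegral_comp hg]
  coeFn ξ := by
    have hm := (measurePreserving_reindex (X := X) e).quasiMeasurePreserving
    filter_upwards [reindexL2_coeFn e (T (reindexL2 e.symm ξ)),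
      hm.ae (h.coeFn (reindexL2 e.symm ξ)),
      hm.ae (h.quasiMeasurePreserving.ae (reindexL2_coeFn e.symm ξ))] with x h1 h2 h3
    rw [reindexOp_apply, h1, h2, h3]

theorem opTensor_one {l : ℕ} (h : IsWeightedComp T w φ) :
    IsWeightedComp (opTensor T (1 : Op X l)) (fun x => w (split k l x).1)
      (fun x => Fin.append (φ (split k l x).1) (split k l x).2) := by
  have hs := measurePreserving_split (X := X) k l
  have ha : Measurable fun p : (Fin k → X) × (Fin l → X) => Fin.append p.1 p.2 := by
    refine measurable_pi_lambda _ fun i => ?_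
    refine Fin.addCases (fun i => ?_) (fun i => ?_) i
    · simp only [Fin.append_left]; fun_prop
    · simp only [Fin.append_right]; fun_prop
  have hsa : ∀ p : (Fin k → X) × (Fin l → X), split k l (Fin.append p.1 p.2) = p := fun p => by
    ext i <;> simp [split]
  have has : ∀ x : Fin (k + l) → X, Fin.append (split k l x).1 (split k l x).2 = x := fun x => by
    funext i
    refine Fin.addCases (fun i => ?_) (fun i => ?_) i <;> simp [split]
  have hφ := h.measurable_map
  have hM : IsWeightedMap (fun x => w (split k l x).1)
      (fun x => Fin.append (φ (split k l x).1) (split k l x).2) :=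
    { measurable_weight := h.measurable_weight.comp (measurable_fst.comp hs.measurable)
      measurable_map := ha.comp (((h.measurable_map.comp measurable_fst).prodMk measurable_snd).comp hs.measurable)
      weight_ne_zero := fun p => h.weight_ne_zero _
      lintegral_eq := fun g hg => by
        have hg' : Measurable fun p : (Fin k → X) × (Fin l → X) => g (Fin.append p.1 p.2) :=
          hg.comp ha
        have hg'' : Measurable fun p : (Fin k → X) × (Fin l → X) =>
            ‖w p.1‖ₑ ^ 2 * g (Fin.append (φ p.1) p.2) :=
          ((h.measurable_weight.comp measurable_fst).enorm.pow_const 2).mul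
            (hg'.comp ((h.measurable_map.comp measurable_fst).prodMk measurable_snd))
        have h1 := hs.lintegral_comp hg''
        have h2 := hs.lintegral_comp hg'
        simp only [has] at h2
        rw [h1, h2, Measure.volume_eq_prod, lintegral_prod_symm _ hg''.aemeasurable,
          lintegral_prod_symm _ hg'.aemeasurable]
        congr 1
        funext q
        exact h.lintegral_eq (fun p => g (Fin.append p q)) (hg'.comp (measurable_id.prodMk measurable_const)) }
  have hW := hM.isWeightedComp
  have : opTensor T (1 : Op X l) = weightedComp (fun x => w (split k l x).1)
      (fun x => Fin.append (φ (split k l x).1) (split k l x).2) := by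
    refine clm_ext_vecTensor fun ξ η => ?_
    ext1
    filter_upwards [hW.coeFn (vecTensor k l ξ η), vecTensor_coeFn (T ξ) η,
      hW.quasiMeasurePreserving.ae (vecTensor_coeFn ξ η), ae_split_fst l (h.coeFn ξ)]
      with x h1 h2 h3 h4
    rw [h1, opTensor_vecTensor, one_apply_eq_self, h2, h3, h4, hsa (φ _, _)]
    ring
  rw [this]
  exact hW

/-- The map `Φ` is characterised by its coordinates and not built from a chosen bijection, so that
explicit formulas can be supplied for it. -/
theorem amp {m : ℕ} (f : Fin k ↪ Fin m) (h : IsWeightedComp T w φ)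
    {Φ : (Fin m → X) → (Fin m → X)} (h1 : ∀ x a, Φ x (f a) = φ (fun b => x (f b)) a)
    (h2 : ∀ x i, i ∉ Set.range f → Φ x i = x i) :
    IsWeightedComp (amp f T) (fun x => w (fun a => x (f a))) Φ := by
  obtain ⟨l, e, he⟩ := exists_equiv_extending f
  rw [amp_eq e he]
  refine (h.opTensor_one.reindexOp e).congr (fun x => ?_) fun x => ?_
  · congr 1
    funext a
    simp [split, he]
  · funext i
    obtain ⟨c, rfl⟩ := e.surjective i
    rw [Equiv.symm_apply_apply]
    refine Fin.addCases (fun a => ?_) (fun b => ?_) c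
    · rw [he, h1, Fin.append_left]
      congr 1
      funext b
      simp [split, he]
    · rw [Fin.append_right, h2]
      · rfl
      · rintro ⟨a, ha⟩
        rw [← he] at ha
        have := congrArg Fin.val (e.injective ha)
        simp only [Fin.val_castAdd, Fin.val_natAdd] at this
        have := a.2
        omega

end IsWeightedComp

/-! ### A criterion for regularity -/

open InnerProductSpace (rankOne)
open OpSpace

theorem Lp_star_add {k : ℕ} (ξ η : L2 X k) : star (ξ + η) = star ξ + star η :=
by
  ext1
  filter_upwards [Lp.coeFn_star (ξ + η), Lp.coeFn_add (star ξ) (star η), Lp.coeFn_star ξ,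
    Lp.coeFn_star η, Lp.coeFn_add ξ η] with x h1 h2 h3 h4 h5
  rw [h1, h2, Pi.star_apply, h5, Pi.add_apply, Pi.add_apply, h3, h4, star_add]
  rfl

theorem Lp_star_smul {k : ℕ} (c : ℂ) (ξ : L2 X k) : star (c • ξ) = star c • star ξ :=
by
  ext1
  filter_upwards [Lp.coeFn_star (c • ξ), Lp.coeFn_smul (star c) (star ξ), Lp.coeFn_star ξ,
    Lp.coeFn_smul c ξ] with x h1 h2 h3 h4
  rw [h1, h2, Pi.star_apply, h4, Pi.smul_apply, Pi.smul_apply, h3, star_smul]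
  rfl

theorem norm_Lp_star {k : ℕ} (ξ : L2 X k) : ‖star ξ‖ = ‖ξ‖ := by
  rw [Lp.norm_def, Lp.norm_def, eLpNorm_congr_ae (Lp.coeFn_star ξ)]
  congr 1
  exact eLpNorm_congr_norm_ae (Filter.Eventually.of_forall fun x => by simp)

theorem inner_Lp_star {k : ℕ} (ξ η : L2 X k) : ⟪star ξ, η⟫_ℂ = ⟪star η, ξ⟫_ℂ := by
  rw [L2.inner_def, L2.inner_def]
  apply integral_congr_ae
  filter_upwards [Lp.coeFn_star ξ, Lp.coeFn_star η] with x h1 h2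
  rw [h1, h2]
  simp [mul_comm]

theorem norm_vecTensor {a b : ℕ} (ξ : L2 X a) (η : L2 X b) :
    ‖vecTensor a b ξ η‖ = ‖ξ‖ * ‖η‖ := by
  have h := inner_vecTensor ξ ξ η η
  rw [inner_self_eq_norm_sq_to_K, inner_self_eq_norm_sq_to_K, inner_self_eq_norm_sq_to_K,
    ← mul_pow] at h
  have h2 : ‖vecTensor a b ξ η‖ ^ 2 = (‖ξ‖ * ‖η‖) ^ 2 := by exact_mod_cast h
  exact (sq_eq_sq₀ (norm_nonneg _) (by positivity)).1 h2

/-- The operator with kernel `u`. -/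
def kernelOp : L2 X (1 + 1) →L[ℂ] Op X 1 :=
  LinearMap.mkContinuous₂ (LinearMap.mk₂ ℂ
    (fun (u : L2 X (1 + 1)) (α : L2 X 1) =>
      ContinuousLinearMap.adjoint (tensorRight 1 (star α)) u)
    (fun u v α => map_add _ u v) (fun c u α => map_smul _ c u)
    (fun u α β => by
      refine ext_inner_left ℂ fun η => ?_
      simp only [inner_add_right, ContinuousLinearMap.adjoint_inner_right, tensorRight_apply,
        Lp_star_add, map_add, inner_add_left])
    (fun c u α => by
      refine ext_inner_left ℂ fun η => ?_
      simp only [inner_smul_right, ContinuousLinearMap.adjoint_inner_right, tensorRight_apply,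
        Lp_star_smul, map_smul, inner_smul_left, RCLike.star_def, RCLike.conj_conj])) 1
    (fun u α => by
      have h : ‖tensorRight 1 (star α)‖ ≤ ‖α‖ :=
        ContinuousLinearMap.opNorm_le_bound _ (norm_nonneg _) fun η => by
          rw [tensorRight_apply, norm_vecTensor, norm_Lp_star, mul_comm]
      have h2 := ContinuousLinearMap.le_opNorm
        (ContinuousLinearMap.adjoint (tensorRight 1 (star α))) u
      rw [LinearIsometryEquiv.norm_map] at h2
      calc _ ≤ _ := h2
        _ ≤ ‖α‖ * ‖u‖ := by gcongr
        _ = _ := by ring)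

theorem inner_kernelOp (u : L2 X (1 + 1)) (α δ : L2 X 1) :
    ⟪δ, kernelOp u α⟫_ℂ = ⟪vecTensor 1 1 δ (star α), u⟫_ℂ := by
  have : kernelOp u α = ContinuousLinearMap.adjoint (tensorRight 1 (star α)) u := rfl
  rw [this, ContinuousLinearMap.adjoint_inner_right, tensorRight_apply]

theorem kernelOp_vecTensor (f g : L2 X 1) :
    kernelOp (vecTensor 1 1 f g) = rankOne ℂ f (star g) := by
  ext1 α
  refine ext_inner_left ℂ fun δ => ?_
  rw [inner_kernelOp, inner_vecTensor, InnerProductSpace.rankOne_apply, inner_smul_right,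
    inner_Lp_star, mul_comm]

/-- The operator `α ⊗ β ↦ ⟪d, β⟫ a ⊗ T α`. -/
def shiftOp (a d : L2 X 1) : Op X 1 →L[ℂ] Op X (1 + 1) :=
  (ContinuousLinearMap.compL ℂ (L2 X (1 + 1)) (L2 X 1) (L2 X (1 + 1)) (tensorLeft a 1)).comp
  ((ContinuousLinearMap.compL ℂ (L2 X (1 + 1)) (L2 X 1) (L2 X 1)).flip
    (ContinuousLinearMap.adjoint (tensorRight 1 d)))

theorem shiftOp_vecTensor (a d : L2 X 1) (T : Op X 1) (α β : L2 X 1) :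
    shiftOp a d T (vecTensor 1 1 α β) = ⟪d, β⟫_ℂ • vecTensor 1 1 a (T α) := by
  have : ContinuousLinearMap.adjoint (tensorRight 1 d) (vecTensor 1 1 α β) = ⟪d, β⟫_ℂ • α := by
    refine ext_inner_left ℂ fun η => ?_
    rw [ContinuousLinearMap.adjoint_inner_right, tensorRight_apply, inner_vecTensor,
      inner_smul_right, mul_comm]
  change tensorLeft a 1 (T (ContinuousLinearMap.adjoint (tensorRight 1 d) (vecTensor 1 1 α β))) = _
  rw [this, map_smul, map_smul, tensorLeft_apply]

theorem shiftOp_rankOne (a d f g : L2 X 1) :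
    shiftOp a d (rankOne ℂ f g) = rankOne ℂ (vecTensor 1 1 a f) (vecTensor 1 1 g d) := by
  refine clm_ext_vecTensor fun α β => ?_
  rw [shiftOp_vecTensor, InnerProductSpace.rankOne_apply, InnerProductSpace.rankOne_apply,
    inner_vecTensor, map_smul, smul_smul, mul_comm]

/-- In `|x ⊗ x'⟩⟨y ⊗ y'|` the vectors `x` and `y'` serve as parameters `a`, `d` of `shiftOp`. What
remains is `|x'⟩⟨y|`, the operator with kernel `x' ⊗ star y`, and by continuity every square
integrable kernel is allowed. -/
theorem cpt_mul_cpt_eq_kernel : leg (Fin.castAddEmb 1) (cpt (X := X) 1) *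
    leg (Fin.natAddEmb 1) (cpt 1) =
      clSpan {T | ∃ a d u, T = shiftOp a d (kernelOp u)} := by
  rw [leg_cpt_mul_leg_cpt]
  apply le_antisymm
  · rw [← leg_cpt_mul_leg_cpt, cpt, leg_clSpan, leg_clSpan, clSpan_mul_clSpan]
    refine clSpan_mono ?_
    rintro _ ⟨_, ⟨_, ⟨x, y, rfl⟩, rfl⟩, _, ⟨_, ⟨x', y', rfl⟩, rfl⟩, rfl⟩
    refine ⟨x, y', vecTensor 1 1 x' (star y), ?_⟩
    rw [kernelOp_vecTensor, star_star, shiftOp_rankOne]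
    exact (opTensor_eq_amp _ _).symm.trans (opTensor_rankOne x y x' y')
  · rw [clSpan_le]
    rintro _ ⟨a, d, u, rfl⟩
    have : (cpt (X := X) (1 + 1)).comap ((shiftOp a d).comp kernelOp) = ⊤ :=
      closedSubmodule_eq_top fun ξ η => by
        rw [ClosedSubmodule.mem_comap, ContinuousLinearMap.comp_apply, kernelOp_vecTensor,
          shiftOp_rankOne]
        exact rankOne_mem_cpt _ _
    exact (eq_top_iff.1 this) (ClosedSubmodule.mem_top (x := u))

/-- If the matrix coefficients of `V` are given by a unitary transformation of the kernels, then
`V` is regular. -/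
theorem cpt_mul_pt_mul_cpt_of_kernel {V N : Op X (1 + 1)}
    (hN : Function.Surjective N)
    (h : ∀ b c α δ : L2 X 1, ⟪vecTensor 1 1 b δ, V (vecTensor 1 1 α c)⟫_ℂ =
      ⟪vecTensor 1 1 δ (star α), N (vecTensor 1 1 (star b) c)⟫_ℂ) :
    leg (Fin.castAddEmb 1) (cpt (X := X) 1) * pt V * leg (Fin.natAddEmb 1) (cpt 1) =
      leg (Fin.castAddEmb 1) (cpt 1) * leg (Fin.natAddEmb 1) (cpt 1) := by
  -- The product sends `α ⊗ β` to `⟪d, β⟫ a ⊗ Tα`, where `Tα` is obtained from `V (α ⊗ c)` by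
  -- pairing its first leg with `b`. The hypothesis `h` says that `T` has kernel `N (star b ⊗ c)`.
  have h0 : ∀ a b c d : L2 X 1, opTensor (rankOne ℂ a b) (1 : Op X 1) * V *
      opTensor (1 : Op X 1) (rankOne ℂ c d) =
      shiftOp a d (kernelOp (N (vecTensor 1 1 (star b) c))) := by
    intro a b c d
    refine clm_ext_vecTensor fun α β => ?_
    rw [mul_apply_eq_comp, mul_apply_eq_comp, opTensor_vecTensor, shiftOp_vecTensor,
      InnerProductSpace.rankOne_apply, map_smul, map_smul, map_smul, one_apply_eq_self,
      opTensor_rankOne_one]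
    congr 2
    refine ext_inner_left ℂ fun δ => ?_
    rw [ContinuousLinearMap.adjoint_inner_right, tensorLeft_apply, h, inner_kernelOp]
  have h1 : leg (Fin.castAddEmb 1) (cpt (X := X) 1) * pt V * leg (Fin.natAddEmb 1) (cpt 1) =
      clSpan {T | ∃ a d b c, T = shiftOp a d (kernelOp (N (vecTensor 1 1 (star b) c)))} := by
    rw [cpt, leg_clSpan, leg_clSpan, pt, clSpan_mul_clSpan, clSpan_mul_clSpan,
      Set.image2_image_left, Set.image2_image_right, Set.image2_singleton_right,
      Set.image2_image_left]
    congr 1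
    ext T
    constructor
    · rintro ⟨_, ⟨a, b, rfl⟩, _, ⟨c, d, rfl⟩, rfl⟩
      refine ⟨a, d, b, c, ?_⟩
      simp only [amp_castAdd, amp_natAdd, h0]
    · rintro ⟨a, d, b, c, rfl⟩
      refine ⟨_, ⟨a, b, rfl⟩, _, ⟨c, d, rfl⟩, ?_⟩
      simp only [amp_castAdd, amp_natAdd, h0]
  rw [h1, cpt_mul_cpt_eq_kernel]
  apply le_antisymm
  · refine clSpan_mono ?_
    rintro _ ⟨a, d, b, c, rfl⟩
    exact ⟨a, d, _, rfl⟩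
  · set G : OpSpace X (1 + 1) :=
      clSpan {T | ∃ a d b c, T = shiftOp a d (kernelOp (N (vecTensor 1 1 (star b) c)))}
    rw [clSpan_le]
    rintro _ ⟨a, d, u, rfl⟩
    -- Every kernel is `N u` for some `u`, and `u` is approximated by sums of the tensors `star b ⊗
    -- c`.
    obtain ⟨u, rfl⟩ := hN u
    have : G.comap ((shiftOp a d).comp (kernelOp.comp N)) = ⊤ :=
      closedSubmodule_eq_top fun ξ η => mem_clSpan ⟨a, d, star ξ, η, by rw [star_star]; rfl⟩
    exact (eq_top_iff.1 this) (ClosedSubmodule.mem_top (x := u))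

end weighted

/-! ### Weighted compositions on two legs and their placement -/

section pairmaps
variable {X : Type} [MeasureSpace X] [SigmaFinite (volume : Measure X)]

theorem isWeightedMap_swap : IsWeightedMap (fun _ : Fin 2 → X => (1 : ℂ)) fun p => ![p 1, p 0] where
  measurable_weight := measurable_const
  measurable_map := by
    refine measurable_pi_lambda _ fun i => ?_
    fin_cases i
    · exact measurable_pi_apply 1
    · exact measurable_pi_apply 0
  weight_ne_zero _ := one_ne_zero
  lintegral_eq g hg := by
    have h : ∀ p : Fin 2 → X, ![p 1, p 0] = fun i => p (Equiv.swap 0 1 i) := fun p => by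
      funext i
      fin_cases i <;> simp
    simp only [enorm_one, one_pow, one_mul, h]
    exact measurePreserving_swap.lintegral_comp hg

/-- `V` is the weighted composition operator on `L²(X²)` with weight `w` and with the map
`(a, b) ↦ (f(a, b), g(a, b))`. -/
def IsPairComp (V : Op X 2) (w : X → X → ℂ) (f g : X → X → X) : Prop :=
  IsWeightedComp V (fun p => w (p 0) (p 1)) fun p => ![f (p 0) (p 1), g (p 0) (p 1)]

theorem IsPairComp.amp {m : ℕ} {V : Op X 2} {w : X → X → ℂ} {f g : X → X → X}
    (h : IsPairComp V w f g) {i j : Fin m} (hij : i ≠ j) :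
    IsWeightedComp (amp (pair i j hij) V) (fun x => w (x i) (x j))
      fun x => Function.update (Function.update x i (f (x i) (x j))) j (g (x i) (x j)) := by
  refine IsWeightedComp.amp (pair i j hij) h (fun x a => ?_) fun x a ha => ?_
  · fin_cases a
    · simp [hij]
    · simp
  · have h0 : a ≠ i := fun h0 => ha ⟨0, by simp [h0]⟩
    have h1 : a ≠ j := fun h1 => ha ⟨1, by simp [h1]⟩
    simp [h0, h1]

theorem isWeightedComp_amp_single {m : ℕ} {T : Op X 1} {w : X → ℂ} {f : X → X}
    (h : IsWeightedComp T (fun p => w (p 0)) fun p => ![f (p 0)]) (i : Fin m) :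
    IsWeightedComp (amp (single i) T) (fun x => w (x i))
      fun x => Function.update x i (f (x i)) := by
  refine IsWeightedComp.amp (single i) h (fun x a => ?_) fun x a ha => ?_
  · fin_cases a
    simp
  · have h0 : a ≠ i := fun h0 => ha ⟨0, by simp [h0]⟩
    simp [h0]

end pairmaps

/-! ### Exponentials, weights and elementary maps on phase space -/

section phase
variable (n : ℕ) (lam : ℝ)

/-- The planes `ℝⁿ × ℝⁿ` of the variables `(x, y)`. -/
abbrev Plane : Type := (Fin n → ℝ) × (Fin n → ℝ)

/-- `e^{λr}`. -/
def ex (r : ℝ) : ℝ := Real.exp (lam * r)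

/-- The weight `(e^{λs})ⁿ e(t)`. -/
def wt (s t : ℝ) : ℂ := (ex lam s : ℂ) ^ n * ee t

/-- The form `((x, y), (x', y')) ↦ β(x, y')`. -/
def bt {n : ℕ} (u v : Plane n) : ℝ := beta u.1 v.2

theorem ex_pos (r : ℝ) : 0 < ex lam r := Real.exp_pos _

theorem ex_ne_zero (r : ℝ) : ex lam r ≠ 0 := (ex_pos lam r).ne'

theorem ex_zero : ex lam 0 = 1 := by simp [ex]

theorem ex_add (r s : ℝ) : ex lam (r + s) = ex lam r * ex lam s := by
  rw [ex, ex, ex, mul_add, Real.exp_add]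

theorem ex_neg (r : ℝ) : ex lam (-r) = (ex lam r)⁻¹ := by
  rw [ex, ex, mul_neg, Real.exp_neg]

theorem ex_sub (r s : ℝ) : ex lam (r - s) = ex lam r * (ex lam s)⁻¹ := by
  rw [sub_eq_add_neg, ex_add, ex_neg]

/-- This cocycle identity, with `eta_zero`, is the property of η_λ on which the relations between
the operators depend. It treats λ = 0 and λ ≠ 0 uniformly from here on. -/
theorem eta_add (r s : ℝ) : eta lam (r + s) = eta lam r + ex lam r ^ 2 * eta lam s := by
  unfold eta ex
  split_ifs with h
  · simp [h]
  · rw [← Real.exp_nat_mul, show 2 * lam * (r + s) = 2 * lam * r + 2 * lam * s by ring,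
      Real.exp_add, show ((2 : ℕ) : ℝ) * (lam * r) = 2 * lam * r by push_cast; ring]
    field_simp
    ring

theorem eta_zero : eta lam 0 = 0 := by simp [eta]

theorem eta_neg (r : ℝ) : eta lam (-r) = -(ex lam r ^ 2)⁻¹ * eta lam r := by
  have h := eta_add lam r (-r)
  have h2 := ex_ne_zero lam r
  rw [add_neg_cancel, eta_zero] at h
  field_simp
  linarith

theorem eta_sub (r s : ℝ) :
    eta lam (r - s) = eta lam r - ex lam r ^ 2 * (ex lam s ^ 2)⁻¹ * eta lam s := by
  rw [sub_eq_add_neg, eta_add, eta_neg]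
  ring

theorem ee_add (s t : ℝ) : ee (s + t) = ee s * ee t := by
  rw [ee, ee, ee, ← Complex.exp_add]
  congr 1
  push_cast
  ring

theorem ee_zero : ee 0 = 1 := by simp [ee]

/-- Comparing the weights of two composites thus becomes comparing two real parameters. -/
theorem wt_mul (s t s' t' : ℝ) : wt n lam s t * wt n lam s' t' = wt n lam (s + s') (t + t') := by
  rw [wt, wt, wt, ex_add, ee_add]
  push_cast
  ring

theorem wt_zero : wt n lam 0 0 = 1 := by simp [wt, ex_zero, ee_zero]

theorem norm_wt (s t : ℝ) : ‖wt n lam s t‖ = ex lam s ^ n := by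
  rw [wt, norm_mul, norm_ee, norm_pow, Complex.norm_real, Real.norm_of_nonneg (ex_pos lam s).le,
    mul_one]

variable {n}

theorem bt_add_left (u v w : Plane n) : bt (u + v) w = bt u w + bt v w := by
  simp [bt, beta, add_mul, Finset.sum_add_distrib]

theorem bt_add_right (u v w : Plane n) : bt u (v + w) = bt u v + bt u w := by
  simp [bt, beta, mul_add, Finset.sum_add_distrib]

theorem bt_smul_left (c : ℝ) (u v : Plane n) : bt (c • u) v = c * bt u v := by
  simp [bt, beta, mul_assoc, Finset.mul_sum]

theorem bt_smul_right (c : ℝ) (u v : Plane n) : bt u (c • v) = c * bt u v := by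
  simp [bt, beta, mul_left_comm, Finset.mul_sum]

theorem bt_neg_left (u v : Plane n) : bt (-u) v = -bt u v := by
  simp [bt, beta]

theorem bt_neg_right (u v : Plane n) : bt u (-v) = -bt u v := by
  simp [bt, beta]

theorem bt_sub_left (u v w : Plane n) : bt (u - v) w = bt u w - bt v w := by
  rw [sub_eq_add_neg, bt_add_left, bt_neg_left, sub_eq_add_neg]

theorem bt_sub_right (u v w : Plane n) : bt u (v - w) = bt u v - bt u w := by
  rw [sub_eq_add_neg, bt_add_right, bt_neg_right, sub_eq_add_neg]

variable (n)

@[fun_prop]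
theorem measurable_ex : Measurable (ex lam) := by
  unfold ex
  fun_prop

theorem measurable_wt {α : Type} [MeasurableSpace α] {f g : α → ℝ} (hf : Measurable f)
    (hg : Measurable g) : Measurable fun a => wt n lam (f a) (g a) := by
  unfold wt
  have := (measurable_ex lam).comp hf
  have h2 := measurable_ee.comp hg
  exact ((Complex.measurable_ofReal.comp this).pow_const n).mul h2

theorem measurable_bt {α : Type} [MeasurableSpace α] {f g : α → Plane n} (hf : Measurable f)
    (hg : Measurable g) : Measurable fun a => bt (f a) (g a) :=
  measurable_beta n (measurable_fst.comp hf) (measurable_snd.comp hg)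

/-- Once `p 0` and the last coordinate of `p 1` are fixed, the map is a translation of the plane.
Shears are the building blocks for the changes of variables in the regularity proofs. -/
theorem isWeightedMap_shear {h : Phase n → ℝ → Plane n} (hh : Measurable (Function.uncurry h)) :
    IsWeightedMap (fun _ : Fin 2 → Phase n => (1 : ℂ))
      fun p => ![p 0, ((p 1).1 + h (p 0) (p 1).2, (p 1).2)] where
  measurable_weight := measurable_const
  measurable_map := by
    refine measurable_pi_lambda _ fun i => ?_
    fin_cases i
    · exact measurable_pi_apply 0
    · have h1 : Measurable fun p : Fin 2 → Phase n => h (p 0) (p 1).2 :=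
        hh.comp (f := fun p : Fin 2 → Phase n => (p 0, (p 1).2)) (by fun_prop)
      have h2 : Measurable fun p : Fin 2 → Phase n => (p 1).1 := by fun_prop
      have h3 : Measurable fun p : Fin 2 → Phase n => (p 1).2 := by fun_prop
      exact (h2.add h1).prodMk h3
  weight_ne_zero _ := one_ne_zero
  lintegral_eq g hg := by
    have := isAddHaar_plane n
    have he := (volume_preserving_piFinTwo (fun _ => Phase n)).symm
    have hm : Measurable fun p : Phase n × Phase n => h p.1 p.2.2 :=
      hh.comp (measurable_fst.prodMk (measurable_snd.comp measurable_snd))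
    have hg1 : Measurable fun p : Phase n × Phase n => g ![p.1, p.2] :=
      hg.comp (MeasurableEquiv.measurable (MeasurableEquiv.piFinTwo fun _ => Phase n).symm)
    have hg2 : Measurable fun p : Phase n × Phase n => g ![p.1, (p.2.1 + h p.1 p.2.2, p.2.2)] := by
      have h4 : Measurable fun p : Phase n × Phase n =>
          (p.1, ((p.2.1 + h p.1 p.2.2, p.2.2) : Phase n)) :=
        measurable_fst.prodMk (((measurable_fst.comp measurable_snd).add hm).prodMk
          (measurable_snd.comp measurable_snd))
      exact hg1.comp h4
    simp only [enorm_one, one_pow, one_mul]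
    rw [← he.lintegral_comp_emb (MeasurableEquiv.measurableEmbedding _),
      ← he.lintegral_comp_emb (MeasurableEquiv.measurableEmbedding _)]
    change ∫⁻ p : Phase n × Phase n, g ![p.1, (p.2.1 + h p.1 p.2.2, p.2.2)] =
      ∫⁻ p : Phase n × Phase n, g ![p.1, p.2]
    rw [Measure.volume_eq_prod, lintegral_prod _ hg2.aemeasurable,
      lintegral_prod _ hg1.aemeasurable]
    congr 1
    funext a
    have hg3 : Measurable fun b : Phase n => g ![a, b] := hg1.comp (f := fun b : Phase n => (a, b)) (by fun_prop)
    have hg4 : Measurable fun b : Phase n => g ![a, (b.1 + h a b.2, b.2)] :=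
      hg2.comp (g := fun p : Phase n × Phase n => g ![p.1, (p.2.1 + h p.1 p.2.2, p.2.2)])
        (f := fun b => (a, b)) (by fun_prop)
    rw [Measure.volume_eq_prod, lintegral_prod_symm _ hg4.aemeasurable,
      lintegral_prod_symm _ hg3.aemeasurable]
    congr 1
    funext r
    exact lintegral_add_right_eq_self (fun u : Plane n => g ![a, (u, r)]) (h a r)

/-! ### The operators of the construction -/

theorem isPairComp_U : IsPairComp (opU n lam)
    (fun a b => wt n lam (-b.2)
      (-(eta lam b.2 * bt ((ex lam b.2)⁻¹ • a.1) (b.1 - (ex lam b.2)⁻¹ • a.1))))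
    (fun a b => ((ex lam b.2)⁻¹ • a.1, a.2 + b.2))
    (fun a b => (b.1 - (ex lam b.2)⁻¹ • a.1, b.2)) := by
  have h : IsWeightedComp (opU n lam) (weightU n lam) (mapU n lam) :=
    { measurable_weight := measurable_weightU n lam
      measurable_map := measurable_mapU n lam
      weight_ne_zero := fun p => by
        rw [weightU]
        refine mul_ne_zero (pow_ne_zero _ (by exact_mod_cast (Real.exp_pos _).ne')) ?_
        rw [← norm_ne_zero_iff, norm_ee]
        exact one_ne_zero
      lintegral_eq := weightU_lintegral n lam
      coeFn := opU_coeFn n lam }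
  have he : ∀ r, Real.exp (-lam * r) = (ex lam r)⁻¹ := fun r => by
    rw [ex, ← Real.exp_neg, neg_mul]
  refine h.congr (fun p => ?_) fun p => ?_
  · simp only [weightU, he, wt, ex_neg]
    rfl
  · simp only [mapU, he]
    rfl

theorem isWeightedComp_J : IsWeightedComp (opJ n lam)
    (fun p => wt n lam (p 0).2 (-(eta lam (p 0).2 * bt (p 0).1 (p 0).1)))
    (fun p => ![(-(ex lam (p 0).2 • (p 0).1), -(p 0).2)]) := by
  have hmap : Measurable (mapJ n lam) := by
    refine measurable_pi_lambda _ fun i => ?_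
    fin_cases i
    simp only [mapJ]
    fun_prop
  have hwt : Measurable (weightJ n lam) :=
    measurable_wt n lam (f := fun p : Fin 1 → Phase n => (p 0).2)
      (g := fun p => -(eta lam (p 0).2 * bt (p 0).1 (p 0).1)) (by fun_prop)
      (((measurable_eta lam).comp (by fun_prop)).mul
        (measurable_bt n (by fun_prop) (by fun_prop))).neg
  exact
    { measurable_weight := hwt
      measurable_map := hmap
      weight_ne_zero := fun p => by
        rw [← norm_ne_zero_iff, norm_wt]
        exact pow_ne_zero _ (ex_ne_zero lam _)
      lintegral_eq := fun g hg => weightJ_lintegral n lam g hg hmap hwt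
      coeFn := opJ_coeFn n lam }

theorem opJ_mul_opJ : opJ n lam * opJ n lam = 1 := by
  refine ((isWeightedComp_J n lam).mul (isWeightedComp_J n lam)).ext IsWeightedComp.one
    (fun p => ?_) fun p => ?_
  · have := ex_ne_zero lam (p 0).2
    simp only [wt_mul, Matrix.cons_val_zero]
    rw [← wt_zero n lam]
    congr 1
    · ring
    · simp only [eta_neg, bt_neg_left, bt_neg_right, bt_smul_left, bt_smul_right]
      field_simp
      ring
  · funext i
    fin_cases i
    have := ex_ne_zero lam (p 0).2
    simp [ex_neg, smul_smul, this]

theorem star_opJ : star (opJ n lam) = opJ n lam := by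
  have h1 := (isWeightedComp_J n lam).star_mul_self
  rw [← mul_one (star _), ← opJ_mul_opJ, ← mul_assoc, h1, one_mul]

end phase

/-! ### The conjugates of U by j and their relations with U -/

section phase
variable (n : ℕ) (lam : ℝ)

theorem isPairComp_J_left : IsWeightedComp (amp (single (0 : Fin 2)) (opJ n lam))
    (fun p => wt n lam (p 0).2 (-(eta lam (p 0).2 * bt (p 0).1 (p 0).1)))
    (fun p => ![(-(ex lam (p 0).2 • (p 0).1), -(p 0).2), p 1]) := by
  refine (isWeightedComp_amp_single (w := fun a => wt n lam a.2 (-(eta lam a.2 * bt a.1 a.1)))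
    (f := fun a => (-(ex lam a.2 • a.1), -a.2)) (isWeightedComp_J n lam) 0).congr
    (fun p => rfl) fun p => ?_
  funext i
  fin_cases i <;> simp

theorem isPairComp_J_right : IsWeightedComp (amp (single (1 : Fin 2)) (opJ n lam))
    (fun p => wt n lam (p 1).2 (-(eta lam (p 1).2 * bt (p 1).1 (p 1).1)))
    (fun p => ![p 0, (-(ex lam (p 1).2 • (p 1).1), -(p 1).2)]) := by
  refine (isWeightedComp_amp_single (w := fun a => wt n lam a.2 (-(eta lam a.2 * bt a.1 a.1)))
    (f := fun a => (-(ex lam a.2 • a.1), -a.2)) (isWeightedComp_J n lam) 1).congr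
    (fun p => rfl) fun p => ?_
  funext i
  fin_cases i <;> simp

/-- Both sides are η(r + s). The identity is needed because the expansion by `eta_add` is not
symmetric, while polynomial arithmetic treats η(r) and η(s) as independent. -/
theorem eta_add_comm (r s : ℝ) :
    eta lam r + ex lam r ^ 2 * eta lam s = eta lam s + ex lam s ^ 2 * eta lam r := by
  rw [← eta_add, ← eta_add, add_comm]

/-- `(j ⊗ 1) U (j ⊗ 1)`. -/
def opQ : Op (Phase n) 2 :=
  amp (single 0) (opJ n lam) * opU n lam * amp (single 0) (opJ n lam)

/-- `(1 ⊗ j) U (1 ⊗ j)`. -/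
def opR : Op (Phase n) 2 :=
  amp (single 1) (opJ n lam) * opU n lam * amp (single 1) (opJ n lam)

/-- Conjugation by `j ⊗ 1` removes the scaling of the first plane, so the weight has modulus one. -/
theorem isPairComp_Q : IsPairComp (opQ n lam)
    (fun a b => wt n lam 0 (eta lam b.2 * (ex lam a.2 * (ex lam b.2)⁻¹ * bt a.1 b.1)))
    (fun a b => (a.1, a.2 - b.2))
    (fun a b => (b.1 + (ex lam a.2 * (ex lam b.2)⁻¹) • a.1, b.2)) := by
  refine (((isPairComp_J_left n lam).mul (isPairComp_U n lam)).mul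
    (isPairComp_J_left n lam)).congr (fun p => ?_) fun p => ?_
  · have h0 := ex_ne_zero lam (p 0).2
    have h1 := ex_ne_zero lam (p 1).2
    simp only [Matrix.cons_val_zero, Matrix.cons_val_one, wt_mul]
    congr 1
    · ring
    · simp only [eta_add, eta_neg, ex_neg, bt_neg_left, bt_neg_right, bt_smul_left, bt_smul_right,
        bt_sub_right]
      field_simp
      linear_combination bt (p 0).1 (p 0).1 * eta_add_comm lam (p 1).2 (p 0).2
  · have h0 := ex_ne_zero lam (p 0).2
    have h1 := ex_ne_zero lam (p 1).2
    funext i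
    fin_cases i
    · refine Prod.ext ?_ ?_
      · simp only [ex_add, ex_neg, Matrix.cons_val_zero, Matrix.cons_val_one, Fin.zero_eta]
        match_scalars
        field_simp
      · simp [sub_eq_add_neg, add_comm]
    · refine Prod.ext ?_ ?_
      · simp only [ex_add, ex_neg, Matrix.cons_val_zero, Matrix.cons_val_one, Fin.mk_one]
        module
      · simp

theorem isPairComp_R : IsPairComp (opR n lam)
    (fun a b => wt n lam b.2 (eta lam b.2 * bt b.1 a.1))
    (fun a b => (ex lam b.2 • a.1, a.2 - b.2))
    (fun a b => (b.1 + a.1, b.2)) := by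
  refine (((isPairComp_J_right n lam).mul (isPairComp_U n lam)).mul
    (isPairComp_J_right n lam)).congr (fun p => ?_) fun p => ?_
  · have h0 := ex_ne_zero lam (p 0).2
    have h1 := ex_ne_zero lam (p 1).2
    simp only [Matrix.cons_val_zero, Matrix.cons_val_one, wt_mul]
    congr 1
    · ring
    · simp only [eta_neg, ex_neg, bt_neg_left, bt_neg_right, bt_smul_left, bt_smul_right,
        bt_sub_right, bt_sub_left]
      field_simp
      ring
  · have h0 := ex_ne_zero lam (p 0).2
    have h1 := ex_ne_zero lam (p 1).2
    funext i
    fin_cases i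
    · refine Prod.ext ?_ ?_
      · simp [ex_neg]
      · simp [sub_eq_add_neg]
    · refine Prod.ext ?_ ?_
      · simp only [ex_neg, Matrix.cons_val_zero, Matrix.cons_val_one, Fin.mk_one]
        match_scalars <;> field_simp
      · simp

theorem pentagon_opU :
    amp (pair (0 : Fin 3) 1 (by decide)) (opU n lam) * amp (pair (0 : Fin 3) 2 (by decide)) (opU n lam) *
      amp (pair (1 : Fin 3) 2 (by decide)) (opU n lam) =
    amp (pair (1 : Fin 3) 2 (by decide)) (opU n lam) *
      amp (pair (0 : Fin 3) 1 (by decide)) (opU n lam) := by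
  have h := isPairComp_U n lam
  refine (((h.amp _).mul (h.amp _)).mul (h.amp _)).ext ((h.amp _).mul (h.amp _))
    (fun p => ?_) fun p => ?_
  · have h0 := ex_ne_zero lam (p 0).2
    have h1 := ex_ne_zero lam (p 1).2
    have h2 := ex_ne_zero lam (p 2).2
    simp [wt_mul]
    congr 1
    · ring
    · simp only [eta_add, bt_smul_left, bt_smul_right, bt_sub_right, bt_sub_left, ex_add]
      field_simp
      linear_combination (ex lam (p 1).2 * bt (p 0).1 (p 1).1 - bt (p 0).1 (p 0).1) *
        eta_add_comm lam (p 1).2 (p 2).2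
  · have h0 := ex_ne_zero lam (p 0).2
    have h1 := ex_ne_zero lam (p 1).2
    have h2 := ex_ne_zero lam (p 2).2
    funext i
    fin_cases i
    · simp [ex_add, smul_smul, add_assoc]
    · simp [ex_add]
      module
    · simp [ex_add]
      module

/-- This is the pentagon of Y after cancelling j on leg 2. The operator Q on the legs 2, 0 or 2, 1
is U conjugated by j on leg 2, and that j commutes with Q on the legs 1, 0. -/
theorem pentagon_opQ_opU :
    amp (pair (1 : Fin 3) 0 (by decide)) (opQ n lam) *
      amp (pair (2 : Fin 3) 0 (by decide)) (opU n lam) *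
      amp (pair (2 : Fin 3) 1 (by decide)) (opU n lam) =
    amp (pair (2 : Fin 3) 1 (by decide)) (opU n lam) *
      amp (pair (1 : Fin 3) 0 (by decide)) (opQ n lam) := by
  have h := isPairComp_U n lam
  have hQ := isPairComp_Q n lam
  refine (((hQ.amp _).mul (h.amp _)).mul (h.amp _)).ext ((h.amp _).mul (hQ.amp _))
    (fun p => ?_) fun p => ?_
  · have h0 := ex_ne_zero lam (p 0).2
    have h1 := ex_ne_zero lam (p 1).2
    have h2 := ex_ne_zero lam (p 2).2
    simp [wt_mul]
    congr 1
    · ring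
    · simp only [eta_sub, bt_smul_left, bt_smul_right, bt_sub_right, bt_sub_left, ex_sub,
        bt_add_right]
      field_simp
      ring
  · have h0 := ex_ne_zero lam (p 0).2
    have h1 := ex_ne_zero lam (p 1).2
    have h2 := ex_ne_zero lam (p 2).2
    funext i
    fin_cases i
    · simp [ex_sub]
      match_scalars <;> field_simp
    · simp [ex_sub, smul_smul]
      match_scalars
      field_simp
    · simp [ex_sub]
      match_scalars
      field_simp

/-- On the common leg 0 the left slices of U meet their conjugates by j, so this expresses that A
commutes with jAj. -/
theorem opU_mul_opR_comm :
    amp (pair (2 : Fin 3) 0 (by decide)) (opU n lam) *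
      amp (pair (1 : Fin 3) 0 (by decide)) (opR n lam) =
    amp (pair (1 : Fin 3) 0 (by decide)) (opR n lam) *
      amp (pair (2 : Fin 3) 0 (by decide)) (opU n lam) := by
  have h := isPairComp_U n lam
  have hR := isPairComp_R n lam
  refine ((h.amp _).mul (hR.amp _)).ext ((hR.amp _).mul (h.amp _))
    (fun p => ?_) fun p => ?_
  · have h0 := ex_ne_zero lam (p 0).2
    have h1 := ex_ne_zero lam (p 1).2
    have h2 := ex_ne_zero lam (p 2).2
    simp [wt_mul]
    congr 1
    simp only [bt_smul_left, bt_smul_right, bt_sub_right, bt_sub_left, bt_add_right]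
    ring
  · have h0 := ex_ne_zero lam (p 0).2
    have h1 := ex_ne_zero lam (p 1).2
    have h2 := ex_ne_zero lam (p 2).2
    funext i
    fin_cases i
    · simp
      match_scalars <;> field_simp
    · simp
    · simp

/-- The counterpart for the first leg of U: the right slices of U commute with their conjugates by
j. -/
theorem opU_mul_opQ_comm :
    amp (pair (1 : Fin 3) 2 (by decide)) (opU n lam) *
      amp (pair (1 : Fin 3) 0 (by decide)) (opQ n lam) =
    amp (pair (1 : Fin 3) 0 (by decide)) (opQ n lam) *
      amp (pair (1 : Fin 3) 2 (by decide)) (opU n lam) := by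
  have h := isPairComp_U n lam
  have hR := isPairComp_Q n lam
  refine ((h.amp _).mul (hR.amp _)).ext ((hR.amp _).mul (h.amp _))
    (fun p => ?_) fun p => ?_
  · have h0 := ex_ne_zero lam (p 0).2
    have h1 := ex_ne_zero lam (p 1).2
    have h2 := ex_ne_zero lam (p 2).2
    simp [wt_mul]
    congr 1
    simp only [bt_smul_left, bt_smul_right, bt_sub_right, ex_add]
    field_simp
    ring
  · have h0 := ex_ne_zero lam (p 0).2
    have h1 := ex_ne_zero lam (p 1).2
    have h2 := ex_ne_zero lam (p 2).2
    funext i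
    fin_cases i
    · simp [ex_add]
      match_scalars
      field_simp
    · simp [ex_add, smul_smul]
      ring
    · simp [ex_add]

end phase

theorem IsWeightedMap.congr_map {X : Type} [MeasureSpace X] [SigmaFinite (volume : Measure X)]
    {k : ℕ} {w : (Fin k → X) → ℂ} {φ ψ : (Fin k → X) → (Fin k → X)} (h : IsWeightedMap w φ)
    (hφ : ∀ p, ψ p = φ p) : IsWeightedMap w ψ := by
  rw [funext hφ]
  exact h

/-! ### Regularity of weighted composition operators -/

section regular
variable {X : Type} [MeasureSpace X] [SigmaFinite (volume : Measure X)]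
open OpSpace

/-- The matrix coefficient is the integral of conj b(p₀) conj δ(p₁) w(p) α(φ(p)₀) c(φ(p)₁). The
substitution p = μ(q) makes the arguments of δ and α the free variables q₀ and q₁. The remaining
factors are then the kernel, which is a weighted composition `N` of `star b ⊗ c`. -/
theorem inner_apply_vecTensor_eq {V M N : Op X 2} {w wM wN : (Fin 2 → X) → ℂ}
    {φ μ ν : (Fin 2 → X) → (Fin 2 → X)} (hV : IsWeightedComp V w φ)
    (hM : IsWeightedComp M wM μ) (hN : IsWeightedComp N wN ν) (hμ : ∀ p, μ p 1 = p 0)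
    (hφ : ∀ p, φ (μ p) 0 = p 1) (hν0 : ∀ p, ν p 0 = μ p 0) (hν1 : ∀ p, ν p 1 = φ (μ p) 1)
    (hw : ∀ p, wN p = starRingEnd ℂ (wM p) * wM p * w (μ p)) (b c α δ : L2 X 1) :
    ⟪vecTensor 1 1 b δ, V (vecTensor 1 1 α c)⟫_ℂ =
      ⟪vecTensor 1 1 δ (star α), N (vecTensor 1 1 (star b) c)⟫_ℂ := by
  have h0 : ∀ p : Fin (1 + 1) → X, (split 1 1 p).1 = fun _ => p 0 := fun p => by
    funext i
    fin_cases i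
    rfl
  have h1 : ∀ p : Fin (1 + 1) → X, (split 1 1 p).2 = fun _ => p 1 := fun p => by
    funext i
    fin_cases i
    rfl
  have hMV := hM.mul hV
  rw [← hM.inner_apply_apply (vecTensor 1 1 b δ), ← mul_apply_eq_comp, L2.inner_def, L2.inner_def]
  apply integral_congr_ae
  filter_upwards [hM.coeFn (vecTensor 1 1 b δ), hMV.coeFn (vecTensor 1 1 α c),
    hM.quasiMeasurePreserving.ae (vecTensor_coeFn b δ),
    hMV.quasiMeasurePreserving.ae (vecTensor_coeFn α c),
    hN.coeFn (vecTensor 1 1 (star b) c), vecTensor_coeFn δ (star α),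
    hN.quasiMeasurePreserving.ae (vecTensor_coeFn (star b) c),
    ae_split_snd 1 (Lp.coeFn_star α),
    hN.quasiMeasurePreserving.ae (ae_split_fst 1 (Lp.coeFn_star b))] with
    p e1 e2 e3 e4 e5 e6 e7 e8 e9
  rw [e1, e2, e3, e4, e5, e6, e7, e8, e9]
  simp only [h0, h1, hμ, hφ, hν0, hν1, hw, Pi.star_apply, RCLike.inner_apply, map_mul,
    RCLike.star_def, RCLike.conj_conj]
  ring

theorem single_zero_two : single (0 : Fin 2) = Fin.castAddEmb 1 := by
  ext i
  fin_cases i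
  rfl

theorem single_one_two : single (1 : Fin 2) = Fin.natAddEmb 1 := by
  ext i
  fin_cases i
  rfl

theorem cpt_mul_pt_mul_cpt_of_isWeightedComp {V M N : Op X 2} {w wM wN : (Fin 2 → X) → ℂ}
    {φ μ ν ρ : (Fin 2 → X) → (Fin 2 → X)} (hV : IsWeightedComp V w φ)
    (hM : IsWeightedComp M wM μ) (hN : IsWeightedComp N wN ν) (hμ : ∀ p, μ p 1 = p 0)
    (hφ : ∀ p, φ (μ p) 0 = p 1) (hν0 : ∀ p, ν p 0 = μ p 0) (hν1 : ∀ p, ν p 1 = φ (μ p) 1)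
    (hw : ∀ p, wN p = starRingEnd ℂ (wM p) * wM p * w (μ p)) (hρ : Measurable ρ)
    (hρν : ∀ p, ρ (ν p) = p) :
    leg (single (1 : Fin 2)) (cpt 1) * pt (star V) * leg (single 0) (cpt 1) =
      leg (single 0) (cpt 1) * leg (single 1) (cpt 1) := by
  have hs : Function.Surjective N := fun ξ => ⟨star N ξ, by
    rw [← mul_apply_eq_comp, hN.mul_star_self hρ hρν, one_apply_eq_self]⟩
  have h := congrArg star (cpt_mul_pt_mul_cpt_of_kernel hs
    (inner_apply_vecTensor_eq hV hM hN hμ hφ hν0 hν1 hw))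
  rw [← single_zero_two, ← single_one_two] at h
  simp only [star_mul, star_leg, star_cpt, star_pt] at h
  rw [mul_assoc, h]
  exact single_commute_single (by decide) _ _

end regular

/-! ### U and Y are regular multiplicative unitaries -/

section phase
variable (n : ℕ) (lam : ℝ)

theorem measurable_pairMap {X : Type} [MeasurableSpace X] {f g : (Fin 2 → X) → X}
    (hf : Measurable f) (hg : Measurable g) : Measurable fun p => ![f p, g p] := by
  refine measurable_pi_lambda _ fun i => ?_
  fin_cases i
  · exact hf
  · exact hg

/-- The scaling `(a, b) ↦ ((e^{λs} u, r - s), b)`, where `a = (u, r)` and `s` is the last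
coordinate of `b`. -/
theorem isWeightedMap_scale : IsWeightedMap (fun p : Fin 2 → Phase n => wt n lam (p 1).2 0)
    fun p => ![(ex lam (p 1).2 • (p 0).1, (p 0).2 - (p 1).2), p 1] := by
  -- The map of U followed by a shear cancelling its translation of the second plane is the inverse
  -- of the scaling, so the change of variables already proved for U suffices.
  have h1 := (isPairComp_U n lam).toIsWeightedMap.comp
    (isWeightedMap_shear n (h := fun a _ => a.1) (by unfold Function.uncurry; fun_prop))
  have hm : Measurable fun p : Fin 2 → Phase n =>
      ![((ex lam (p 1).2 • (p 0).1, (p 0).2 - (p 1).2) : Phase n), p 1] :=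
    measurable_pairMap (by fun_prop) (by fun_prop)
  refine (h1.inverse hm fun p => ?_).congr_norm (measurable_wt n lam (by fun_prop) (by fun_prop))
    fun p => ?_
  · funext i
    fin_cases i
    · simp [ex_ne_zero]
    · simp
  · simp [norm_wt, ex_neg]

/-- For λ = 0 the map of Q consists of this translation and a shear, and a second shear undoes the
first. -/
theorem isWeightedMap_translate : IsWeightedMap (fun _ : Fin 2 → Phase n => (1 : ℂ))
    fun p => ![((p 0).1, (p 0).2 - (p 1).2), p 1] := by
  have h1 := (isPairComp_Q n 0).toIsWeightedMap.comp
    (isWeightedMap_shear n (h := fun a _ => -(a.1 : Plane n))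
      (by unfold Function.uncurry; fun_prop))
  refine (h1.congr_norm measurable_const fun p => ?_).congr_map fun p => ?_
  · simp [norm_wt, ex_zero]
  · simp [ex]

theorem isPairComp_Y : IsPairComp (amp (pair 1 0 (by decide)) (opQ n lam))
    (fun a b => wt n lam 0 (eta lam a.2 * (ex lam b.2 * (ex lam a.2)⁻¹ * bt b.1 a.1)))
    (fun a b => (a.1 + (ex lam b.2 * (ex lam a.2)⁻¹) • b.1, a.2))
    (fun a b => (b.1, b.2 - a.2)) := by
  refine ((isPairComp_Q n lam).amp (by decide : (1 : Fin 2) ≠ 0)).congr (fun p => rfl) fun p => ?_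
  funext i
  fin_cases i <;> simp

theorem regular_opU : OpSpace.leg (single (1 : Fin 2)) (OpSpace.cpt 1) *
    OpSpace.pt (star (opU n lam)) * OpSpace.leg (single 0) (OpSpace.cpt 1) =
      OpSpace.leg (single 0) (OpSpace.cpt 1) * OpSpace.leg (single 1) (OpSpace.cpt 1) := by
  have hU := isPairComp_U n lam
  -- The map of `hM` sends (p₀, p₁) to ((e^{λs}u₁, r₁ - s), p₀), where s is the last coordinate of
  -- p₀ and p₁ = (u₁, r₁). It is the solution of μ(p)₁ = p₀ and φ(μ(p))₀ = p₁ for the map φ of U.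
  have hM := (isWeightedMap_swap.comp (isWeightedMap_scale n lam)).isWeightedComp
  have hN := (isWeightedMap_swap.comp ((isWeightedMap_shear n (h := fun a _ => -(a.1 : Plane n))
      (by unfold Function.uncurry; fun_prop)).comp (isWeightedMap_scale n lam))).congr_norm
      (((Complex.continuous_conj.measurable.comp hM.measurable_weight).mul
        hM.measurable_weight).mul (hU.measurable_weight.comp hM.measurable_map)) fun p => by
      have := ex_ne_zero lam (p 0).2
      simp [norm_wt, ex_neg, this]
  refine cpt_mul_pt_mul_cpt_of_isWeightedComp hU hM hN.isWeightedComp (fun p => ?_) (fun p => ?_)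
    (fun p => ?_) (fun p => ?_) (fun p => rfl)
    (ρ := fun p => ![(((p 1).1 + (ex lam (p 1).2)⁻¹ • (p 0).1, (p 1).2) : Phase n),
      ((ex lam (p 1).2)⁻¹ • (p 0).1, (p 0).2 + (p 1).2)])
    (measurable_pairMap (by fun_prop) (by fun_prop)) fun p => ?_
  · simp
  · simp [ex_ne_zero]
  · simp
  · simp [ex_ne_zero, sub_eq_add_neg]
  · funext i
    fin_cases i <;> simp [ex_ne_zero]

theorem regular_opQ : OpSpace.leg (single (1 : Fin 2)) (OpSpace.cpt 1) *
    OpSpace.pt (star (amp (pair 1 0 (by decide)) (opQ n lam))) *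
      OpSpace.leg (single 0) (OpSpace.cpt 1) =
      OpSpace.leg (single 0) (OpSpace.cpt 1) * OpSpace.leg (single 1) (OpSpace.cpt 1) := by
  have hU := isPairComp_Y n lam
  -- This shear cancels in advance the plane translation made by Y. Followed by the swap, it gives μ
  -- with μ(p)₁ = p₀ and φ(μ(p))₀ = p₁.
  have hS := isWeightedMap_shear n
    (h := fun a r => -((ex lam a.2 * (ex lam r)⁻¹) • a.1 : Plane n))
    (by unfold Function.uncurry; fun_prop)
  have hM := (hS.comp isWeightedMap_swap).isWeightedComp
  have hN := (hS.comp ((isWeightedMap_translate n).comp isWeightedMap_swap)).congr_norm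
      (((Complex.continuous_conj.measurable.comp hM.measurable_weight).mul
        hM.measurable_weight).mul (hU.measurable_weight.comp hM.measurable_map)) fun p => by
      simp [norm_wt, ex_zero]
  refine cpt_mul_pt_mul_cpt_of_isWeightedComp hU hM hN.isWeightedComp (fun p => ?_) (fun p => ?_)
    (fun p => ?_) (fun p => ?_) (fun p => rfl)
    (ρ := fun p => ![(((p 1).1, (p 0).2 + (p 1).2) : Phase n),
      ((p 0).1 + ex lam (p 1).2 • (p 1).1, (p 0).2)])
    (measurable_pairMap (by fun_prop) (by fun_prop)) fun p => ?_
  · simp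
  · simp
  · simp
  · simp
  · funext i
    fin_cases i <;> simp [ex_sub]

theorem flipOp_mul_mul_flipOp {X : Type} [MeasureSpace X] [SigmaFinite (volume : Measure X)]
    (T : Op X 2) : flipOp * T * flipOp = amp (pair 1 0 (by decide)) T := by
  have h : ∀ ξ : L2 X 2, flipOp ξ = reindexL2 (Equiv.swap 0 1) ξ := fun ξ => by
    ext1
    filter_upwards [flipOp_coeFn ξ, reindexL2_coeFn (Equiv.swap (0 : Fin 2) 1) ξ] with p h1 h2
    rw [h1, h2]
  have he : pair (1 : Fin 2) 0 (by decide) = (Equiv.swap (0 : Fin 2) 1).toEmbedding := by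
    ext i
    fin_cases i <;> rfl
  rw [he, amp_equiv]
  ext1 ξ
  rw [reindexOp_apply, mul_apply_eq_comp, mul_apply_eq_comp, h, h]
  rfl

theorem opY_eq : opY n lam = amp (pair 1 0 (by decide)) (opQ n lam) := by
  rw [opQ, ← flipOp_mul_mul_flipOp, single_zero_two, amp_castAdd]
  simp only [opY, mul_assoc]

theorem opX_eq : opX n lam = star (opQ n lam) := by
  rw [opX, opY_eq, flipOp_mul_mul_flipOp, map_star]
  rw [amp_amp (h := Function.Embedding.refl _) (fun i => by fin_cases i <;> rfl)]
  exact congrArg star (amp_id (fun _ => rfl) _)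

theorem star_opU_mul : star (opU n lam) * opU n lam = 1 := (isPairComp_U n lam).star_mul_self

theorem opU_mul_star : opU n lam * star (opU n lam) = 1 :=
  (isPairComp_U n lam).mul_star_self
    (ψ := fun p => ![((ex lam (p 1).2 • (p 0).1, (p 0).2 - (p 1).2) : Phase n),
      ((p 1).1 + (p 0).1, (p 1).2)]) (measurable_pairMap (by fun_prop) (by fun_prop)) fun p => by
    funext i
    fin_cases i <;> simp [ex_ne_zero]

theorem isRegularMU_opU : IsRegularMU (opU n lam) where
  star_mul_self := star_opU_mul n lam
  mul_star_self := opU_mul_star n lam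
  pentagon := pentagon_opU n lam
  regular := regular_opU n lam

theorem isRegularMU_opY : IsRegularMU (opY n lam) := by
  have hJ : ∀ i : Fin 3, amp (single i) (opJ n lam) * amp (single i) (opJ n lam) = 1 := fun i => by
    rw [← map_mul, opJ_mul_opJ, map_one]
  have hY : opY n lam = amp (single 1) (opJ n lam) * amp (pair 1 0 (by decide)) (opU n lam) *
      amp (single 1) (opJ n lam) := by
    rw [opY_eq, opQ]
    simp
  have hJ2 : amp (single (1 : Fin 2)) (opJ n lam) * amp (single 1) (opJ n lam) = 1 := by
    rw [← map_mul, opJ_mul_opJ, map_one]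
  have hJs : star (amp (single (1 : Fin 2)) (opJ n lam)) = amp (single 1) (opJ n lam) := by
    rw [← map_star, star_opJ]
  have h1 : star (amp (pair (1 : Fin 2) 0 (by decide)) (opU n lam)) *
      amp (pair 1 0 (by decide)) (opU n lam) = 1 := by
    rw [← map_star, ← map_mul, star_opU_mul, map_one]
  have h2 : amp (pair (1 : Fin 2) 0 (by decide)) (opU n lam) *
      star (amp (pair 1 0 (by decide)) (opU n lam)) = 1 := by
    rw [← map_star, ← map_mul, opU_mul_star, map_one]
  refine ⟨?_, ?_, ?_, ?_⟩
  · rw [hY]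
    simp only [star_mul, hJs, mul_assoc, mul_asc hJ2, mul_asc h1, one_mul, hJ2]
  · rw [hY]
    simp only [star_mul, hJs, mul_assoc, mul_asc hJ2, mul_asc h2, one_mul, hJ2]
  · rw [opY_eq]
    have h := pentagon_opQ_opU n lam
    have h20 : amp (pair (2 : Fin 3) 0 (by decide)) (opQ n lam) = amp (single 2) (opJ n lam) *
        amp (pair (2 : Fin 3) 0 (by decide)) (opU n lam) * amp (single 2) (opJ n lam) := by
      simp [opQ]
    have h21 : amp (pair (2 : Fin 3) 1 (by decide)) (opQ n lam) = amp (single 2) (opJ n lam) *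
        amp (pair (2 : Fin 3) 1 (by decide)) (opU n lam) * amp (single 2) (opJ n lam) := by
      simp [opQ]
    have hc : Commute (amp (single 2) (opJ n lam))
        (amp (pair (1 : Fin 3) 0 (by decide)) (opQ n lam)) :=
      amp_commute (by decide) _ _
    simp only [amp_pair, pair_zero, pair_one, h20, h21]
    -- The two inner copies of j on leg 2 cancel, and the outer ones can be taken out of the word.
    calc _ = amp (single 2) (opJ n lam) * (amp (pair (1 : Fin 3) 0 (by decide)) (opQ n lam) *
          amp (pair (2 : Fin 3) 0 (by decide)) (opU n lam) *
          amp (pair (2 : Fin 3) 1 (by decide)) (opU n lam)) * amp (single 2) (opJ n lam) := by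
            simp only [mul_assoc, mul_asc (hJ 2), one_mul, mul_asc hc.eq]
      _ = _ := by
            rw [h]
            simp only [mul_assoc, hc.eq]
  · rw [opY_eq]
    exact regular_opQ n lam

/-- Cancelling a compact leg requires a nonzero Hilbert space. Phase space is not null, also for n =
0, where it still contains the line of the variable r, so some set of finite positive measure has a
nonzero indicator. -/
instance nontrivial_L2 : Nontrivial (L2 (Phase n) 1) := by
  have := isAddHaar_plane n
  have h1 : (volume : Measure (Phase n)).IsOpenPosMeasure :=
    Measure.prod.instIsOpenPosMeasure (μ := volume) (ν := volume)
  have h3 : SigmaFinite (volume : Measure (Fin 1 → Phase n)) := Measure.pi.sigmaFinite _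
  have h4 : (volume : Measure (Fin 1 → Phase n)).IsOpenPosMeasure := Measure.pi.isOpenPosMeasure _
  have h2 : (volume : Measure (Fin 1 → Phase n)) Set.univ ≠ 0 := isOpen_univ.measure_ne_zero _
    Set.univ_nonempty
  rw [← iUnion_spanningSets (volume : Measure (Fin 1 → Phase n))] at h2
  obtain ⟨k, hk⟩ : ∃ k, volume (spanningSets (volume : Measure (Fin 1 → Phase n)) k) ≠ 0 := by
    by_contra! h
    exact h2 (measure_iUnion_null h)
  have hf := measure_spanningSets_lt_top (volume : Measure (Fin 1 → Phase n)) k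
  refine nontrivial_of_ne
    (indicatorConstLp 2 (measurableSet_spanningSets volume k) hf.ne (1 : ℂ)) 0 fun h => ?_
  have h3 := congrArg norm h
  rw [norm_indicatorConstLp (by norm_num) (by norm_num), norm_zero, norm_one, one_mul] at h3
  exact (Real.rpow_pos_of_pos (ENNReal.toReal_pos hk hf.ne) _).ne' h3

end phase

section slices
variable {X : Type} [MeasureSpace X] [SigmaFinite (volume : Measure X)]
open OpSpace

/-! ### Slices by normal functionals -/

theorem norm_sliceL_le {a b : ℕ} (η ξ : L2 X a) (V : Op X (a + b)) :
    ‖sliceL a b η ξ V‖ ≤ ‖V‖ * (‖η‖ * ‖ξ‖) := by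
  refine ContinuousLinearMap.opNorm_le_bound _ (by positivity) fun ζ => ?_
  rw [sliceL_apply]
  have h1 : ‖ContinuousLinearMap.adjoint (tensorLeft η b)‖ ≤ ‖η‖ := by
    rw [LinearIsometryEquiv.norm_map]
    exact ContinuousLinearMap.opNorm_le_bound _ (norm_nonneg _) fun θ => by
      rw [tensorLeft_apply, norm_vecTensor]
  calc _ ≤ ‖ContinuousLinearMap.adjoint (tensorLeft η b)‖ * ‖V (vecTensor a b ξ ζ)‖ :=
        ContinuousLinearMap.le_opNorm _ _
    _ ≤ ‖η‖ * (‖V‖ * (‖ξ‖ * ‖ζ‖)) := by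
        rw [← norm_vecTensor]
        gcongr
        exact ContinuousLinearMap.le_opNorm _ _
    _ = _ := by ring

theorem inner_adjoint_tensorRight {a b : ℕ} (η ξ : L2 X a) (θ ζ : L2 X b) (V : Op X (a + b)) :
    ⟪η, ((ContinuousLinearMap.adjoint (tensorRight a θ)).comp
      (V.comp (tensorRight a ζ))) ξ⟫_ℂ = ⟪θ, sliceL a b η ξ V ζ⟫_ℂ := by
  rw [inner_sliceL, ContinuousLinearMap.comp_apply, ContinuousLinearMap.adjoint_inner_right,
    ContinuousLinearMap.comp_apply, tensorRight_apply, tensorRight_apply]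

/-- A normal functional is an absolutely convergent sum of vector functionals, so the slice is a
norm convergent sum of vector slices. -/
theorem leftSlices_subset_leftSpan {a b : ℕ} (V : Op X (a + b)) :
    leftSlices V ⊆ leftSpan a b V := by
  rintro S ⟨ω, ⟨ξ, η, hξ, hη, hω⟩, hS⟩
  have hs : Summable fun i => sliceL a b (η i) (ξ i) V := by
    refine Summable.of_norm_bounded ((hη.add hξ).mul_left ‖V‖) fun i => ?_
    refine (norm_sliceL_le _ _ _).trans ?_
    gcongr
    nlinarith [sq_nonneg (‖η i‖ - ‖ξ i‖), sq_nonneg ‖η i‖, sq_nonneg ‖ξ i‖]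
  have hS' : S = ∑' i, sliceL a b (η i) (ξ i) V := by
    ext1 ζ
    refine ext_inner_left ℂ fun θ => ?_
    have h1 := hs.hasSum.mapL (ContinuousLinearMap.apply ℂ (L2 X b) ζ)
    have h2 := h1.mapL (innerSL ℂ θ)
    have h3 := hω ((ContinuousLinearMap.adjoint (tensorRight a θ)).comp
      (V.comp (tensorRight a ζ)))
    simp only [inner_adjoint_tensorRight] at h3
    rw [hS]
    exact h3.unique h2
  rw [hS']
  exact (leftSpan a b V).isClosed.mem_of_tendsto hs.hasSum
    (Filter.Eventually.of_forall fun F => sum_mem fun i _ => mem_clSpan ⟨_, _, rfl⟩)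

theorem span_subset_leftSlices {a b : ℕ} (V : Op X (a + b)) :
    (Submodule.span ℂ {T | ∃ η ξ : L2 X a, T = sliceL a b η ξ V} : Set (Op X b)) ⊆
      leftSlices V := by
  intro S hS
  obtain ⟨N, c, g, rfl⟩ := Submodule.mem_span_set'.1 hS
  choose η ξ hg using fun i => (g i).2
  -- The finite family is padded with zeros to a sequence, the coefficients being put into the
  -- vectors `ξ'`.
  let η' : ℕ → L2 X a := fun i => if h : i < N then η ⟨i, h⟩ else 0
  let ξ' : ℕ → L2 X a := fun i => if h : i < N then c ⟨i, h⟩ • ξ ⟨i, h⟩ else 0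
  have hη0 : ∀ i ∉ Finset.range N, η' i = 0 := fun i hi => dif_neg (by simpa using hi)
  have hξ0 : ∀ i ∉ Finset.range N, ξ' i = 0 := fun i hi => dif_neg (by simpa using hi)
  let ω : Op X a →L[ℂ] ℂ := ∑ i ∈ Finset.range N,
    (innerSL ℂ (η' i)).comp (ContinuousLinearMap.apply ℂ (L2 X a) (ξ' i))
  have hω : ∀ T, ω T = ∑ i ∈ Finset.range N, ⟪η' i, T (ξ' i)⟫_ℂ := fun T => by
    simp [ω]
  refine ⟨ω, ⟨ξ', η', ?_, ?_, fun T => ?_⟩, fun ζ θ => ?_⟩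
  · exact summable_of_ne_finset_zero (s := Finset.range N) fun i hi => by simp [hξ0 i hi]
  · exact summable_of_ne_finset_zero (s := Finset.range N) fun i hi => by simp [hη0 i hi]
  · rw [hω]
    exact hasSum_sum_of_ne_finset_zero fun i hi => by simp [hξ0 i hi]
  · rw [hω, Finset.sum_range]
    simp only [inner_adjoint_tensorRight]
    rw [sum_apply, inner_sum]
    refine Finset.sum_congr rfl fun i _ => ?_
    have h1 : η' i = η i := dif_pos i.2
    have h2 : ξ' i = c i • ξ i := dif_pos i.2
    rw [h1, h2, smul_apply, hg, inner_smul_right, inner_sliceL, inner_sliceL, map_smul]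
    simp [inner_smul_right]

/-- The set of slices lies between the span of the vector slices and its closure, so it need not be
shown to be a subspace. -/
theorem closure_leftSlices {a b : ℕ} (V : Op X (a + b)) :
    closure (leftSlices V) = leftSpan a b V :=
  Set.Subset.antisymm
    (closure_minimal (leftSlices_subset_leftSpan V) (leftSpan a b V).isClosed)
    (closure_mono (span_subset_leftSlices V))

theorem clSpan_leftSlices {a b : ℕ} (V : Op X (a + b)) :
    clSpan (leftSlices V) = leftSpan a b V := by
  apply le_antisymm
  · exact clSpan_le.2 (leftSlices_subset_leftSpan V)
  · exact clSpan_mono (Submodule.subset_span.trans (span_subset_leftSlices V))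

theorem flipOp_vecTensor (ξ η : L2 X 1) : flipOp (vecTensor 1 1 ξ η) = vecTensor 1 1 η ξ := by
  ext1
  filter_upwards [flipOp_coeFn (vecTensor 1 1 ξ η), vecTensor_coeFn η ξ,
    measurePreserving_swap.quasiMeasurePreserving.ae (vecTensor_coeFn ξ η)] with p h1 h2 h3
  rw [h1, h2, h3, mul_comm]
  congr 2
  · funext i
    fin_cases i
    simp [split]
  · funext i
    fin_cases i
    simp [split]

theorem star_flipOp : star (flipOp (X := X)) = flipOp := by
  refine clm_ext_vecTensor (a := 1) (b := 1) fun ξ η => ?_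
  refine ext_inner_vecTensor (a := 1) (b := 1) fun ξ' η' => ?_
  rw [ContinuousLinearMap.star_eq_adjoint, ContinuousLinearMap.adjoint_inner_right,
    flipOp_vecTensor, flipOp_vecTensor, inner_vecTensor, inner_vecTensor, mul_comm]

theorem rightSlices_eq_leftSlices (V : Op X 2) :
    rightSlices (a := 1) (b := 1) V = leftSlices (a := 1) (b := 1) (flipOp * V * flipOp) := by
  have hf : ∀ v w : L2 X 2, ⟪v, flipOp w⟫_ℂ = ⟪flipOp v, w⟫_ℂ := fun v w => by
    rw [← ContinuousLinearMap.adjoint_inner_left, ← ContinuousLinearMap.star_eq_adjoint,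
      star_flipOp]
  have h : ∀ θ ζ : L2 X 1, (ContinuousLinearMap.adjoint (tensorLeft θ 1)).comp
      (ContinuousLinearMap.comp V (tensorLeft ζ 1)) =
      (ContinuousLinearMap.adjoint (tensorRight 1 θ)).comp
        (ContinuousLinearMap.comp (flipOp * V * flipOp) (tensorRight 1 ζ)) := by
    intro θ ζ
    ext1 ξ
    refine ext_inner_left ℂ fun η => ?_
    calc _ = ⟪vecTensor 1 1 θ η, V (vecTensor 1 1 ζ ξ)⟫_ℂ := by
          simp only [ContinuousLinearMap.comp_apply, ContinuousLinearMap.adjoint_inner_right,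
            tensorLeft_apply]
          exact congrArg (fun z => ⟪vecTensor 1 1 θ η, V z⟫_ℂ) (tensorLeft_apply ζ ξ)
      _ = ⟪flipOp (vecTensor 1 1 η θ), V (flipOp (vecTensor 1 1 ξ ζ))⟫_ℂ := by
          rw [flipOp_vecTensor, flipOp_vecTensor]
      _ = ⟪vecTensor 1 1 η θ, flipOp (V (flipOp (vecTensor 1 1 ξ ζ)))⟫_ℂ := (hf _ _).symm
      _ = _ := by
          simp only [ContinuousLinearMap.comp_apply, ContinuousLinearMap.adjoint_inner_right,
            tensorRight_apply, mul_apply_eq_comp]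
  simp only [rightSlices, leftSlices, h]

theorem star_slices_eq (V : Op X 2) : star (slices V) = slices (star V) := by
  have h : ∀ (η ξ : L2 X 1) (V : Op X 2),
      star (sliceL 1 1 η ξ V) = sliceL 1 1 ξ η (star V) := by
    intro η ξ V
    ext1 ζ
    refine ext_inner_left ℂ fun θ => ?_
    rw [inner_sliceL, ContinuousLinearMap.star_eq_adjoint, ContinuousLinearMap.star_eq_adjoint,
      ContinuousLinearMap.adjoint_inner_right, ContinuousLinearMap.adjoint_inner_right,
      ← inner_conj_symm, inner_sliceL, inner_conj_symm]
  rw [slices, slices, leftSpan, leftSpan, star_clSpan]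
  congr 1
  ext T
  constructor
  · rintro ⟨_, ⟨η, ξ, rfl⟩, rfl⟩
    exact ⟨ξ, η, h _ _ _⟩
  · rintro ⟨η, ξ, rfl⟩
    exact ⟨_, ⟨ξ, η, rfl⟩, h _ _ _⟩

/-! ### Commutants -/

/-- The space of operators commuting with `R`. -/
def commutant {m : ℕ} (R : Op X m) : OpSpace X m where
  carrier := {T | Commute T R}
  add_mem' := fun h1 h2 => h1.add_left h2
  zero_mem' := Commute.zero_left R
  smul_mem' := fun c _ h => h.smul_left c
  isClosed' := isClosed_eq (by fun_prop) (by fun_prop)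

theorem mem_commutant {m : ℕ} {R T : Op X m} : T ∈ commutant R ↔ Commute T R := Iff.rfl

open InnerProductSpace (rankOne) in
-- Leg 0 of `V` is sliced off, so `V` is placed on the legs 0 and `j + 1`, and `R` on 1 and 2.
-- Rank-one operators on leg 0 commute with `R` there, so the sandwich `|u⟩⟨u| ⊗ (slice)` commutes
-- with it as well. Slicing leg 0 leaves the commutation of the slice with `R`.
theorem leg_slices_le_commutant [Nontrivial (L2 X 1)] {V R : Op X 2} (j : Fin 2)
    (h : Commute (amp (pair (0 : Fin 3) j.succ (Fin.succ_ne_zero j).symm) V)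
      (amp (pair (1 : Fin 3) 2 (by decide)) R)) :
    leg (single j) (slices V) ≤ commutant R := by
  rw [slices, leftSpan, leg_clSpan, clSpan_le]
  rintro _ ⟨_, ⟨η, ξ, rfl⟩, rfl⟩
  obtain ⟨u, hu⟩ := exists_ne (0 : L2 X 1)
  have hV := congrArg (amp (pair (0 : Fin 3) j.succ (Fin.succ_ne_zero j).symm))
    (rankOne_mul_mul_rankOne (a := 1) (b := 1) u η ξ u V)
  rw [← amp_castAdd, ← amp_castAdd, opTensor_eq_amp, ← single_zero_two, ← single_one_two, map_mul,
    map_mul, map_mul, amp_single, amp_single, amp_single, pair_zero] at hV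
  replace hV := hV.trans (congrArg _ (amp_single (pair (0 : Fin 3) j.succ _) 1 _))
  rw [pair_one] at hV
  have hc : ∀ T : Op X 1, Commute (amp (single (0 : Fin 3)) T)
      (amp (pair (1 : Fin 3) 2 (by decide)) R) := fun T => amp_commute (by decide) _ _
  have h1 := ((hc (rankOne ℂ u η)).mul_left h).mul_left (hc (rankOne ℂ ξ u))
  rw [hV] at h1
  have hN : pair (1 : Fin 3) 2 (by decide) = Fin.natAddEmb 1 := by
    ext i
    fin_cases i <;> rfl
  have h0 : single (0 : Fin 3) = Fin.castAddEmb 2 := by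
    ext i
    fin_cases i
    rfl
  have hj : ∀ T : Op X 1, amp (single j.succ) T = amp (Fin.natAddEmb 1) (amp (single j) T) :=
    fun T => (amp_amp (fun _ => Fin.ext (Nat.add_comm 1 j)) T).symm
  have h2 : opTensor (a := 1) (b := 2) (rankOne ℂ u u)
        (amp (single j) (sliceL 1 1 η ξ V) * R) =
      opTensor (a := 1) (b := 2) (rankOne ℂ u u) (R * amp (single j) (sliceL 1 1 η ξ V)) := by
    rw [opTensor_eq_amp, opTensor_eq_amp, map_mul, map_mul, ← hj, ← h0, ← hN, ← mul_assoc, h1.eq,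
      ← mul_assoc, ← mul_assoc, (hc _).eq]
  have h3 := congrArg (sliceL 1 2 u u) h2
  rw [sliceL_opTensor, sliceL_opTensor, InnerProductSpace.rankOne_apply, inner_smul_right] at h3
  have h4 : (⟪u, u⟫_ℂ : ℂ) ≠ 0 := inner_self_ne_zero.2 hu
  exact smul_right_injective _ (mul_ne_zero h4 h4) h3

end slices

section implemented
variable {X : Type} [MeasureSpace X] [SigmaFinite (volume : Measure X)]
open OpSpace

/-! ### Homomorphisms implemented by unitaries -/

/-- `φ` is the homomorphism `c ↦ W (amp f c) W*`. -/
def IsAd {k l : ℕ} {C : NonUnitalStarSubalgebra ℂ (Op X k)} (φ : OpHom C l) (f : Fin k ↪ Fin l)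
    (W : Op X l) : Prop :=
  star W * W = 1 ∧ ∀ c : C, φ c = W * amp f (c : Op X k) * star W

/-- The homomorphism `c ↦ W (amp f c) W*`. -/
def adHom {k l : ℕ} (C : NonUnitalStarSubalgebra ℂ (Op X k)) (f : Fin k ↪ Fin l) (W : Op X l)
    (hW : star W * W = 1) : OpHom C l where
  toFun c := W * amp f (c : Op X k) * star W
  map_smul' r c := by
    rw [NonUnitalStarSubalgebra.coe_smul, map_smul, mul_smul_comm, smul_mul_assoc]
    rfl
  map_zero' := by simp
  map_add' c d := by
    rw [NonUnitalStarSubalgebra.coe_add, map_add, mul_add, add_mul]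
  map_mul' c d := by
    rw [NonUnitalStarSubalgebra.coe_mul, map_mul]
    simp only [mul_assoc, mul_asc hW, one_mul]
  map_star' c := by
    have h : ((star c : C) : Op X k) = star (c : Op X k) := rfl
    rw [h, map_star]
    simp only [star_mul, star_star, mul_assoc]

theorem isAd_adHom {k l : ℕ} (C : NonUnitalStarSubalgebra ℂ (Op X k)) (f : Fin k ↪ Fin l)
    {W : Op X l} (hW : star W * W = 1) : IsAd (adHom C f W hW) f W := ⟨hW, fun _ => rfl⟩

theorem isAd_incl {k : ℕ} (C : NonUnitalStarSubalgebra ℂ (Op X k)) :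
    IsAd (incl C) (Function.Embedding.refl _) 1 :=
  ⟨by simp, fun c => by
    rw [amp_id (fun _ => rfl), star_one, one_mul, mul_one]
    rfl⟩

theorem amp_opTensor {a b k l : ℕ} {f : Fin a ↪ Fin k} {g : Fin b ↪ Fin l}
    {h : Fin (a + b) ↪ Fin (k + l)} (h1 : ∀ i, h (Fin.castAdd b i) = Fin.castAdd l (f i))
    (h2 : ∀ i, h (Fin.natAdd a i) = Fin.natAdd k (g i)) (T : Op X a) (S : Op X b) :
    amp h (opTensor T S) = opTensor (amp f T) (amp g S) := by
  rw [opTensor_eq_amp, opTensor_eq_amp, map_mul, amp_amp (h := f.trans (Fin.castAddEmb l)) h1,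
    amp_amp (h := g.trans (Fin.natAddEmb k)) h2,
    amp_amp (h := f.trans (Fin.castAddEmb l)) (fun _ => rfl),
    amp_amp (h := g.trans (Fin.natAddEmb k)) (fun _ => rfl)]

theorem isTensorHom_of_isAd {a b k l : ℕ} {A : NonUnitalStarSubalgebra ℂ (Op X a)}
    {B : NonUnitalStarSubalgebra ℂ (Op X b)} {φ : OpHom A k} {ψ : OpHom B l}
    {Φ : OpHom (spatialTensor A B) (k + l)} {f : Fin a ↪ Fin k} {g : Fin b ↪ Fin l}
    {h : Fin (a + b) ↪ Fin (k + l)} {W : Op X k} {W' : Op X l} {W'' : Op X (k + l)}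
    (hφ : IsAd φ f W) (hψ : IsAd ψ g W') (hΦ : IsAd Φ h W'')
    (h1 : ∀ i, h (Fin.castAdd b i) = Fin.castAdd l (f i))
    (h2 : ∀ i, h (Fin.natAdd a i) = Fin.natAdd k (g i))
    (hW : W'' = amp (Fin.castAddEmb l) W * amp (Fin.natAddEmb k) W') : IsTensorHom φ ψ Φ := by
  intro S R
  rw [hΦ.2, hφ.2, hψ.2, hW, ← opTensor_eq_amp, star_opTensor, amp_opTensor h1 h2, opTensor_mul,
    opTensor_mul]

/-- The formula of `φ` makes sense for every bounded operator, and `star W * W = 1` gives the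
property that characterises the extension. -/
theorem IsAd.extendsTo {k l : ℕ} {C : NonUnitalStarSubalgebra ℂ (Op X k)} {φ : OpHom C l}
    {f : Fin k ↪ Fin l} {W : Op X l} (hφ : IsAd φ f W) {T : Op X k} (hT : IsMultiplier C T)
    {S : Op X l} (hS : S = W * amp f T * star W) : ExtendsTo φ T S := by
  refine ⟨hT, fun c => ?_⟩
  rw [hS, hφ.2, hφ.2, map_mul]
  simp only [mul_assoc, mul_asc hφ.1, one_mul]

theorem mul_star_mem_adLeg {k l : ℕ} {C : NonUnitalStarSubalgebra ℂ (Op X k)} (f : Fin k ↪ Fin l)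
    (W : Op X l) (c : C) : W * amp f (c : Op X k) * star W ∈ adLeg f W (ofAlg C) :=
  mem_adLeg f W (mem_clSpan c.2)

theorem star_adLeg {k l : ℕ} (f : Fin k ↪ Fin l) (W : Op X l) {E : OpSpace X k} (hE : star E = E) :
    star (adLeg f W E) = adLeg f W E := by
  rw [adLeg, star_mul, star_mul, star_leg, hE, star_pt, star_pt, star_star, mul_assoc]

theorem isMultiplier_ad {k l : ℕ} {C : NonUnitalStarSubalgebra ℂ (Op X k)}
    {D : NonUnitalStarSubalgebra ℂ (Op X l)} (hD : IsClosed (D : Set (Op X l)))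
    {f : Fin k ↪ Fin l} {W : Op X l} (h : adLeg f W (ofAlg C) * ofAlg D = ofAlg D) (c : C) :
    IsMultiplier D (W * amp f (c : Op X k) * star W) :=
  isMultiplier_of_mul_le hD (star_adLeg f W (star_ofAlg C)) h.le (mul_star_mem_adLeg f W c)

open InnerProductSpace (rankOne) in
-- Evaluating the elements of `C * K = K` at a vector `ξ` shows that `⟪ξ, ξ⟫ ξ` lies in the closed
-- span of the vectors `c η`.
theorem closure_span_apply_eq_univ {k : ℕ} {C : NonUnitalStarSubalgebra ℂ (Op X k)}
    (hK : ofAlg C * cpt k = cpt k) :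
    closure (Submodule.span ℂ {v : L2 X k | ∃ c ∈ C, ∃ ξ, v = c ξ} : Set (L2 X k)) =
      Set.univ := by
  let M : ClosedSubmodule ℂ (L2 X k) :=
    (Submodule.span ℂ {v : L2 X k | ∃ c ∈ C, ∃ ξ, v = c ξ}).closure
  rw [Set.eq_univ_iff_forall]
  intro ξ
  have h1 : ofAlg C * cpt k ≤ M.comap (ContinuousLinearMap.apply ℂ (L2 X k) ξ) := by
    rw [ofAlg, cpt, clSpan_mul_clSpan, clSpan_le]
    rintro _ ⟨c, hc, T, ⟨x, y, rfl⟩, rfl⟩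
    have h2 : c (rankOne ℂ x y ξ) ∈ M := subset_closure (Submodule.subset_span ⟨c, hc, _, rfl⟩)
    exact h2
  rw [hK] at h1
  have h2 : rankOne ℂ ξ ξ ξ ∈ M := h1 (rankOne_mem_cpt ξ ξ)
  rw [InnerProductSpace.rankOne_apply] at h2
  by_cases hξ : ξ = 0
  · rw [hξ]
    exact M.zero_mem
  · have h3 := M.smul_mem (⟪ξ, ξ⟫_ℂ)⁻¹ h2
    rw [smul_smul, inv_mul_cancel₀ (inner_self_ne_zero.2 hξ), one_smul] at h3
    exact h3

/-- The equality `hm` serves twice: it makes `δ c` a multiplier of `C ⊗ C` and it states that `δ` is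
nondegenerate. The embeddings `g₁`, `g₂` are the leg placements of `δ ⊗ id` and `id ⊗ δ`, so that
coassociativity becomes the equality `hco` of two conjugates of `c`. -/
theorem isCStarBialgebra_of_isAd {k : ℕ} {C : NonUnitalStarSubalgebra ℂ (Op X k)}
    (hC : IsClosed (C : Set (Op X k))) (hK : ofAlg C * cpt k = cpt k) {δ : OpHom C (k + k)}
    {f : Fin k ↪ Fin (k + k)} {W : Op X (k + k)} (hδ : IsAd δ f W)
    (hm : adLeg f W (ofAlg C) * ofAlg (spatialTensor C C) = ofAlg (spatialTensor C C))
    (g₁ : Fin (k + k) ↪ Fin (k + k + k)) (g₂ : Fin (k + k) ↪ Fin (k + (k + k)))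
    (hg₁ : ∀ i, g₁ (Fin.castAdd k i) = Fin.castAdd k (f i))
    (hg₁' : ∀ i, g₁ (Fin.natAdd k i) = Fin.natAdd (k + k) i)
    (hg₂ : ∀ i, g₂ (Fin.castAdd k i) = Fin.castAdd (k + k) i)
    (hg₂' : ∀ i, g₂ (Fin.natAdd k i) = Fin.natAdd k (f i))
    (hco : ∀ (h : k + k + k = k + (k + k)), ∀ c ∈ C,
      amp (Fin.natAddEmb k) W * amp g₂ (W * amp f c * star W) * star (amp (Fin.natAddEmb k) W) =
      opCast h (amp (Fin.castAddEmb k) W * amp g₁ (W * amp f c * star W) *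
        star (amp (Fin.castAddEmb k) W))) :
    IsCStarBialgebra C δ where
  isClosed := hC
  nondegenerate_action := closure_span_apply_eq_univ hK
  isMultiplier c := by
    rw [hδ.2]
    exact isMultiplier_ad (isClosed_spatialTensor C C) hm c
  nondegenerate := by
    have h1 : clSpan {T : Op X (k + k) | ∃ c : C, ∃ d ∈ spatialTensor C C, T = δ c * d} =
        ofAlg (spatialTensor C C) := by
      rw [← hm, adLeg, ofAlg, ofAlg, leg_clSpan, pt, pt, clSpan_mul_clSpan, clSpan_mul_clSpan,
        clSpan_mul_clSpan, Set.image2_singleton_left, Set.image2_singleton_right, Set.image_image,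
        Set.image_image, Set.image2_image_left]
      congr 1
      ext T
      constructor
      · rintro ⟨c, d, hd, rfl⟩
        exact ⟨c, c.2, d, hd, by rw [hδ.2]⟩
      · rintro ⟨c, hc, d, hd, rfl⟩
        exact ⟨⟨c, hc⟩, d, hd, by rw [hδ.2]⟩
    rw [← coe_clSpan, h1]
    ext T
    exact mem_ofAlg (isClosed_spatialTensor C C)
  coassoc := by
    have u₁ : star (amp (Fin.castAddEmb k) W) * amp (Fin.castAddEmb k) W = 1 := by
      rw [← map_star, ← map_mul, hδ.1, map_one]
    have u₂ : star (amp (Fin.natAddEmb k) W) * amp (Fin.natAddEmb k) W = 1 := by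
      rw [← map_star, ← map_mul, hδ.1, map_one]
    refine ⟨adHom _ g₁ _ u₁, adHom _ g₂ _ u₂,
      isTensorHom_of_isAd hδ (isAd_incl C) (isAd_adHom _ _ u₁) hg₁ hg₁' (by rw [map_one, mul_one]),
      isTensorHom_of_isAd (isAd_incl C) hδ (isAd_adHom _ _ u₂) hg₂ hg₂' (by rw [map_one, one_mul]),
      fun c => ⟨_, (isAd_adHom _ _ u₁).extendsTo ?_ rfl, (isAd_adHom _ _ u₂).extendsTo ?_ ?_⟩⟩
    · rw [hδ.2]
      exact isMultiplier_ad (isClosed_spatialTensor C C) hm c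
    · rw [hδ.2]
      exact isMultiplier_ad (isClosed_spatialTensor C C) hm c
    · rw [hδ.2]
      exact (hco _ c c.2).symm

variable (C D : NonUnitalStarSubalgebra ℂ (Op X 1))

/-- In this and the following lemmas every bracketing of a tensor product becomes the same product
of leg spaces, so spaces never have to be reassociated later. -/
theorem ofAlg_tensor_two : ofAlg (spatialTensor C D) =
    leg (single (0 : Fin 2)) (ofAlg C) * leg (single 1) (ofAlg D) := by
  rw [ofAlg_spatialTensor, single_zero_two, single_one_two]

theorem ofAlg_tensor_three (E : NonUnitalStarSubalgebra ℂ (Op X 1)) :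
    ofAlg (spatialTensor C (spatialTensor D E)) = leg (single (0 : Fin 3)) (ofAlg C) *
      leg (single 1) (ofAlg D) * leg (single 2) (ofAlg E) := by
  have h0 : Fin.castAddEmb 2 = single (0 : Fin 3) := by
    ext i
    fin_cases i
    rfl
  have h1 : leg (Fin.natAddEmb 1 : Fin 2 ↪ Fin 3) (leg (single (0 : Fin 2)) (ofAlg D)) =
    leg (single (1 : Fin 3)) (ofAlg D) := leg_single _ _ _
  have h2 : leg (Fin.natAddEmb 1 : Fin 2 ↪ Fin 3) (leg (single (1 : Fin 2)) (ofAlg E)) =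
    leg (single (2 : Fin 3)) (ofAlg E) := leg_single _ _ _
  rw [ofAlg_spatialTensor, ofAlg_tensor_two, leg_mul, mul_assoc, ← h1, ← h2, ← h0]

theorem ofAlg_tensor_three' (E : NonUnitalStarSubalgebra ℂ (Op X 1)) :
    ofAlg (spatialTensor (spatialTensor C D) E) = leg (single (0 : Fin 3)) (ofAlg C) *
      leg (single 1) (ofAlg D) * leg (single 2) (ofAlg E) := by
  have h0 : Fin.natAddEmb 2 = single (2 : Fin 3) := by
    ext i
    fin_cases i
    rfl
  have h1 : leg (Fin.castAddEmb 1 : Fin 2 ↪ Fin 3) (leg (single (0 : Fin 2)) (ofAlg C)) =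
    leg (single (0 : Fin 3)) (ofAlg C) := leg_single _ _ _
  have h2 : leg (Fin.castAddEmb 1 : Fin 2 ↪ Fin 3) (leg (single (1 : Fin 2)) (ofAlg D)) =
    leg (single (1 : Fin 3)) (ofAlg D) := leg_single _ _ _
  rw [ofAlg_spatialTensor, ofAlg_tensor_two, leg_mul, ← h1, ← h2, ← h0]

theorem ofAlg_tensor_four (E F : NonUnitalStarSubalgebra ℂ (Op X 1)) :
    ofAlg (spatialTensor (spatialTensor C D) (spatialTensor E F)) =
      leg (single (0 : Fin 4)) (ofAlg C) * leg (single 1) (ofAlg D) *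
        leg (single 2) (ofAlg E) * leg (single 3) (ofAlg F) := by
  have h0 : leg (Fin.castAddEmb 2 : Fin 2 ↪ Fin 4) (leg (single (0 : Fin 2)) (ofAlg C)) =
    leg (single (0 : Fin 4)) (ofAlg C) := leg_single _ _ _
  have h1 : leg (Fin.castAddEmb 2 : Fin 2 ↪ Fin 4) (leg (single (1 : Fin 2)) (ofAlg D)) =
    leg (single (1 : Fin 4)) (ofAlg D) := leg_single _ _ _
  have h2 : leg (Fin.natAddEmb 2 : Fin 2 ↪ Fin 4) (leg (single (0 : Fin 2)) (ofAlg E)) =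
    leg (single (2 : Fin 4)) (ofAlg E) := leg_single _ _ _
  have h3 : leg (Fin.natAddEmb 2 : Fin 2 ↪ Fin 4) (leg (single (1 : Fin 2)) (ofAlg F)) =
    leg (single (3 : Fin 4)) (ofAlg F) := leg_single _ _ _
  rw [ofAlg_spatialTensor, ofAlg_tensor_two, ofAlg_tensor_two, leg_mul, leg_mul, ← mul_assoc, ← h0,
    ← h1, ← h2, ← h3]

theorem ofAlg_tensor_four' (E F : NonUnitalStarSubalgebra ℂ (Op X 1)) :
    ofAlg (spatialTensor (spatialTensor C (spatialTensor D E)) F) =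
      leg (single (0 : Fin 4)) (ofAlg C) * leg (single 1) (ofAlg D) *
        leg (single 2) (ofAlg E) * leg (single 3) (ofAlg F) := by
  have h0 : leg (Fin.castAddEmb 1 : Fin 3 ↪ Fin 4) (leg (single (0 : Fin 3)) (ofAlg C)) =
    leg (single (0 : Fin 4)) (ofAlg C) := leg_single _ _ _
  have h1 : leg (Fin.castAddEmb 1 : Fin 3 ↪ Fin 4) (leg (single (1 : Fin 3)) (ofAlg D)) =
    leg (single (1 : Fin 4)) (ofAlg D) := leg_single _ _ _
  have h2 : leg (Fin.castAddEmb 1 : Fin 3 ↪ Fin 4) (leg (single (2 : Fin 3)) (ofAlg E)) =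
    leg (single (2 : Fin 4)) (ofAlg E) := leg_single _ _ _
  have h3 : Fin.natAddEmb 3 = single (3 : Fin 4) := by
    ext i
    fin_cases i
    rfl
  rw [ofAlg_spatialTensor, ofAlg_tensor_three, leg_mul, leg_mul, ← h0, ← h1, ← h2, ← h3]

end implemented

/-! ### Nondegeneracy and comultiplication of slices on arbitrary legs -/

section algebras
variable {X : Type} [MeasureSpace X] [SigmaFinite (volume : Measure X)] [Nontrivial (L2 X 1)]
open OpSpace

/-- With a further compact leg, `K ⊗ AK` is `(K ⊗ 1)V(K ⊗ K)`, and the unitary `V` is absorbed by `K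
⊗ K`. -/
theorem IsRegularMU.slices_mul_cpt {V : Op X 2} (hV : IsRegularMU V) :
    slices V * cpt 1 = cpt 1 := by
  have h : leg (single (0 : Fin 2)) (cpt 1) * leg (single 1) (slices V * cpt 1) =
      leg (single 0) (cpt 1) * leg (single 1) (cpt 1) := by
    have h1 := hV.amp_mul_cpt (i := (0 : Fin 2)) (j := 1) (by decide)
    have h2 := cpt_mul_amp_mul_cpt (i := (0 : Fin 2)) (j := 1) (by decide) V
    rw [leg_mul, ← mul_assoc, ← h2, mul_assoc, mul_assoc, h1, ← mul_assoc,
      leg_cpt_mul_leg_cpt_self]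
  exact le_antisymm (le_of_cpt_mul_le_two h.le) (le_of_cpt_mul_le_two h.ge)

theorem IsRegularMU.conj_mul_slices {V : Op X 2} (hV : IsRegularMU V) {m : ℕ} {i j : Fin m}
    (h : i ≠ j) : pt (amp (pair i j h) V) * leg (single i) (slices V) *
      pt (star (amp (pair i j h) V)) * (leg (single i) (slices V) * leg (single j) (slices V)) =
      leg (single i) (slices V) * leg (single j) (slices V) := by
  simpa [leg_mul, map_star] using congrArg (leg (pair i j h)) hV.comul_mul_slices

end algebras

/-! ### The algebras A and Âᵒᵖ, and Y as a multiplier of their tensor product -/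

section phase
variable (n : ℕ) (lam : ℝ)
open OpSpace

/-- The space of the elements of `A`. -/
abbrev spaceA : OpSpace (Phase n) 1 := slices (opU n lam)

/-- The space of the elements of `Âᵒᵖ`. -/
abbrev spaceB : OpSpace (Phase n) 1 := slices (opY n lam)

/-- `U` on the legs `i, j`. -/
abbrev legU {m : ℕ} (i j : Fin m) (h : i ≠ j) : Op (Phase n) m := amp (pair i j h) (opU n lam)

/-- `Y` on the legs `i, j`. -/
abbrev legY {m : ℕ} (i j : Fin m) (h : i ≠ j) : Op (Phase n) m := amp (pair i j h) (opY n lam)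

/-- `j` on the leg `i`. -/
abbrev legJ {m : ℕ} (i : Fin m) : Op (Phase n) m := amp (single i) (opJ n lam)

theorem clSpan_leftSlices_opU : clSpan (leftSlices (a := 1) (b := 1) (opU n lam)) = spaceA n lam :=
  clSpan_leftSlices (a := 1) (b := 1) _

/-- The closure of the slices is a closed subspace that regularity has shown to be self-adjoint and
closed under products, so generating a C*-algebra adds nothing. -/
theorem coe_algA : (algA n lam : Set (Op (Phase n) 1)) =
    closure (leftSlices (a := 1) (b := 1) (opU n lam)) := by
  have h := isRegularMU_opU n lam
  rw [algA, coe_cstarGenerated, closure_leftSlices, clSpan_leftSlices]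
  · rw [clSpan_leftSlices_opU, h.slices_mul_slices]
  · rw [clSpan_leftSlices_opU, h.star_slices]

theorem ofAlg_algA : ofAlg (algA n lam) = spaceA n lam := by
  rw [ofAlg, coe_algA, closure_leftSlices, clSpan_coe]
  rfl

theorem rightSlices_opX : rightSlices (a := 1) (b := 1) (opX n lam) =
    leftSlices (a := 1) (b := 1) (star (opY n lam)) := by
  rw [rightSlices_eq_leftSlices, flipOp_mul_mul_flipOp, opX_eq, opY_eq, map_star]

/-- The flip turns the right slices of X into left slices of Y*. Their closed span is the adjoint of
the space of slices of Y, which is self-adjoint. -/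
theorem clSpan_rightSlices_opX :
    clSpan (rightSlices (a := 1) (b := 1) (opX n lam)) = spaceB n lam := by
  rw [rightSlices_opX, clSpan_leftSlices]
  exact (star_slices_eq _).symm.trans (isRegularMU_opY n lam).star_slices

theorem coe_algHatOp : (algHatOp n lam : Set (Op (Phase n) 1)) =
    closure (rightSlices (a := 1) (b := 1) (opX n lam)) := by
  have h := isRegularMU_opY n lam
  rw [algHatOp, coe_cstarGenerated]
  · rw [rightSlices_opX, closure_leftSlices, clSpan_leftSlices]
  · rw [clSpan_rightSlices_opX, h.slices_mul_slices]
  · rw [clSpan_rightSlices_opX, h.star_slices]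

theorem ofAlg_algHatOp : ofAlg (algHatOp n lam) = spaceB n lam := by
  have h := isRegularMU_opY n lam
  rw [algHatOp, ofAlg_cstarGenerated, clSpan_rightSlices_opX]
  · rw [clSpan_rightSlices_opX, h.slices_mul_slices]
  · rw [clSpan_rightSlices_opX, h.star_slices]

theorem isClosed_algA : IsClosed (algA n lam : Set (Op (Phase n) 1)) := isClosed_cstarGenerated _

theorem isClosed_algHatOp : IsClosed (algHatOp n lam : Set (Op (Phase n) 1)) :=
  isClosed_cstarGenerated _

section legs
variable {m : ℕ} {i j k : Fin m}

theorem legJ_mul_legJ : legJ n lam i * legJ n lam i = 1 := by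
  rw [← map_mul, opJ_mul_opJ, map_one]

theorem star_legJ : star (legJ n lam i) = legJ n lam i := by
  rw [← map_star, star_opJ]

theorem legY_eq (h : i ≠ j) :
    legY n lam i j h = legJ n lam j * legU n lam j i h.symm * legJ n lam j := by
  simp [legY, opY_eq, opQ]

theorem legY_eq_legQ (h : i ≠ j) : legY n lam i j h = amp (pair j i h.symm) (opQ n lam) := by
  simp [legY, opY_eq]

theorem commute_legJ_legU (hjk : j ≠ k) (h1 : i ≠ j) (h2 : i ≠ k) :
    Commute (legJ n lam i) (legU n lam j k hjk) :=
  amp_commute (fun _ b => by fin_cases b <;> assumption) _ _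

/-- This is the pentagon of U on the legs k, i, j conjugated by j on leg k, which turns U_ki and
U_kj into Y_ik and Y_jk and does not affect U_ij. -/
theorem legU_mul_legY (hij : i ≠ j) (hik : i ≠ k) (hjk : j ≠ k) :
    legU n lam i j hij * legY n lam i k hik =
      legY n lam i k hik * legY n lam j k hjk * legU n lam i j hij := by
  have h := (isRegularMU_opU n lam).pentagon_amp hik.symm hjk.symm hij
  have hc := (commute_legJ_legU n lam hij hik.symm hjk.symm).eq
  have hJ := legJ_mul_legJ n lam (i := k)
  rw [legY_eq, legY_eq]
  calc _ = legJ n lam k * (legU n lam i j hij * legU n lam k i hik.symm) * legJ n lam k := by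
        simp only [mul_assoc, mul_asc hc]
    _ = legJ n lam k * legU n lam k i hik.symm * legU n lam k j hjk.symm *
          (legJ n lam k * legU n lam i j hij) := by
        rw [← h, hc]
        simp only [mul_assoc]
    _ = _ := by simp only [mul_assoc, mul_asc hJ, one_mul]

/-- As Y is U with exchanged legs, conjugated by j on leg 1, and the compacts on that leg absorb j,
the right slices of Y are the left slices of U. -/
theorem cpt_mul_legY_mul_cpt : leg (single (1 : Fin 2)) (cpt 1) * pt (opY n lam) *
    leg (single 1) (cpt 1) = leg (single 1) (cpt 1) * leg (single 0) (spaceA n lam) := by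
  have hJ := opJ_mul_opJ n lam
  have h1 : leg (single (1 : Fin 2)) (cpt 1) * pt (legJ n lam 1) = leg (single 1) (cpt 1) := by
    rw [← leg_pt, ← leg_mul, cpt_mul_pt hJ]
  have h2 : pt (legJ n lam 1) * leg (single (1 : Fin 2)) (cpt 1) = leg (single 1) (cpt 1) := by
    rw [← leg_pt, ← leg_mul, pt_mul_cpt hJ]
  have hY : opY n lam = legJ n lam 1 * legU n lam 1 0 (by decide) * legJ n lam 1 := by
    rw [← legY_eq n lam (by decide : (0 : Fin 2) ≠ 1)]
    exact (amp_id (fun a => by fin_cases a <;> rfl) _).symm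
  rw [hY, ← pt_mul, ← pt_mul, mul_assoc, mul_assoc, h2, ← mul_assoc, ← mul_assoc, h1]
  exact cpt_mul_amp_mul_cpt (by decide) _

theorem pt_opY_mul : pt (opY n lam) *
    (leg (single (0 : Fin 2)) (spaceA n lam) * leg (single 1) (cpt 1)) =
      leg (single 0) (spaceA n lam) * leg (single 1) (cpt 1) := by
  have hJ := opJ_mul_opJ n lam
  have h2 : pt (legJ n lam 1) * leg (single (1 : Fin 2)) (cpt 1) = leg (single 1) (cpt 1) := by
    rw [← leg_pt, ← leg_mul, pt_mul_cpt hJ]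
  have hY : opY n lam = legJ n lam 1 * legU n lam 1 0 (by decide) * legJ n lam 1 := by
    rw [← legY_eq n lam (by decide : (0 : Fin 2) ≠ 1)]
    exact (amp_id (fun a => by fin_cases a <;> rfl) _).symm
  have h3 := (isRegularMU_opU n lam).amp_mul_cpt_slices (i := (1 : Fin 2)) (j := 0) (by decide)
  rw [single_commute_single (by decide), hY, ← pt_mul, ← pt_mul, mul_assoc, mul_assoc,
    mul_asc h2, h3, mul_asc h2]

/-- Y is a regular multiplicative unitary with right slices A and left slices Âᵒᵖ, so the general
fact that such a unitary multiplies the tensor product of its two slice algebras applies. -/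
theorem star_legY_mul (h : i ≠ j) : pt (star (legY n lam i j h)) *
    (leg (single i) (spaceA n lam) * leg (single j) (spaceB n lam)) =
      leg (single i) (spaceA n lam) * leg (single j) (spaceB n lam) := by
  have h1 := (isRegularMU_opY n lam).star_pt_mul_slices_slices
    (isRegularMU_opU n lam).star_slices (isRegularMU_opU n lam).slices_mul_slices
    (cpt_mul_legY_mul_cpt n lam) (pt_opY_mul n lam)
  simpa [leg_mul, map_star] using congrArg (leg (pair i j h)) h1

theorem legY_mul (h : i ≠ j) : pt (legY n lam i j h) *
    (leg (single i) (spaceA n lam) * leg (single j) (spaceB n lam)) =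
      leg (single i) (spaceA n lam) * leg (single j) (spaceB n lam) := by
  conv_lhs => rw [← star_legY_mul n lam h]
  rw [← mul_assoc, pt_mul_pt_star ((isRegularMU_opY n lam).amp_mul_star h), one_mul]

end legs

theorem opTensor_opJ : opTensor (opJ n lam) (opJ n lam) =
    legJ n lam (0 : Fin 2) * legJ n lam 1 := by
  rw [opTensor_eq_amp, ← single_zero_two, ← single_one_two]

/-- In `(j ⊗ j) Y (j ⊗ j)` the copies of j on leg 1 cancel against those contained in Y. -/
theorem opZ_eq : opZ n lam = star (opY n lam) * amp (pair 1 0 (by decide)) (opR n lam) := by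
  have hJ := legJ_mul_legJ n lam (i := (1 : Fin 2))
  have hJ0 : Commute (legJ n lam (0 : Fin 2)) (legJ n lam 1) := amp_commute (by decide) _ _
  have hY : opY n lam = legJ n lam 1 * legU n lam 1 0 (by decide) * legJ n lam 1 := by
    rw [← legY_eq n lam (by decide : (0 : Fin 2) ≠ 1)]
    exact (amp_id (fun a => by fin_cases a <;> rfl) _).symm
  have hR : amp (pair (1 : Fin 2) 0 (by decide)) (opR n lam) =
      legJ n lam 0 * legU n lam 1 0 (by decide) * legJ n lam 0 := by
    simp [opR]
  rw [opZ, opTensor_opJ, hR, hY]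
  congr 1
  simp only [mul_assoc]
  rw [hJ0.eq, mul_asc hJ, mul_asc hJ, one_mul, one_mul]

/-- On leg 0 the second factor of Z lies in the conjugate of A by j, which commutes with A. On leg 1
it is the first leg of U, whose slices commute with their conjugates by j, hence with the slices of
Y. So this factor does not contribute to conjugation by Z. -/
theorem commute_opR {p : Op (Phase n) 2} (hp : p ∈ leg (single (0 : Fin 2)) (spaceA n lam) *
    leg (single 1) (spaceB n lam)) : Commute p (amp (pair 1 0 (by decide)) (opR n lam)) := by
  have h1 : leg (single (0 : Fin 2)) (spaceA n lam) ≤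
      commutant (amp (pair 1 0 (by decide)) (opR n lam)) := by
    refine leg_slices_le_commutant 0 ?_
    have h := congrArg (amp (triple (1 : Fin 3) 2 0 (by decide) (by decide) (by decide)))
      (opU_mul_opR_comm n lam)
    simp only [map_mul, amp_pair, triple_zero, triple_one, triple_two] at h
    rw [amp_pair]
    exact h
  have h2 : leg (single (1 : Fin 2)) (spaceB n lam) ≤
      commutant (amp (pair 1 0 (by decide)) (opR n lam)) := by
    refine leg_slices_le_commutant 1 ?_
    have h := congrArg (amp (triple (1 : Fin 3) 2 0 (by decide) (by decide) (by decide)))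
      (opU_mul_opQ_comm n lam)
    simp only [map_mul, amp_pair, triple_zero, triple_one, triple_two] at h
    rw [← legY_eq_legQ n lam (by decide : (1 : Fin 3) ≠ 2), legY_eq] at h
    have hY := legY_eq n lam (by decide : (0 : Fin 3) ≠ 2)
    have hR : amp (pair (2 : Fin 3) 1 (by decide)) (opR n lam) =
        legJ n lam 1 * legU n lam 2 1 (by decide) * legJ n lam 1 := by
      simp [opR]
    have J1 := legJ_mul_legJ n lam (i := (1 : Fin 3))
    have J2 := legJ_mul_legJ n lam (i := (2 : Fin 3))
    have J12 : Commute (legJ n lam (1 : Fin 3)) (legJ n lam 2) := amp_commute (by decide) _ _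
    have c1 := commute_legJ_legU n lam (i := (1 : Fin 3)) (j := 2) (k := 0)
      (by decide) (by decide) (by decide)
    -- Conjugation of the relation `h` by j on leg 2 moves j from one operator to the other.
    have key : Commute (legJ n lam (2 : Fin 3) * legU n lam 2 0 (by decide) * legJ n lam 2)
        (legU n lam 2 1 (by decide)) := by
      have h' := congrArg (fun T => legJ n lam (2 : Fin 3) * T * legJ n lam 2) h
      simp only [mul_assoc, mul_asc J2, J2, mul_one, one_mul] at h'
      rw [Commute, SemiconjBy]
      simp only [mul_assoc]
      exact h'
    have hc : Commute (legJ n lam (2 : Fin 3) * legU n lam 2 0 (by decide) * legJ n lam 2)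
        (legJ n lam 1) := ((J12.symm.mul_left c1.symm).mul_left J12.symm)
    rw [amp_pair]
    change Commute (legY n lam (0 : Fin 3) 2 (by decide))
      (amp (pair (2 : Fin 3) 1 (by decide)) (opR n lam))
    rw [hY, hR]
    exact (hc.mul_right key).mul_right hc
  have h3 : leg (single (0 : Fin 2)) (spaceA n lam) * leg (single 1) (spaceB n lam) ≤
      commutant (amp (pair 1 0 (by decide)) (opR n lam)) :=
    mul_le.2 fun x hx y hy => (mem_commutant.1 (h1 hx)).mul_left (h2 hy)
  exact h3 hp

end phase

/-! ### Absorption rules for conjugated leg spaces -/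

section legs
variable {X : Type} [MeasureSpace X] [SigmaFinite (volume : Measure X)]
open OpSpace

theorem single_left_comm {m : ℕ} {i j : Fin m} (h : i ≠ j) (E F : OpSpace X 1) (G : OpSpace X m) :
    leg (single i) E * (leg (single j) F * G) = leg (single j) F * (leg (single i) E * G) := by
  rw [← mul_assoc, single_commute_single h, mul_assoc]

theorem adLeg_pair {m : ℕ} {i j : Fin m} (h : i ≠ j) (W : Op X m)
    (C D : NonUnitalStarSubalgebra ℂ (Op X 1)) :
    adLeg (pair i j h) W (ofAlg (spatialTensor C D)) =
      pt W * (leg (single i) (ofAlg C) * leg (single j) (ofAlg D)) * pt (star W) := by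
  rw [adLeg, ofAlg_tensor_two, leg_mul, leg_single, leg_single, pair_zero, pair_one]

theorem mul_eq_of_eq_mul {M : Type*} [Semigroup M] {x E R T : M} (hT : T = E * R)
    (h : x * E = E) : x * T = T := by
  rw [hT, ← mul_assoc, h]

/-- The commutation hypotheses split the conjugate of `P * Q` into `(u P u')(v Q v')`, whose factors
are absorbed one after the other. -/
theorem conj_mul_eq {M : Type*} [Monoid M] {u u' v v' P Q T : M} (h₁ : Commute v P)
    (h₂ : Commute v u') (h₃ : Commute Q u') (h₄ : Commute v' u') (hu : u * P * u' * T = T)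
    (hv : v * Q * v' * T = T) : u * v * (P * Q) * (v' * u') * T = T := by
  calc _ = u * (v * P) * (Q * (v' * u')) * T := by simp only [mul_assoc]
    _ = u * P * (v * Q * v' * u') * T := by rw [h₁.eq]; simp only [mul_assoc]
    _ = u * P * (u' * (v * Q * v')) * T := by rw [((h₂.mul_left h₃).mul_left h₄).eq]
    _ = u * P * u' * (v * Q * v' * T) := by simp only [mul_assoc]
    _ = T := by rw [hv, hu]

theorem conj_mul_eq' {M : Type*} [Monoid M] {s s' w w' L T : M} (hs : s * T = T) (hs' : s' * T = T)
    (hw : w * L * w' * T = T) : s * w * L * (w' * s') * T = T := by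
  calc _ = s * (w * L * w' * (s' * T)) := by simp only [mul_assoc]
    _ = T := by rw [hs', hw, hs]

end legs

/-! ### Multiplier and nondegeneracy identities for the comultiplications and their composites with
τ -/

section phase
variable (n : ℕ) (lam : ℝ)
open OpSpace

theorem slicesA_mul {m : ℕ} (i : Fin m) : leg (single i) (spaceA n lam) *
    leg (single i) (spaceA n lam) = leg (single i) (spaceA n lam) := by
  rw [← leg_mul, (isRegularMU_opU n lam).slices_mul_slices]

theorem slicesB_mul {m : ℕ} (i : Fin m) : leg (single i) (spaceB n lam) *
    leg (single i) (spaceB n lam) = leg (single i) (spaceB n lam) := by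
  rw [← leg_mul, (isRegularMU_opY n lam).slices_mul_slices]

theorem commute_single_star {m : ℕ} {i j k : Fin m} (hjk : j ≠ k) (h1 : i ≠ j) (h2 : i ≠ k)
    (E : OpSpace (Phase n) 1) (T : Op (Phase n) 2) :
    Commute (leg (single i) E) (pt (star (amp (pair j k hjk) T))) :=
  single_commute_pair_star hjk h1 h2 E T

theorem commute_single_pair {m : ℕ} {i j k : Fin m} (hjk : j ≠ k) (h1 : i ≠ j) (h2 : i ≠ k)
    (E : OpSpace (Phase n) 1) (T : Op (Phase n) 2) :
    Commute (leg (single i) E) (pt (amp (pair j k hjk) T)) :=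
  single_commute_pair hjk h1 h2 E T

theorem commute_pair_pair {m : ℕ} {i j k l : Fin m} (hij : i ≠ j) (hkl : k ≠ l) (h1 : i ≠ k)
    (h2 : i ≠ l) (h3 : j ≠ k) (h4 : j ≠ l) (T S : Op (Phase n) 2) :
    Commute (amp (pair i j hij) T) (amp (pair k l hkl) S) :=
  amp_commute (fun a b => by fin_cases a <;> fin_cases b <;> assumption) _ _

/-- In leg notation the co-opposite comultiplications are a ↦ U₁₀(1 ⊗ a)U₁₀* and b ↦ Y₀₁(b ⊗ 1)Y₀₁*.
This identity and the next are thus the slice identities for U and Y. -/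
theorem adLeg_comulA : adLeg (single (1 : Fin 2)) (legU n lam 1 0 (by decide)) (ofAlg (algA n lam)) *
    ofAlg (spatialTensor (algA n lam) (algA n lam)) =
      ofAlg (spatialTensor (algA n lam) (algA n lam)) := by
  rw [adLeg, ofAlg_tensor_two, ofAlg_algA]
  refine mul_eq_of_eq_mul (R := 1) ?_
    ((isRegularMU_opU n lam).conj_mul_slices (by decide : (1 : Fin 2) ≠ 0))
  rw [mul_one, single_commute_single (by decide)]

theorem adLeg_comulB : adLeg (single (0 : Fin 2)) (legY n lam 0 1 (by decide))
    (ofAlg (algHatOp n lam)) * ofAlg (spatialTensor (algHatOp n lam) (algHatOp n lam)) =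
      ofAlg (spatialTensor (algHatOp n lam) (algHatOp n lam)) := by
  rw [adLeg, ofAlg_tensor_two, ofAlg_algHatOp]
  exact (isRegularMU_opY n lam).conj_mul_slices (by decide : (0 : Fin 2) ≠ 1)

/-- The image of Δ^cop ⊗ id. The unitary involves only the legs of Δ^cop, and the leg of Âᵒᵖ is
absorbed because Âᵒᵖ is idempotent as a space. -/
theorem adLeg_comulA_id : adLeg (pair (1 : Fin 3) 2 (by decide)) (legU n lam 1 0 (by decide))
    (ofAlg (spatialTensor (algA n lam) (algHatOp n lam))) *
      ofAlg (spatialTensor (algA n lam) (spatialTensor (algA n lam) (algHatOp n lam))) =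
      ofAlg (spatialTensor (algA n lam) (spatialTensor (algA n lam) (algHatOp n lam))) := by
  rw [adLeg_pair, ofAlg_tensor_three, ofAlg_algA, ofAlg_algHatOp]
  have h := conj_mul_eq (u := pt (legU n lam (1 : Fin 3) 0 (by decide)))
    (u' := pt (star (legU n lam (1 : Fin 3) 0 (by decide)))) (v := 1) (v' := 1)
    (P := leg (single (1 : Fin 3)) (spaceA n lam)) (Q := leg (single (2 : Fin 3)) (spaceB n lam))
    (T := leg (single (0 : Fin 3)) (spaceA n lam) * leg (single 1) (spaceA n lam) *
      leg (single 2) (spaceB n lam)) (Commute.one_left _) (Commute.one_left _)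
    (commute_single_star n (by decide) (by decide) (by decide) _ _) (Commute.one_left _)
    (mul_eq_of_eq_mul (R := leg (single 2) (spaceB n lam)) (by
      simp [mul_assoc, single_commute_single])
      ((isRegularMU_opU n lam).conj_mul_slices (by decide)))
    (mul_eq_of_eq_mul (E := leg (single 2) (spaceB n lam))
      (R := leg (single 0) (spaceA n lam) * leg (single 1) (spaceA n lam))
      (by simp [mul_assoc, single_commute_single, single_left_comm])
      (by rw [one_mul, mul_one, slicesB_mul]))
  simpa only [mul_one, one_mul] using h

/-- The unitary of `(id ⊗ τ)(Δ^cop ⊗ id)`: the flip in τ exchanges the legs 1 and 2, turning U₁₀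
into U₂₀, and Y₂₁* follows. The latter is absorbed since Y multiplies A ⊗ Âᵒᵖ. -/
theorem adLeg_tau_comulA : adLeg (pair (2 : Fin 3) 1 (by decide))
    (star (legY n lam 2 1 (by decide)) * legU n lam 2 0 (by decide))
    (ofAlg (spatialTensor (algA n lam) (algHatOp n lam))) *
      ofAlg (spatialTensor (spatialTensor (algA n lam) (algHatOp n lam)) (algA n lam)) =
      ofAlg (spatialTensor (spatialTensor (algA n lam) (algHatOp n lam)) (algA n lam)) := by
  rw [adLeg_pair, ofAlg_tensor_three', ofAlg_algA, ofAlg_algHatOp, star_mul, star_star, ← pt_mul,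
    ← pt_mul]
  refine conj_mul_eq' (mul_eq_of_eq_mul (R := leg (single 0) (spaceA n lam)) (by
      simp [mul_assoc, single_commute_single, single_left_comm]) (star_legY_mul n lam _))
    (mul_eq_of_eq_mul (R := leg (single 0) (spaceA n lam)) (by
      simp [mul_assoc, single_commute_single, single_left_comm]) (legY_mul n lam _)) ?_
  have h := conj_mul_eq (u := pt (legU n lam (2 : Fin 3) 0 (by decide)))
    (u' := pt (star (legU n lam (2 : Fin 3) 0 (by decide)))) (v := 1) (v' := 1)
    (P := leg (single (2 : Fin 3)) (spaceA n lam)) (Q := leg (single (1 : Fin 3)) (spaceB n lam))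
    (T := leg (single (0 : Fin 3)) (spaceA n lam) * leg (single 1) (spaceB n lam) *
      leg (single 2) (spaceA n lam)) (Commute.one_left _) (Commute.one_left _)
    (commute_single_star n (by decide) (by decide) (by decide) _ _) (Commute.one_left _)
    (mul_eq_of_eq_mul (R := leg (single 1) (spaceB n lam)) (by
      simp [mul_assoc, single_commute_single])
      ((isRegularMU_opU n lam).conj_mul_slices (by decide)))
    (mul_eq_of_eq_mul (E := leg (single 1) (spaceB n lam))
      (R := leg (single 0) (spaceA n lam) * leg (single 2) (spaceA n lam))
      (by simp [mul_assoc, single_left_comm])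
      (by rw [one_mul, mul_one, slicesB_mul]))
  simpa only [mul_one, one_mul] using h

theorem adLeg_id_comulB : adLeg (pair (0 : Fin 3) 1 (by decide)) (legY n lam 1 2 (by decide))
    (ofAlg (spatialTensor (algA n lam) (algHatOp n lam))) *
      ofAlg (spatialTensor (spatialTensor (algA n lam) (algHatOp n lam)) (algHatOp n lam)) =
      ofAlg (spatialTensor (spatialTensor (algA n lam) (algHatOp n lam)) (algHatOp n lam)) := by
  rw [adLeg_pair, ofAlg_tensor_three', ofAlg_algA, ofAlg_algHatOp]
  have h := conj_mul_eq (v := pt (legY n lam (1 : Fin 3) 2 (by decide)))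
    (v' := pt (star (legY n lam (1 : Fin 3) 2 (by decide)))) (u := 1) (u' := 1)
    (P := leg (single (0 : Fin 3)) (spaceA n lam)) (Q := leg (single (1 : Fin 3)) (spaceB n lam))
    (T := leg (single (0 : Fin 3)) (spaceA n lam) * leg (single 1) (spaceB n lam) *
      leg (single 2) (spaceB n lam))
    (commute_single_pair n (by decide) (by decide) (by decide) _ _).symm (Commute.one_right _)
    (Commute.one_right _) (Commute.one_right _)
    (mul_eq_of_eq_mul (E := leg (single 0) (spaceA n lam))
      (R := leg (single 1) (spaceB n lam) * leg (single 2) (spaceB n lam))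
      (mul_assoc _ _ _) (by rw [one_mul, mul_one, slicesA_mul]))
    (mul_eq_of_eq_mul (R := leg (single 0) (spaceA n lam)) (by
      simp [mul_assoc, single_commute_single, single_left_comm])
      ((isRegularMU_opY n lam).conj_mul_slices (by decide)))
  simpa only [mul_one, one_mul] using h

/-- The unitary of `(τ ⊗ id)(id ⊗ Δ̂^cop)`: here the flip exchanges the legs 0 and 1, turning Y₁₂
into Y₀₂, and Y₁₀* follows. -/
theorem adLeg_tau_comulB : adLeg (pair (1 : Fin 3) 0 (by decide))
    (star (legY n lam 1 0 (by decide)) * legY n lam 0 2 (by decide))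
    (ofAlg (spatialTensor (algA n lam) (algHatOp n lam))) *
      ofAlg (spatialTensor (algHatOp n lam) (spatialTensor (algA n lam) (algHatOp n lam))) =
      ofAlg (spatialTensor (algHatOp n lam) (spatialTensor (algA n lam) (algHatOp n lam))) := by
  rw [adLeg_pair, ofAlg_tensor_three, ofAlg_algA, ofAlg_algHatOp, star_mul, star_star, ← pt_mul,
    ← pt_mul]
  refine conj_mul_eq' (mul_eq_of_eq_mul (R := leg (single 2) (spaceB n lam)) (by
      simp [mul_assoc, single_commute_single]) (star_legY_mul n lam _))
    (mul_eq_of_eq_mul (R := leg (single 2) (spaceB n lam)) (by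
      simp [mul_assoc, single_commute_single]) (legY_mul n lam _)) ?_
  have h := conj_mul_eq (v := pt (legY n lam (0 : Fin 3) 2 (by decide)))
    (v' := pt (star (legY n lam (0 : Fin 3) 2 (by decide)))) (u := 1) (u' := 1)
    (P := leg (single (1 : Fin 3)) (spaceA n lam)) (Q := leg (single (0 : Fin 3)) (spaceB n lam))
    (T := leg (single (0 : Fin 3)) (spaceB n lam) * leg (single 1) (spaceA n lam) *
      leg (single 2) (spaceB n lam))
    (commute_single_pair n (by decide) (by decide) (by decide) _ _).symm (Commute.one_right _)
    (Commute.one_right _) (Commute.one_right _)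
    (mul_eq_of_eq_mul (E := leg (single 1) (spaceA n lam))
      (R := leg (single 0) (spaceB n lam) * leg (single 2) (spaceB n lam))
      (by simp [mul_assoc, single_left_comm])
      (by rw [one_mul, mul_one, slicesA_mul]))
    (mul_eq_of_eq_mul (R := leg (single 1) (spaceA n lam)) (by
      simp [mul_assoc, single_commute_single])
      ((isRegularMU_opY n lam).conj_mul_slices (by decide)))
  simpa only [mul_one, one_mul] using h

theorem adLeg_comulA_comulB : adLeg (pair (1 : Fin 4) 2 (by decide))
    (legU n lam 1 0 (by decide) * legY n lam 2 3 (by decide))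
    (ofAlg (spatialTensor (algA n lam) (algHatOp n lam))) *
      ofAlg (spatialTensor (spatialTensor (algA n lam) (spatialTensor (algA n lam) (algHatOp n lam)))
        (algHatOp n lam)) =
      ofAlg (spatialTensor (spatialTensor (algA n lam) (spatialTensor (algA n lam) (algHatOp n lam)))
        (algHatOp n lam)) := by
  rw [adLeg_pair, ofAlg_tensor_four', ofAlg_algA, ofAlg_algHatOp, star_mul, ← pt_mul, ← pt_mul]
  have h1 : Commute (pt (legY n lam (2 : Fin 4) 3 (by decide)))
      (pt (star (legU n lam (1 : Fin 4) 0 (by decide)))) := by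
    rw [← map_star]
    exact pt_commute (commute_pair_pair n _ _ (by decide) (by decide) (by decide) (by decide) _ _)
  have h2 : Commute (pt (star (legY n lam (2 : Fin 4) 3 (by decide))))
      (pt (star (legU n lam (1 : Fin 4) 0 (by decide)))) := by
    rw [← map_star, ← map_star]
    exact pt_commute (commute_pair_pair n _ _ (by decide) (by decide) (by decide) (by decide) _ _)
  refine conj_mul_eq (commute_single_pair n (by decide) (by decide) (by decide) _ _).symm h1
    (commute_single_star n (by decide) (by decide) (by decide) _ _) h2
    (mul_eq_of_eq_mul (R := leg (single 2) (spaceB n lam) * leg (single 3) (spaceB n lam)) ?_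
      ((isRegularMU_opU n lam).conj_mul_slices (by decide)))
    (mul_eq_of_eq_mul (R := leg (single 0) (spaceA n lam) * leg (single 1) (spaceA n lam)) ?_
      ((isRegularMU_opY n lam).conj_mul_slices (by decide)))
  · unfold spaceA spaceB
    generalize slices (opU n lam) = E, slices (opY n lam) = F
    simp [mul_assoc, single_commute_single]
  · unfold spaceA spaceB
    generalize slices (opU n lam) = E, slices (opY n lam) = F
    simp [mul_assoc, single_commute_single, single_left_comm]

/-- For δ_τ the flip exchanges the middle legs of U₁₀Y₂₃, which gives U₂₀Y₁₃, and Y₂₁* comes from τ.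
-/
theorem adLeg_comul_tau : adLeg (pair (2 : Fin 4) 1 (by decide))
    (star (legY n lam 2 1 (by decide)) * (legU n lam 2 0 (by decide) * legY n lam 1 3 (by decide)))
    (ofAlg (spatialTensor (algA n lam) (algHatOp n lam))) *
      ofAlg (spatialTensor (spatialTensor (algA n lam) (algHatOp n lam))
        (spatialTensor (algA n lam) (algHatOp n lam))) =
      ofAlg (spatialTensor (spatialTensor (algA n lam) (algHatOp n lam))
        (spatialTensor (algA n lam) (algHatOp n lam))) := by
  rw [adLeg_pair, ofAlg_tensor_four, ofAlg_algA, ofAlg_algHatOp, star_mul, star_star,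
    ← pt_mul (star _) (_ * _), ← pt_mul (star (_ * _)) _]
  refine conj_mul_eq' (mul_eq_of_eq_mul
      (R := leg (single 0) (spaceA n lam) * leg (single 3) (spaceB n lam)) (by
      simp [mul_assoc, single_commute_single, single_left_comm]) (star_legY_mul n lam _))
    (mul_eq_of_eq_mul (R := leg (single 0) (spaceA n lam) * leg (single 3) (spaceB n lam)) (by
      simp [mul_assoc, single_commute_single, single_left_comm]) (legY_mul n lam _)) ?_
  rw [star_mul, ← pt_mul, ← pt_mul]
  have h1 : Commute (pt (legY n lam (1 : Fin 4) 3 (by decide)))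
      (pt (star (legU n lam (2 : Fin 4) 0 (by decide)))) := by
    rw [← map_star]
    exact pt_commute (commute_pair_pair n _ _ (by decide) (by decide) (by decide) (by decide) _ _)
  have h2 : Commute (pt (star (legY n lam (1 : Fin 4) 3 (by decide))))
      (pt (star (legU n lam (2 : Fin 4) 0 (by decide)))) := by
    rw [← map_star, ← map_star]
    exact pt_commute (commute_pair_pair n _ _ (by decide) (by decide) (by decide) (by decide) _ _)
  refine conj_mul_eq (commute_single_pair n (by decide) (by decide) (by decide) _ _).symm h1
    (commute_single_star n (by decide) (by decide) (by decide) _ _) h2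
    (mul_eq_of_eq_mul (R := leg (single 1) (spaceB n lam) * leg (single 3) (spaceB n lam)) ?_
      ((isRegularMU_opU n lam).conj_mul_slices (by decide)))
    (mul_eq_of_eq_mul (R := leg (single 0) (spaceA n lam) * leg (single 2) (spaceA n lam)) ?_
      ((isRegularMU_opY n lam).conj_mul_slices (by decide)))
  · unfold spaceA spaceB
    generalize slices (opU n lam) = E, slices (opY n lam) = F
    simp [mul_assoc, single_commute_single, single_left_comm]
  · unfold spaceA spaceB
    generalize slices (opU n lam) = E, slices (opY n lam) = F
    rw [single_commute_single (i := 0) (j := 1) (by decide)]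
    simp only [mul_assoc]
    rw [single_commute_single (i := 2) (j := 3) (by decide),
      single_left_comm (i := 0) (j := 3) (by decide)]

end phase

/-- A right factor that commutes with `a` drops out of the conjugate. This discards the second
factor of Z and the tails in the coassociativity arguments. -/
theorem conj_eq_conj {R : Type*} [Monoid R] [StarMul R] {P Q r a : R} (h : P = Q * r)
    (hr : r * star r = 1) (hc : Commute r a) : P * a * star P = Q * a * star Q := by
  rw [h, star_mul]
  calc _ = Q * (r * a) * star r * star Q := by simp only [mul_assoc]
    _ = _ := by rw [hc.eq]; simp only [mul_assoc, mul_asc hr, one_mul]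

/-- The legs `i, j, k, l`. -/
def quad {m : ℕ} (i j k l : Fin m) (h : Function.Injective ![i, j, k, l]) : Fin 4 ↪ Fin m :=
  ⟨![i, j, k, l], h⟩

section phase
variable (n : ℕ) (lam : ℝ)
open OpSpace

theorem legU_unitary {m : ℕ} {i j : Fin m} (h : i ≠ j) :
    star (legU n lam i j h) * legU n lam i j h = 1 :=
  (isRegularMU_opU n lam).star_mul_amp h

theorem legU_unitary' {m : ℕ} {i j : Fin m} (h : i ≠ j) :
    legU n lam i j h * star (legU n lam i j h) = 1 :=
  (isRegularMU_opU n lam).amp_mul_star h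

theorem legY_unitary {m : ℕ} {i j : Fin m} (h : i ≠ j) :
    star (legY n lam i j h) * legY n lam i j h = 1 :=
  (isRegularMU_opY n lam).star_mul_amp h

theorem legY_unitary' {m : ℕ} {i j : Fin m} (h : i ≠ j) :
    legY n lam i j h * star (legY n lam i j h) = 1 :=
  (isRegularMU_opY n lam).amp_mul_star h

theorem star_legY_unitary {m : ℕ} {i j : Fin m} (h : i ≠ j) :
    star (star (legY n lam i j h)) * star (legY n lam i j h) = 1 := by
  rw [star_star, legY_unitary']

/-! ### The comultiplications -/

/-- `Δ^cop` on `A`. -/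
def deltaA : OpHom (algA n lam) (1 + 1) :=
  adHom _ (single (1 : Fin 2)) (legU n lam 1 0 (by decide)) (legU_unitary n lam _)

theorem isAd_deltaA : IsAd (deltaA n lam) (single (1 : Fin 2)) (legU n lam 1 0 (by decide)) :=
  isAd_adHom _ _ _

/-- `Δ̂^cop` on `Âᵒᵖ`. -/
def deltaB : OpHom (algHatOp n lam) (1 + 1) :=
  adHom _ (single (0 : Fin 2)) (legY n lam 0 1 (by decide)) (legY_unitary n lam _)

theorem isAd_deltaB : IsAd (deltaB n lam) (single (0 : Fin 2)) (legY n lam 0 1 (by decide)) :=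
  isAd_adHom _ _ _

theorem deltaA_apply (S : algA n lam) :
    deltaA n lam S = flipOp * comulA n lam S * flipOp := by
  rw [(isAd_deltaA n lam).2, flipOp_mul_mul_flipOp, comulA, ← amp_castAdd, ← single_zero_two,
    map_mul, map_mul, map_star, amp_single, pair_zero]

theorem deltaB_apply (S : algHatOp n lam) :
    deltaB n lam S = flipOp * comulHat n lam S * flipOp := by
  rw [(isAd_deltaB n lam).2, flipOp_mul_mul_flipOp, comulHat, ← amp_natAdd, ← single_one_two,
    map_mul, map_mul, map_star, amp_single, pair_one, opX_eq, legY_eq_legQ]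
  simp only [map_star, star_star]

theorem isCStarBialgebra_deltaA : IsCStarBialgebra (algA n lam) (deltaA n lam) := by
  have hU := isRegularMU_opU n lam
  refine isCStarBialgebra_of_isAd (isClosed_algA n lam)
    (by rw [ofAlg_algA, hU.slices_mul_cpt]) (isAd_deltaA n lam) (adLeg_comulA n lam)
    (pair (1 : Fin 3) 2 (by decide)) (pair (0 : Fin 3) 2 (by decide)) (by decide) (by decide)
    (by decide) (by decide) fun _ c _ => ?_
  change amp (Fin.natAddEmb 1) (legU n lam (1 : Fin 2) 0 (by decide)) * _ *
    star (amp (Fin.natAddEmb 1) (legU n lam (1 : Fin 2) 0 (by decide))) =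
    amp (Fin.castAddEmb 1) (legU n lam (1 : Fin 2) 0 (by decide)) * _ *
    star (amp (Fin.castAddEmb 1) (legU n lam (1 : Fin 2) 0 (by decide)))
  have h1 : amp (Fin.natAddEmb 1) (legU n lam (1 : Fin 2) 0 (by decide)) =
    legU n lam (2 : Fin 3) 1 (by decide) := amp_pair _ _ _ _ _
  have h2 : amp (Fin.castAddEmb 1) (legU n lam (1 : Fin 2) 0 (by decide)) =
    legU n lam (1 : Fin 3) 0 (by decide) := amp_pair _ _ _ _ _
  rw [h1, h2]
  simp only [map_mul, map_star, amp_pair, amp_single]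
  -- The pentagon reads U₁₀U₂₁ = U₂₁U₂₀ · U₁₀, and the last factor commutes with `c` on leg 2.
  have h := conj_eq_conj (hU.pentagon_amp (by decide : (2 : Fin 3) ≠ 1) (by decide : (2 : Fin 3) ≠ 0)
    (by decide : (1 : Fin 3) ≠ 0)).symm (hU.amp_mul_star _)
    (a := amp (single 2) c) (amp_commute (by decide) _ _)
  simp only [star_mul, mul_assoc] at h ⊢
  exact h.symm

theorem isCStarBialgebra_deltaB : IsCStarBialgebra (algHatOp n lam) (deltaB n lam) := by
  have hY := isRegularMU_opY n lam
  refine isCStarBialgebra_of_isAd (isClosed_algHatOp n lam)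
    (by rw [ofAlg_algHatOp, hY.slices_mul_cpt]) (isAd_deltaB n lam) (adLeg_comulB n lam)
    (pair (0 : Fin 3) 2 (by decide)) (pair (0 : Fin 3) 1 (by decide)) (by decide) (by decide)
    (by decide) (by decide) fun _ c _ => ?_
  change amp (Fin.natAddEmb 1) (legY n lam (0 : Fin 2) 1 (by decide)) * _ *
    star (amp (Fin.natAddEmb 1) (legY n lam (0 : Fin 2) 1 (by decide))) =
    amp (Fin.castAddEmb 1) (legY n lam (0 : Fin 2) 1 (by decide)) * _ *
    star (amp (Fin.castAddEmb 1) (legY n lam (0 : Fin 2) 1 (by decide)))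
  have h1 : amp (Fin.natAddEmb 1) (legY n lam (0 : Fin 2) 1 (by decide)) =
    legY n lam (1 : Fin 3) 2 (by decide) := amp_pair _ _ _ _ _
  have h2 : amp (Fin.castAddEmb 1) (legY n lam (0 : Fin 2) 1 (by decide)) =
    legY n lam (0 : Fin 3) 1 (by decide) := amp_pair _ _ _ _ _
  rw [h1, h2]
  simp only [map_mul, map_star, amp_pair, amp_single]
  -- The pentagon reads Y₁₂Y₀₁ = Y₀₁Y₀₂ · Y₁₂, and the last factor commutes with `c` on leg 0.
  have h := conj_eq_conj (hY.pentagon_amp (by decide : (0 : Fin 3) ≠ 1) (by decide : (0 : Fin 3) ≠ 2)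
    (by decide : (1 : Fin 3) ≠ 2)).symm (hY.amp_mul_star _)
    (a := amp (single 0) c) (amp_commute (by decide) _ _)
  simp only [star_mul, mul_assoc] at h ⊢
  exact h

/-! ### The inversion -/

/-- The algebras are self-adjoint, so the absorption of Y* from the left has as its adjoint the
absorption of Y from the right. Conjugation by Y* therefore preserves A ⊗ Âᵒᵖ, up to the order of
the legs. -/
theorem adLeg_tau_le : adLeg (pair (1 : Fin 2) 0 (by decide)) (star (legY n lam 1 0 (by decide)))
    (ofAlg (spatialTensor (algA n lam) (algHatOp n lam))) ≤
      ofAlg (spatialTensor (algHatOp n lam) (algA n lam)) := by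
  have h := star_legY_mul n lam (by decide : (1 : Fin 2) ≠ 0)
  have h' := congrArg star h
  simp only [star_mul, star_leg, star_pt, star_star, (isRegularMU_opU n lam).star_slices,
    (isRegularMU_opY n lam).star_slices] at h'
  rw [adLeg_pair, ofAlg_tensor_two, ofAlg_algA, ofAlg_algHatOp, h, star_star,
    single_commute_single (by decide), h']

theorem adLeg_tau_symm_le : adLeg (pair (1 : Fin 2) 0 (by decide)) (legY n lam 0 1 (by decide))
    (ofAlg (spatialTensor (algHatOp n lam) (algA n lam))) ≤
      ofAlg (spatialTensor (algA n lam) (algHatOp n lam)) := by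
  have h := legY_mul n lam (by decide : (0 : Fin 2) ≠ 1)
  have h' := congrArg star h
  simp only [star_mul, star_leg, star_pt, (isRegularMU_opU n lam).star_slices,
    (isRegularMU_opY n lam).star_slices] at h'
  rw [adLeg_pair, ofAlg_tensor_two, ofAlg_algA, ofAlg_algHatOp,
    single_commute_single (by decide : (1 : Fin 2) ≠ 0), h,
    single_commute_single (by decide : (0 : Fin 2) ≠ 1), h']

theorem amp_pair_zero_one {X : Type} [MeasureSpace X] [SigmaFinite (volume : Measure X)]
    (T : Op X 2) : amp (pair (0 : Fin 2) 1 (by decide)) T = T :=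
  amp_id (fun i => by fin_cases i <;> rfl) T

set_option synthInstance.maxHeartbeats 200000 in
/-- The isomorphism `p ↦ φ p` given by mutually inverse homomorphisms. -/
def flipIsoOfHom {X : Type} [MeasureSpace X] [SigmaFinite (volume : Measure X)]
    {A B : NonUnitalStarSubalgebra ℂ (Op X 1)} (φ : OpHom (spatialTensor A B) 2)
    (ψ : spatialTensor B A → Op X 2) (hφ : ∀ p, φ p ∈ spatialTensor B A)
    (hψ : ∀ q, ψ q ∈ spatialTensor A B) (h₁ : ∀ p, ψ ⟨φ p, hφ p⟩ = p)
    (h₂ : ∀ q, φ ⟨ψ q, hψ q⟩ = q) : FlipIso A B where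
  toFun p := ⟨φ p, hφ p⟩
  invFun q := ⟨ψ q, hψ q⟩
  left_inv p := Subtype.ext (h₁ p)
  right_inv q := Subtype.ext (h₂ q)
  map_mul' p q := Subtype.ext (map_mul φ p q)
  map_add' p q := Subtype.ext (map_add φ p q)
  map_star' p := Subtype.ext (map_star φ p)
  map_smul' c p := Subtype.ext (map_smul φ c p)

theorem isAd_tauHom_of_isAd {X : Type} [MeasureSpace X] [SigmaFinite (volume : Measure X)]
    {A B : NonUnitalStarSubalgebra ℂ (Op X 1)} {τ : FlipIso A B} {f : Fin 2 ↪ Fin 2} {W : Op X 2}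
    (hW : star W * W = 1) (h : ∀ p, (τ p : Op X 2) = W * amp f (p : Op X 2) * star W) :
    IsAd (tauHom τ) f W := ⟨hW, h⟩

/-- The homomorphism `p ↦ Y₁₀* (Σ p Σ) Y₁₀`. -/
def tauAux : OpHom (spatialTensor (algA n lam) (algHatOp n lam)) 2 :=
  adHom _ (pair (1 : Fin 2) 0 (by decide)) (star (legY n lam 1 0 (by decide)))
    (star_legY_unitary n lam _)

/-- The homomorphism `q ↦ Y (Σ q Σ) Y*`. -/
def tauAuxInv : OpHom (spatialTensor (algHatOp n lam) (algA n lam)) 2 :=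
  adHom _ (pair (1 : Fin 2) 0 (by decide)) (legY n lam 0 1 (by decide)) (legY_unitary n lam _)

theorem tauAux_mem (p : spatialTensor (algA n lam) (algHatOp n lam)) :
    tauAux n lam p ∈ spatialTensor (algHatOp n lam) (algA n lam) :=
  (mem_ofAlg (isClosed_spatialTensor _ _)).1 (adLeg_tau_le n lam (mul_star_mem_adLeg _ _ p))

theorem tauAuxInv_mem (q : spatialTensor (algHatOp n lam) (algA n lam)) :
    tauAuxInv n lam q ∈ spatialTensor (algA n lam) (algHatOp n lam) :=
  (mem_ofAlg (isClosed_spatialTensor _ _)).1 (adLeg_tau_symm_le n lam (mul_star_mem_adLeg _ _ q))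

/-- The inversion `τ(p) = Σ Z p Z* Σ`. -/
def tauIso : FlipIso (algA n lam) (algHatOp n lam) :=
  flipIsoOfHom (tauAux n lam) (tauAuxInv n lam) (tauAux_mem n lam) (tauAuxInv_mem n lam)
    (fun p => by
      have h := legY_unitary' n lam (by decide : (0 : Fin 2) ≠ 1)
      change legY n lam (0 : Fin 2) 1 (by decide) * amp (pair (1 : Fin 2) 0 (by decide))
        (star (legY n lam (1 : Fin 2) 0 (by decide)) * amp (pair (1 : Fin 2) 0 (by decide))
        (p : Op (Phase n) 2) * star (star (legY n lam (1 : Fin 2) 0 (by decide)))) *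
        star (legY n lam (0 : Fin 2) 1 (by decide)) = p
      simp only [map_mul, map_star, amp_pair, pair_zero, pair_one, star_star,
        mul_assoc, mul_asc h, one_mul]
      rw [h, mul_one, amp_pair_zero_one])
    (fun q => by
      have h := legY_unitary n lam (by decide : (1 : Fin 2) ≠ 0)
      change star (legY n lam (1 : Fin 2) 0 (by decide)) * amp (pair (1 : Fin 2) 0 (by decide))
        (legY n lam (0 : Fin 2) 1 (by decide) * amp (pair (1 : Fin 2) 0 (by decide))
        (q : Op (Phase n) 2) * star (legY n lam (0 : Fin 2) 1 (by decide))) *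
        star (star (legY n lam (1 : Fin 2) 0 (by decide))) = q
      simp only [map_mul, map_star, amp_pair, pair_zero, pair_one, star_star,
        mul_assoc, mul_asc h, one_mul]
      rw [h, mul_one, amp_pair_zero_one])

theorem isAd_tauHom : IsAd (tauHom (tauIso n lam)) (pair (1 : Fin 2) 0 (by decide))
    (star (legY n lam 1 0 (by decide))) :=
  isAd_tauHom_of_isAd (star_legY_unitary n lam _) fun _ => rfl

theorem coe_tauIso (p : spatialTensor (algA n lam) (algHatOp n lam)) :
    (tauIso n lam p : Op (Phase n) 2) = star (legY n lam 1 0 (by decide)) *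
      amp (pair (1 : Fin 2) 0 (by decide)) (p : Op (Phase n) 2) * legY n lam 1 0 (by decide) := by
  have h := (isAd_tauHom n lam).2 p
  rw [star_star] at h
  exact h

/-- Z is Y* times a unitary that commutes with `p`, so conjugation by Z and by Y* agree on `p`. -/
theorem tauIso_apply (p : spatialTensor (algA n lam) (algHatOp n lam)) :
    (tauIso n lam p : Op (Phase n) 2) =
      flipOp * (opZ n lam * (p : Op (Phase n) 2) * star (opZ n lam)) * flipOp := by
  have hp : (p : Op (Phase n) 2) ∈ leg (single (0 : Fin 2)) (spaceA n lam) *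
      leg (single 1) (spaceB n lam) := by
    rw [← ofAlg_algA, ← ofAlg_algHatOp, ← ofAlg_tensor_two]
    exact (mem_ofAlg (isClosed_spatialTensor _ _)).2 p.2
  have hR : amp (pair (1 : Fin 2) 0 (by decide)) (opR n lam) *
      star (amp (pair (1 : Fin 2) 0 (by decide)) (opR n lam)) = 1 := by
    have J := legJ_mul_legJ n lam (i := (0 : Fin 2))
    have hU := legU_unitary' n lam (by decide : (1 : Fin 2) ≠ 0)
    simp only [opR, map_mul, amp_single, pair_one, star_mul, star_legJ, mul_assoc, mul_asc J,
      one_mul]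
    rw [mul_asc hU, one_mul, J]
  rw [coe_tauIso, flipOp_mul_mul_flipOp, opZ_eq,
    conj_eq_conj rfl hR (commute_opR n lam hp).symm, map_mul, map_mul, star_star, map_star]

end phase

theorem conj_conj {R : Type*} [Monoid R] [StarMul R] (W V a : R) :
    W * (V * a * star V) * star W = W * V * a * star (W * V) := by
  simp only [star_mul, mul_assoc]

/-- The letters `y₂₁`, `y₄₁`, `y₄₃` stand for adjoints of Y, `z₃₅` for the adjoint of `y₃₅`. The
left side is the unitary of `(δ_τ ⊗ id)δ_τ`. The right side is that of `(id ⊗ δ_τ)δ_τ` followed by a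
tail without the legs 4 and 1, which carry the argument. `h₁`–`h₄` are the pentagons of U and Y and
the mixed relation between them, and the other hypotheses say that disjoint legs commute. -/
theorem twisted_mul_twisted {R : Type*} [Monoid R]
    {y₂₁ u₂₀ y₁₃ y₄₁ u₄₂ y₁₅ y₄₃ y₃₅ z₃₅ u₄₀ : R} (h₁ : y₄₃ * y₄₁ * y₁₃ = y₁₃ * y₄₁)
    (h₂ : y₁₃ * y₁₅ = y₃₅ * y₁₃ * z₃₅) (h₃ : u₄₂ * u₄₀ * u₂₀ = u₂₀ * u₄₂)
    (h₄ : y₂₁ * y₄₁ * u₄₂ = u₄₂ * y₄₁) (c₁ : Commute y₁₃ u₄₂) (c₂ : Commute u₂₀ y₄₃)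
    (c₃ : Commute y₂₁ y₄₃) (c₄ : Commute u₂₀ y₄₁) (c₅ : Commute y₃₅ y₄₁) (c₆ : Commute y₃₅ u₄₀)
    (c₇ : Commute y₁₃ u₂₀) (c₈ : Commute y₃₅ u₂₀) :
    y₂₁ * (u₂₀ * y₁₃) * (y₄₁ * (u₄₂ * y₁₅)) =
      y₄₃ * (u₄₂ * y₃₅) * (y₄₁ * (u₄₀ * y₁₃)) * (u₂₀ * z₃₅) := by
  calc _ = y₂₁ * u₂₀ * (y₁₃ * y₄₁) * u₄₂ * y₁₅ := by simp only [mul_assoc]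
    _ = y₂₁ * (u₂₀ * y₄₃) * y₄₁ * (y₁₃ * u₄₂) * y₁₅ := by rw [← h₁]; simp only [mul_assoc]
    _ = y₂₁ * y₄₃ * (u₂₀ * y₄₁) * u₄₂ * y₁₃ * y₁₅ := by
      rw [c₁.eq, c₂.eq]; simp only [mul_assoc]
    _ = y₄₃ * y₂₁ * y₄₁ * (u₂₀ * u₄₂) * y₁₃ * y₁₅ := by
      rw [c₃.eq, c₄.eq]; simp only [mul_assoc]
    _ = y₄₃ * (y₂₁ * y₄₁ * u₄₂) * u₄₀ * u₂₀ * (y₁₃ * y₁₅) := by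
      rw [← h₃]; simp only [mul_assoc]
    _ = y₄₃ * u₄₂ * y₄₁ * u₄₀ * (u₂₀ * y₃₅) * y₁₃ * z₃₅ := by
      rw [h₄, h₂]; simp only [mul_assoc]
    _ = y₄₃ * u₄₂ * y₄₁ * (u₄₀ * y₃₅) * u₂₀ * y₁₃ * z₃₅ := by
      rw [← c₈.eq]; simp only [mul_assoc]
    _ = y₄₃ * u₄₂ * (y₄₁ * y₃₅) * u₄₀ * (u₂₀ * y₁₃) * z₃₅ := by
      rw [← c₆.eq]; simp only [mul_assoc]
    _ = _ := by rw [← c₅.eq, ← c₇.eq]; simp only [mul_assoc]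

/-! ### Inversions and twisted comultiplications implemented by unitaries -/

section implemented
variable {X : Type} [MeasureSpace X] [SigmaFinite (volume : Measure X)]
variable {A B : NonUnitalStarSubalgebra ℂ (Op X 1)} {δA : OpHom A (1 + 1)} {δB : OpHom B (1 + 1)}
  {τ : FlipIso A B} {U V W : Op X 2}
open OpSpace

theorem amp_conj {k m : ℕ} (f : Fin k ↪ Fin m) (S T : Op X k) :
    amp f (S * T * star S) = amp f S * amp f T * star (amp f S) := by
  rw [map_mul, map_mul, map_star]

theorem castAddEmb_eq_pair : (Fin.castAddEmb 1 : Fin 2 ↪ Fin 3) = pair 0 1 (by decide) := by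
  ext i
  fin_cases i <;> rfl

theorem natAddEmb_eq_pair : (Fin.natAddEmb 1 : Fin 2 ↪ Fin 3) = pair 1 2 (by decide) := by
  ext i
  fin_cases i <;> rfl

theorem star_amp_mul_amp {k m : ℕ} {f : Fin k ↪ Fin m} {T : Op X k} (hT : star T * T = 1) :
    star (amp f T) * amp f T = 1 := by
  rw [← map_star, ← map_mul, hT, map_one]

/-- Both sides are conjugates of `q` placed on the legs 2 and 0, and `h` equates the conjugating
words. The `triple` embeddings record the flips contained in τ. -/
theorem compat_left_conj
    (h : amp (pair (1 : Fin 3) 2 (by decide)) U * amp (pair (0 : Fin 3) 2 (by decide)) W =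
      amp (pair (0 : Fin 3) 1 (by decide)) W * amp (pair (0 : Fin 3) 2 (by decide)) W *
        amp (pair (1 : Fin 3) 2 (by decide)) U) (q : Op X 2) :
    amp (pair (1 : Fin 3) 2 (by decide)) U *
        amp (pair (0 : Fin 3) 2 (by decide)) (W * amp (pair (1 : Fin 2) 0 (by decide)) q * star W) *
        star (amp (pair (1 : Fin 3) 2 (by decide)) U) =
        amp (pair (0 : Fin 3) 1 (by decide)) W * amp (triple (1 : Fin 3) 0 2 (by decide) (by decide) (by decide))
          (amp (pair (1 : Fin 3) 2 (by decide)) W * amp (triple (0 : Fin 3) 2 1 (by decide) (by decide) (by decide))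
            (amp (pair (0 : Fin 3) 1 (by decide)) U * amp (pair (1 : Fin 3) 2 (by decide)) q *
              star (amp (pair (0 : Fin 3) 1 (by decide)) U)) * star (amp (pair (1 : Fin 3) 2 (by decide)) W)) *
        star (amp (pair (0 : Fin 3) 1 (by decide)) W) := by
  simp only [amp_conj, conj_conj, amp_pair, triple_zero, triple_one, triple_two, pair_zero,
    pair_one]
  simp only [map_mul, amp_pair, triple_zero, triple_one, triple_two, h, mul_assoc]

theorem compat_right_conj
    (h : amp (pair (0 : Fin 3) 1 (by decide)) U * amp (pair (0 : Fin 3) 2 (by decide)) W =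
      amp (pair (1 : Fin 3) 2 (by decide)) W * amp (pair (0 : Fin 3) 2 (by decide)) W *
        amp (pair (0 : Fin 3) 1 (by decide)) U) (q : Op X 2) :
    amp (pair (0 : Fin 3) 1 (by decide)) U *
        amp (pair (0 : Fin 3) 2 (by decide)) (W * amp (pair (1 : Fin 2) 0 (by decide)) q * star W) *
        star (amp (pair (0 : Fin 3) 1 (by decide)) U) =
        amp (pair (1 : Fin 3) 2 (by decide)) W * amp (triple (0 : Fin 3) 2 1 (by decide) (by decide) (by decide))
          (amp (pair (0 : Fin 3) 1 (by decide)) W * amp (triple (1 : Fin 3) 0 2 (by decide) (by decide) (by decide))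
            (amp (pair (1 : Fin 3) 2 (by decide)) U * amp (pair (0 : Fin 3) 1 (by decide)) q *
              star (amp (pair (1 : Fin 3) 2 (by decide)) U)) * star (amp (pair (0 : Fin 3) 1 (by decide)) W)) *
        star (amp (pair (1 : Fin 3) 2 (by decide)) W) := by
  simp only [amp_conj, conj_conj, amp_pair, triple_zero, triple_one, triple_two, pair_zero,
    pair_one]
  simp only [map_mul, amp_pair, triple_zero, triple_one, triple_two, h, mul_assoc]

/-- The first compatibility condition of an inversion, for implemented homomorphisms. -/
theorem compat_left_of_isAd (hδ : IsAd δA (single (1 : Fin 2)) U)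
    (hτ : IsAd (tauHom τ) (pair (1 : Fin 2) 0 (by decide)) W)
    (h₁ : adLeg (pair (1 : Fin 3) 2 (by decide)) (amp (pair (0 : Fin 3) 1 (by decide)) U)
      (ofAlg (spatialTensor A B)) * ofAlg (spatialTensor A (spatialTensor A B)) =
      ofAlg (spatialTensor A (spatialTensor A B)))
    (h₂ : adLeg (pair (2 : Fin 3) 1 (by decide))
      (amp (pair (1 : Fin 3) 2 (by decide)) W * amp (pair (0 : Fin 3) 2 (by decide)) U)
      (ofAlg (spatialTensor A B)) * ofAlg (spatialTensor (spatialTensor A B) A) =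
      ofAlg (spatialTensor (spatialTensor A B) A))
    (h : amp (pair (1 : Fin 3) 2 (by decide)) U * amp (pair (0 : Fin 3) 2 (by decide)) W =
      amp (pair (0 : Fin 3) 1 (by decide)) W * amp (pair (0 : Fin 3) 2 (by decide)) W *
        amp (pair (1 : Fin 3) 2 (by decide)) U) :
    ∃ (δι : OpHom (spatialTensor A B) (1 + 1 + 1))
      (ιτ : OpHom (spatialTensor A (spatialTensor A B)) (1 + (1 + 1)))
      (τι : OpHom (spatialTensor (spatialTensor A B) A) (1 + 1 + 1))
      (ιδ : OpHom (spatialTensor B A) (1 + (1 + 1))),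
    IsTensorHom δA (incl B) δι ∧ IsTensorHom (incl A) (tauHom τ) ιτ ∧
    IsTensorHom (tauHom τ) (incl A) τι ∧ IsTensorHom (incl B) δA ιδ ∧
    ∀ p, ∃ S : Op X (1 + (1 + 1)), ExtendsTo ιτ (opCast (by omega) (δι p)) S ∧
      ExtendsTo τι (opCast (by omega) S) (opCast (by omega) (ιδ (τ p))) := by
  have i₁ := isAd_adHom (spatialTensor A B) (pair (1 : Fin 3) 2 (by decide))
    (star_amp_mul_amp (f := (pair 0 1 (by decide) : Fin 2 ↪ Fin 3)) hδ.1)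
  have i₂ := isAd_adHom (spatialTensor A (spatialTensor A B))
    (triple (0 : Fin 3) 2 1 (by decide) (by decide) (by decide))
    (star_amp_mul_amp (f := (pair 1 2 (by decide) : Fin 2 ↪ Fin 3)) hτ.1)
  have i₃ := isAd_adHom (spatialTensor (spatialTensor A B) A)
    (triple (1 : Fin 3) 0 2 (by decide) (by decide) (by decide))
    (star_amp_mul_amp (f := (pair 0 1 (by decide) : Fin 2 ↪ Fin 3)) hτ.1)
  have i₄ := isAd_adHom (spatialTensor B A) (pair (0 : Fin 3) 2 (by decide))
    (star_amp_mul_amp (f := (pair 1 2 (by decide) : Fin 2 ↪ Fin 3)) hδ.1)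
  refine ⟨_, _, _, _,
    isTensorHom_of_isAd (a := 1) (b := 1) (k := 1 + 1) (l := 1) hδ (isAd_incl B) i₁ (by decide)
      (by decide) (by rw [map_one, mul_one, ← castAddEmb_eq_pair]),
    isTensorHom_of_isAd (a := 1) (b := 1 + 1) (k := 1) (l := 1 + 1) (isAd_incl A) hτ i₂ (by decide)
      (by decide) (by rw [map_one, one_mul, ← natAddEmb_eq_pair]),
    isTensorHom_of_isAd (a := 1 + 1) (b := 1) (k := 1 + 1) (l := 1) hτ (isAd_incl A) i₃ (by decide)
      (by decide) (by rw [map_one, mul_one, ← castAddEmb_eq_pair]),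
    isTensorHom_of_isAd (a := 1) (b := 1) (k := 1) (l := 1 + 1) (isAd_incl B) hδ i₄ (by decide)
      (by decide) (by rw [map_one, one_mul, ← natAddEmb_eq_pair]),
    fun p => ⟨_, i₂.extendsTo (isMultiplier_ad (isClosed_spatialTensor _ _) h₁ p) rfl,
      i₃.extendsTo (T := amp (pair (1 : Fin 3) 2 (by decide)) W *
        amp (triple (0 : Fin 3) 2 1 (by decide) (by decide) (by decide))
        (amp (pair (0 : Fin 3) 1 (by decide)) U * amp (pair (1 : Fin 3) 2 (by decide)) (p : Op X 2) *
        star (amp (pair (0 : Fin 3) 1 (by decide)) U)) *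
        star (amp (pair (1 : Fin 3) 2 (by decide)) W)) ?_ ?_⟩⟩
  · simp only [amp_conj, conj_conj, amp_pair, triple_zero, triple_one, triple_two]
    exact isMultiplier_ad (isClosed_spatialTensor _ _) h₂ p
  · have hp : (τ p : Op X 2) = W * amp (pair (1 : Fin 2) 0 (by decide)) (p : Op X 2) * star W :=
      hτ.2 p
    change amp (pair (1 : Fin 3) 2 (by decide)) U * amp (pair (0 : Fin 3) 2 (by decide))
      (τ p : Op X 2) * star (amp (pair (1 : Fin 3) 2 (by decide)) U) = _
    rw [hp]
    exact compat_left_conj h p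

/-- The second compatibility condition of an inversion, for implemented homomorphisms. -/
theorem compat_right_of_isAd (hδ : IsAd δB (single (0 : Fin 2)) U)
    (hτ : IsAd (tauHom τ) (pair (1 : Fin 2) 0 (by decide)) W)
    (h₁ : adLeg (pair (0 : Fin 3) 1 (by decide)) (amp (pair (1 : Fin 3) 2 (by decide)) U)
      (ofAlg (spatialTensor A B)) * ofAlg (spatialTensor (spatialTensor A B) B) =
      ofAlg (spatialTensor (spatialTensor A B) B))
    (h₂ : adLeg (pair (1 : Fin 3) 0 (by decide))
      (amp (pair (0 : Fin 3) 1 (by decide)) W * amp (pair (0 : Fin 3) 2 (by decide)) U)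
      (ofAlg (spatialTensor A B)) * ofAlg (spatialTensor B (spatialTensor A B)) =
      ofAlg (spatialTensor B (spatialTensor A B)))
    (h : amp (pair (0 : Fin 3) 1 (by decide)) U * amp (pair (0 : Fin 3) 2 (by decide)) W =
      amp (pair (1 : Fin 3) 2 (by decide)) W * amp (pair (0 : Fin 3) 2 (by decide)) W *
        amp (pair (0 : Fin 3) 1 (by decide)) U) :
    ∃ (ιδ : OpHom (spatialTensor A B) (1 + (1 + 1)))
      (τι : OpHom (spatialTensor (spatialTensor A B) B) (1 + 1 + 1))
      (ιτ : OpHom (spatialTensor B (spatialTensor A B)) (1 + (1 + 1)))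
      (δι : OpHom (spatialTensor B A) (1 + 1 + 1)),
    IsTensorHom (incl A) δB ιδ ∧ IsTensorHom (tauHom τ) (incl B) τι ∧
    IsTensorHom (incl B) (tauHom τ) ιτ ∧ IsTensorHom δB (incl A) δι ∧
    ∀ p, ∃ S : Op X (1 + 1 + 1), ExtendsTo τι (opCast (by omega) (ιδ p)) S ∧
      ExtendsTo ιτ (opCast (by omega) S) (opCast (by omega) (δι (τ p))) := by
  have i₁ := isAd_adHom (spatialTensor A B) (pair (0 : Fin 3) 1 (by decide))
    (star_amp_mul_amp (f := (pair 1 2 (by decide) : Fin 2 ↪ Fin 3)) hδ.1)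
  have i₂ := isAd_adHom (spatialTensor (spatialTensor A B) B)
    (triple (1 : Fin 3) 0 2 (by decide) (by decide) (by decide))
    (star_amp_mul_amp (f := (pair 0 1 (by decide) : Fin 2 ↪ Fin 3)) hτ.1)
  have i₃ := isAd_adHom (spatialTensor B (spatialTensor A B))
    (triple (0 : Fin 3) 2 1 (by decide) (by decide) (by decide))
    (star_amp_mul_amp (f := (pair 1 2 (by decide) : Fin 2 ↪ Fin 3)) hτ.1)
  have i₄ := isAd_adHom (spatialTensor B A) (pair (0 : Fin 3) 2 (by decide))
    (star_amp_mul_amp (f := (pair 0 1 (by decide) : Fin 2 ↪ Fin 3)) hδ.1)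
  refine ⟨_, _, _, _,
    isTensorHom_of_isAd (a := 1) (b := 1) (k := 1) (l := 1 + 1) (isAd_incl A) hδ i₁ (by decide)
      (by decide) (by rw [map_one, one_mul, ← natAddEmb_eq_pair]),
    isTensorHom_of_isAd (a := 1 + 1) (b := 1) (k := 1 + 1) (l := 1) hτ (isAd_incl B) i₂ (by decide)
      (by decide) (by rw [map_one, mul_one, ← castAddEmb_eq_pair]),
    isTensorHom_of_isAd (a := 1) (b := 1 + 1) (k := 1) (l := 1 + 1) (isAd_incl B) hτ i₃ (by decide)
      (by decide) (by rw [map_one, one_mul, ← natAddEmb_eq_pair]),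
    isTensorHom_of_isAd (a := 1) (b := 1) (k := 1 + 1) (l := 1) hδ (isAd_incl A) i₄ (by decide)
      (by decide) (by rw [map_one, mul_one, ← castAddEmb_eq_pair]),
    fun p => ⟨_, i₂.extendsTo (isMultiplier_ad (isClosed_spatialTensor _ _) h₁ p) rfl,
      i₃.extendsTo (T := amp (pair (0 : Fin 3) 1 (by decide)) W *
        amp (triple (1 : Fin 3) 0 2 (by decide) (by decide) (by decide))
        (amp (pair (1 : Fin 3) 2 (by decide)) U * amp (pair (0 : Fin 3) 1 (by decide)) (p : Op X 2) *
        star (amp (pair (1 : Fin 3) 2 (by decide)) U)) *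
        star (amp (pair (0 : Fin 3) 1 (by decide)) W)) ?_ ?_⟩⟩
  · simp only [amp_conj, conj_conj, amp_pair, triple_zero, triple_one, triple_two]
    exact isMultiplier_ad (isClosed_spatialTensor _ _) h₂ p
  · have hp : (τ p : Op X 2) = W * amp (pair (1 : Fin 2) 0 (by decide)) (p : Op X 2) * star W :=
      hτ.2 p
    change amp (pair (0 : Fin 3) 1 (by decide)) U * amp (pair (0 : Fin 3) 2 (by decide))
      (τ p : Op X 2) * star (amp (pair (0 : Fin 3) 1 (by decide)) U) = _
    rw [hp]
    exact compat_right_conj h p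

theorem star_mul_mul_mul {R : Type*} [Monoid R] [StarMul R] {a b : R} (ha : star a * a = 1)
    (hb : star b * b = 1) : star (a * b) * (a * b) = 1 := by
  rw [star_mul, mul_assoc, mul_asc ha, one_mul, hb]

/-- The comultiplications contribute U₀₁V₂₃ and id ⊗ τ ⊗ id exchanges the legs 1 and 2 before
conjugating by W₁₂, which gives the word in `hδ`. -/
theorem isTwistedComul_of_isAd {δτ : OpHom (spatialTensor A B) (1 + 1 + (1 + 1))}
    (hA : IsAd δA (single (1 : Fin 2)) U) (hB : IsAd δB (single (0 : Fin 2)) V)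
    (hτ : IsAd (tauHom τ) (pair (1 : Fin 2) 0 (by decide)) W)
    (hδ : IsAd δτ (pair (2 : Fin 4) 1 (by decide)) (amp (pair (1 : Fin 4) 2 (by decide)) W *
      (amp (pair (0 : Fin 4) 2 (by decide)) U * amp (pair (1 : Fin 4) 3 (by decide)) V)))
    (h : adLeg (pair (1 : Fin 4) 2 (by decide))
      (amp (pair (0 : Fin 4) 1 (by decide)) U * amp (pair (2 : Fin 4) 3 (by decide)) V)
      (ofAlg (spatialTensor A B)) * ofAlg (spatialTensor (spatialTensor A (spatialTensor A B)) B) =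
      ofAlg (spatialTensor (spatialTensor A (spatialTensor A B)) B)) :
    IsTwistedComul δA δB τ δτ := by
  have i₁ := isAd_adHom (spatialTensor A B) (pair (1 : Fin 4) 2 (by decide))
    (star_mul_mul_mul (star_amp_mul_amp (f := (pair 0 1 (by decide) : Fin 2 ↪ Fin 4)) hA.1)
      (star_amp_mul_amp (f := (pair 2 3 (by decide) : Fin 2 ↪ Fin 4)) hB.1))
  have i₂ := isAd_adHom (spatialTensor A (spatialTensor A B))
    (triple (0 : Fin 3) 2 1 (by decide) (by decide) (by decide))
    (star_amp_mul_amp (f := (pair 1 2 (by decide) : Fin 2 ↪ Fin 3)) hτ.1)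
  have i₃ := isAd_adHom (spatialTensor (spatialTensor A (spatialTensor A B)) B)
    (quad (0 : Fin 4) 2 1 3 (by decide))
    (star_amp_mul_amp (f := (pair 1 2 (by decide) : Fin 2 ↪ Fin 4)) hτ.1)
  have e₁ : (Fin.castAddEmb 2 : Fin 2 ↪ Fin 4) = pair 0 1 (by decide) := by
    ext i
    fin_cases i <;> rfl
  have e₂ : (Fin.natAddEmb 2 : Fin 2 ↪ Fin 4) = pair 2 3 (by decide) := by
    ext i
    fin_cases i <;> rfl
  have e₃ : amp (Fin.castAddEmb 1 : Fin 3 ↪ Fin 4) (amp (pair (1 : Fin 3) 2 (by decide)) W) =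
    amp (pair (1 : Fin 4) 2 (by decide)) W := amp_pair _ _ _ _ _
  refine ⟨_, _, _,
    isTensorHom_of_isAd (a := 1) (b := 1) (k := 1 + 1) (l := 1 + 1) hA hB i₁ (by decide)
      (by decide) (by rw [← e₁, ← e₂]),
    isTensorHom_of_isAd (a := 1) (b := 1 + 1) (k := 1) (l := 1 + 1) (isAd_incl A) hτ i₂ (by decide)
      (by decide) (by rw [map_one, one_mul, ← natAddEmb_eq_pair]),
    isTensorHom_of_isAd (a := 1 + (1 + 1)) (b := 1) (k := 1 + (1 + 1)) (l := 1) i₂ (isAd_incl B) i₃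
      (by decide) (by decide) (by rw [map_one, mul_one, ← e₃]),
    fun p => i₃.extendsTo (isMultiplier_ad (isClosed_spatialTensor _ _) h p) ?_⟩
  have key (q : Op X 2) : amp (pair (1 : Fin 4) 2 (by decide)) W *
      (amp (pair (0 : Fin 4) 2 (by decide)) U * amp (pair (1 : Fin 4) 3 (by decide)) V) *
      amp (pair (2 : Fin 4) 1 (by decide)) q *
      star (amp (pair (1 : Fin 4) 2 (by decide)) W * (amp (pair (0 : Fin 4) 2 (by decide)) U *
      amp (pair (1 : Fin 4) 3 (by decide)) V)) =
      amp (pair (1 : Fin 4) 2 (by decide)) W * amp (quad (0 : Fin 4) 2 1 3 (by decide))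
      (amp (pair (0 : Fin 4) 1 (by decide)) U * amp (pair (2 : Fin 4) 3 (by decide)) V *
      amp (pair (1 : Fin 4) 2 (by decide)) q *
      star (amp (pair (0 : Fin 4) 1 (by decide)) U * amp (pair (2 : Fin 4) 3 (by decide)) V)) *
      star (amp (pair (1 : Fin 4) 2 (by decide)) W) := by
    simp only [amp_conj, conj_conj]
    simp only [map_mul, amp_pair]
    rfl
  exact (hδ.2 p).trans (key p)

end implemented

section phase
variable (n : ℕ) (lam : ℝ)
open OpSpace

/-! ### The inversion property and the twisted comultiplication -/

theorem star_legY_mul_star_legY_mul_legU {m : ℕ} {i j k : Fin m} (hij : i ≠ j) (hik : i ≠ k)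
    (hjk : j ≠ k) : star (legY n lam j k hjk) * star (legY n lam i k hik) * legU n lam i j hij =
      legU n lam i j hij * star (legY n lam i k hik) :=
  star_mul_star_mul_of_pentagon (legU_mul_legY n lam hij hik hjk).symm (legY_unitary n lam _)
    (legY_unitary' n lam _) (legY_unitary n lam _)

theorem star_legY_mul_star_legY_mul_legY {m : ℕ} {i j k : Fin m} (hij : i ≠ j) (hik : i ≠ k)
    (hjk : j ≠ k) : star (legY n lam i k hik) * star (legY n lam i j hij) * legY n lam j k hjk =
      legY n lam j k hjk * star (legY n lam i j hij) :=
  star_mul_star_mul_of_pentagon ((isRegularMU_opY n lam).pentagon_amp hij hik hjk)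
    (legY_unitary n lam _) (legY_unitary' n lam _) (legY_unitary n lam _)

/-- With Y* on exchanged legs as the unitary of τ, the first compatibility is the mixed relation
between U and Y, and the second is the pentagon of Y, both solved for Y*. -/
theorem isInversion_tauIso : IsInversion (deltaA n lam) (deltaB n lam) (tauIso n lam) where
  left := isCStarBialgebra_deltaA n lam
  right := isCStarBialgebra_deltaB n lam
  compat_left := by
    refine compat_left_of_isAd (isAd_deltaA n lam) (isAd_tauHom n lam) ?_ ?_ ?_
    · simp only [amp_pair]
      exact adLeg_comulA_id n lam
    · simp only [map_star, amp_pair]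
      exact adLeg_tau_comulA n lam
    · simp only [map_star, amp_pair]
      exact (star_legY_mul_star_legY_mul_legU n lam (i := 2) (j := 1) (k := 0) (by decide)
        (by decide) (by decide)).symm
  compat_right := by
    refine compat_right_of_isAd (isAd_deltaB n lam) (isAd_tauHom n lam) ?_ ?_ ?_
    · simp only [amp_pair]
      exact adLeg_id_comulB n lam
    · simp only [map_star, amp_pair]
      exact adLeg_tau_comulB n lam
    · simp only [map_star, amp_pair]
      exact (star_legY_mul_star_legY_mul_legY n lam (i := 2) (j := 0) (k := 1) (by decide)
        (by decide) (by decide)).symm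

theorem twist_unitary : star (star (legY n lam (2 : Fin 4) 1 (by decide)) *
    (legU n lam 2 0 (by decide) * legY n lam 1 3 (by decide))) *
    (star (legY n lam (2 : Fin 4) 1 (by decide)) *
    (legU n lam 2 0 (by decide) * legY n lam 1 3 (by decide))) = 1 :=
  star_mul_mul_mul (star_legY_unitary n lam _)
    (star_mul_mul_mul (legU_unitary n lam _) (legY_unitary n lam _))

/-- The comultiplication `δ_τ = (id ⊗ τ ⊗ id)(Δ^cop ⊗ Δ̂^cop)` on `A ⊗ Âᵒᵖ`. -/
def deltaTau : OpHom (spatialTensor (algA n lam) (algHatOp n lam)) (1 + 1 + (1 + 1)) :=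
  adHom _ (pair (2 : Fin 4) 1 (by decide)) _ (twist_unitary n lam)

theorem isAd_deltaTau : IsAd (deltaTau n lam) (pair (2 : Fin 4) 1 (by decide))
    (star (legY n lam (2 : Fin 4) 1 (by decide)) *
      (legU n lam 2 0 (by decide) * legY n lam 1 3 (by decide))) :=
  isAd_adHom _ _ _

theorem isTwistedComul_deltaTau :
    IsTwistedComul (deltaA n lam) (deltaB n lam) (tauIso n lam) (deltaTau n lam) := by
  refine isTwistedComul_of_isAd (isAd_deltaA n lam) (isAd_deltaB n lam) (isAd_tauHom n lam) ?_ ?_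
  · simp only [map_star, amp_pair]
    exact isAd_deltaTau n lam
  · simp only [amp_pair]
    exact adLeg_comulA_comulB n lam

theorem ofAlg_tensor_mul_cpt :
    ofAlg (spatialTensor (algA n lam) (algHatOp n lam)) * cpt 2 = cpt 2 := by
  have h : leg (single (0 : Fin 2)) (cpt 1) * leg (single 1) (cpt 1) = cpt (X := Phase n) 2 := by
    rw [single_zero_two, single_one_two]
    exact leg_cpt_mul_leg_cpt 1 1
  rw [ofAlg_tensor_two, ofAlg_algA, ofAlg_algHatOp, ← h, mul_assoc,
    single_left_comm (by decide : (1 : Fin 2) ≠ 0), ← leg_mul, ← mul_assoc, ← leg_mul, spaceA,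
    spaceB, (isRegularMU_opU n lam).slices_mul_cpt, (isRegularMU_opY n lam).slices_mul_cpt]

theorem commute_legU_legY {m : ℕ} {i j k l : Fin m} (hij : i ≠ j) (hkl : k ≠ l) (h1 : i ≠ k)
    (h2 : i ≠ l) (h3 : j ≠ k) (h4 : j ≠ l) :
    Commute (legU n lam i j hij) (legY n lam k l hkl) :=
  commute_pair_pair n hij hkl h1 h2 h3 h4 _ _

theorem commute_legY_legY {m : ℕ} {i j k l : Fin m} (hij : i ≠ j) (hkl : k ≠ l) (h1 : i ≠ k)
    (h2 : i ≠ l) (h3 : j ≠ k) (h4 : j ≠ l) :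
    Commute (legY n lam i j hij) (legY n lam k l hkl) :=
  commute_pair_pair n hij hkl h1 h2 h3 h4 _ _

theorem commute_legU_star_legY {m : ℕ} {i j k l : Fin m} (hij : i ≠ j) (hkl : k ≠ l) (h1 : i ≠ k)
    (h2 : i ≠ l) (h3 : j ≠ k) (h4 : j ≠ l) :
    Commute (legU n lam i j hij) (star (legY n lam k l hkl)) := by
  rw [← map_star]
  exact commute_pair_pair n hij hkl h1 h2 h3 h4 _ _

theorem commute_legY_star_legY {m : ℕ} {i j k l : Fin m} (hij : i ≠ j) (hkl : k ≠ l) (h1 : i ≠ k)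
    (h2 : i ≠ l) (h3 : j ≠ k) (h4 : j ≠ l) :
    Commute (legY n lam i j hij) (star (legY n lam k l hkl)) := by
  rw [← map_star]
  exact commute_pair_pair n hij hkl h1 h2 h3 h4 _ _

/-- The identity of unitaries behind the coassociativity of `δ_τ`. -/
theorem twist_mul_twist :
    star (legY n lam (2 : Fin 6) 1 (by decide)) *
        (legU n lam (2 : Fin 6) 0 (by decide) * legY n lam (1 : Fin 6) 3 (by decide)) *
        (star (legY n lam (4 : Fin 6) 1 (by decide)) *
        (legU n lam (4 : Fin 6) 2 (by decide) * legY n lam (1 : Fin 6) 5 (by decide))) =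
      star (legY n lam (4 : Fin 6) 3 (by decide)) *
        (legU n lam (4 : Fin 6) 2 (by decide) * legY n lam (3 : Fin 6) 5 (by decide)) *
        (star (legY n lam (4 : Fin 6) 1 (by decide)) *
        (legU n lam (4 : Fin 6) 0 (by decide) * legY n lam (1 : Fin 6) 3 (by decide))) *
        (legU n lam (2 : Fin 6) 0 (by decide) * star (legY n lam (3 : Fin 6) 5 (by decide))) := by
  have hp := (isRegularMU_opY n lam).pentagon_amp (by decide : (1 : Fin 6) ≠ 3)
    (by decide : (1 : Fin 6) ≠ 5) (by decide : (3 : Fin 6) ≠ 5)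
  refine twisted_mul_twisted
    (star_legY_mul_star_legY_mul_legY n lam (by decide) (by decide) (by decide)) ?_
    ((isRegularMU_opU n lam).pentagon_amp (by decide) (by decide) (by decide))
    (star_legY_mul_star_legY_mul_legU n lam (by decide) (by decide) (by decide))
    (commute_legU_legY n lam _ _ (by decide) (by decide) (by decide) (by decide)).symm
    (commute_legU_star_legY n lam _ _ (by decide) (by decide) (by decide) (by decide))
    (commute_legY_legY n lam _ _ (by decide) (by decide) (by decide) (by decide)).star_star
    (commute_legU_star_legY n lam _ _ (by decide) (by decide) (by decide) (by decide))
    (commute_legY_star_legY n lam _ _ (by decide) (by decide) (by decide) (by decide))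
    (commute_legU_legY n lam _ _ (by decide) (by decide) (by decide) (by decide)).symm
    (commute_legU_legY n lam _ _ (by decide) (by decide) (by decide) (by decide)).symm
    (commute_legU_legY n lam _ _ (by decide) (by decide) (by decide) (by decide)).symm
  rw [← hp, mul_assoc _ _ (star _), legY_unitary', mul_one]

/-- The tail in `twist_mul_twist` acts on the legs 2, 0, 3, 5, so it commutes with `p` on the legs
4, 1 and is discarded. -/
theorem coassoc_twist (p : Op (Phase n) 2) :
    star (legY n lam (4 : Fin 6) 3 (by decide)) *
        (legU n lam (4 : Fin 6) 2 (by decide) * legY n lam (3 : Fin 6) 5 (by decide)) *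
        (star (legY n lam (4 : Fin 6) 1 (by decide)) *
        (legU n lam (4 : Fin 6) 0 (by decide) * legY n lam (1 : Fin 6) 3 (by decide))) *
        amp (pair (4 : Fin 6) 1 (by decide)) p *
        star (star (legY n lam (4 : Fin 6) 3 (by decide)) *
        (legU n lam (4 : Fin 6) 2 (by decide) * legY n lam (3 : Fin 6) 5 (by decide)) *
        (star (legY n lam (4 : Fin 6) 1 (by decide)) *
        (legU n lam (4 : Fin 6) 0 (by decide) * legY n lam (1 : Fin 6) 3 (by decide)))) =
      star (legY n lam (2 : Fin 6) 1 (by decide)) *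
        (legU n lam (2 : Fin 6) 0 (by decide) * legY n lam (1 : Fin 6) 3 (by decide)) *
        (star (legY n lam (4 : Fin 6) 1 (by decide)) *
        (legU n lam (4 : Fin 6) 2 (by decide) * legY n lam (1 : Fin 6) 5 (by decide))) *
        amp (pair (4 : Fin 6) 1 (by decide)) p *
        star (star (legY n lam (2 : Fin 6) 1 (by decide)) *
        (legU n lam (2 : Fin 6) 0 (by decide) * legY n lam (1 : Fin 6) 3 (by decide)) *
        (star (legY n lam (4 : Fin 6) 1 (by decide)) *
        (legU n lam (4 : Fin 6) 2 (by decide) * legY n lam (1 : Fin 6) 5 (by decide)))) := by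
  refine (conj_eq_conj (twist_mul_twist n lam) ?_ ?_).symm
  · rw [star_mul, star_star, mul_assoc, ← mul_assoc _ _ (star _), legY_unitary, one_mul,
      legU_unitary']
  · refine Commute.mul_left ?_ ?_
    · exact commute_pair_pair n _ _ (by decide) (by decide) (by decide) (by decide) _ _
    · rw [← map_star]
      exact commute_pair_pair n _ _ (by decide) (by decide) (by decide) (by decide) _ _

theorem isCStarBialgebra_deltaTau :
    IsCStarBialgebra (spatialTensor (algA n lam) (algHatOp n lam)) (deltaTau n lam) := by
  refine isCStarBialgebra_of_isAd (k := 1 + 1) (isClosed_spatialTensor _ _)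
    (ofAlg_tensor_mul_cpt n lam) (isAd_deltaTau n lam) (adLeg_comul_tau n lam)
    -- δ_τ places its argument on the legs 2, 1. Hence δ_τ ⊗ id sends four legs to 2, 1, 4, 5, and
    -- id ⊗ δ_τ, shifted by two, sends them to 0, 1, 4, 3.
    (quad (2 : Fin 6) 1 4 5 (by decide)) (quad (0 : Fin 6) 1 4 3 (by decide)) (by decide)
    (by decide) (by decide) (by decide) fun _ c _ => ?_
  have e₁ : amp (Fin.natAddEmb 2 : Fin 4 ↪ Fin 6) (star (legY n lam (2 : Fin 4) 1 (by decide)) *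
      (legU n lam 2 0 (by decide) * legY n lam 1 3 (by decide))) =
      star (legY n lam (4 : Fin 6) 3 (by decide)) *
        (legU n lam (4 : Fin 6) 2 (by decide) * legY n lam (3 : Fin 6) 5 (by decide)) := by
    simp only [map_mul, map_star, amp_pair]
    rfl
  have e₂ : amp (Fin.castAddEmb 2 : Fin 4 ↪ Fin 6) (star (legY n lam (2 : Fin 4) 1 (by decide)) *
      (legU n lam 2 0 (by decide) * legY n lam 1 3 (by decide))) =
      star (legY n lam (2 : Fin 6) 1 (by decide)) *
        (legU n lam (2 : Fin 6) 0 (by decide) * legY n lam (1 : Fin 6) 3 (by decide)) := by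
    simp only [map_mul, map_star, amp_pair]
    rfl
  have key (q : Op (Phase n) 2) : amp (Fin.natAddEmb 2 : Fin 4 ↪ Fin 6)
      (star (legY n lam (2 : Fin 4) 1 (by decide)) *
        (legU n lam 2 0 (by decide) * legY n lam 1 3 (by decide))) *
      amp (quad (0 : Fin 6) 1 4 3 (by decide)) (star (legY n lam (2 : Fin 4) 1 (by decide)) *
        (legU n lam 2 0 (by decide) * legY n lam 1 3 (by decide)) *
        amp (pair (2 : Fin 4) 1 (by decide)) q * star (star (legY n lam (2 : Fin 4) 1 (by decide)) *
        (legU n lam 2 0 (by decide) * legY n lam 1 3 (by decide)))) *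
      star (amp (Fin.natAddEmb 2 : Fin 4 ↪ Fin 6)
      (star (legY n lam (2 : Fin 4) 1 (by decide)) *
        (legU n lam 2 0 (by decide) * legY n lam 1 3 (by decide)))) =
      amp (Fin.castAddEmb 2 : Fin 4 ↪ Fin 6)
      (star (legY n lam (2 : Fin 4) 1 (by decide)) *
        (legU n lam 2 0 (by decide) * legY n lam 1 3 (by decide))) *
      amp (quad (2 : Fin 6) 1 4 5 (by decide)) (star (legY n lam (2 : Fin 4) 1 (by decide)) *
        (legU n lam 2 0 (by decide) * legY n lam 1 3 (by decide)) *
        amp (pair (2 : Fin 4) 1 (by decide)) q * star (star (legY n lam (2 : Fin 4) 1 (by decide)) *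
        (legU n lam 2 0 (by decide) * legY n lam 1 3 (by decide)))) *
      star (amp (Fin.castAddEmb 2 : Fin 4 ↪ Fin 6)
      (star (legY n lam (2 : Fin 4) 1 (by decide)) *
        (legU n lam 2 0 (by decide) * legY n lam 1 3 (by decide)))) := by
    rw [e₁, e₂]
    simp only [amp_conj, conj_conj]
    simp only [map_mul, map_star, amp_pair]
    exact coassoc_twist n lam q
  exact key c

end phase
end
end QuantumHeisenberg

open QuantumHeisenberg in
theorem mainTheorem8 (n : ℕ) (lam : ℝ) :
    (algA n lam : Set (Op (Phase n) 1)) =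
      closure (leftSlices (a := 1) (b := 1) (opU n lam)) ∧
    (algHatOp n lam : Set (Op (Phase n) 1)) =
      closure (rightSlices (a := 1) (b := 1) (opX n lam)) ∧
    ∃ (δA : OpHom (algA n lam) (1 + 1)) (δB : OpHom (algHatOp n lam) (1 + 1))
      (τ : FlipIso (algA n lam) (algHatOp n lam))
      (δτ : OpHom (spatialTensor (algA n lam) (algHatOp n lam)) (1 + 1 + (1 + 1))),
      (∀ S, δA S = flipOp * comulA n lam S * flipOp) ∧
      (∀ S, δB S = flipOp * comulHat n lam S * flipOp) ∧
      (∀ p, (τ p : Op (Phase n) (1 + 1)) =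
        flipOp * (opZ n lam * (p : Op (Phase n) (1 + 1)) * star (opZ n lam)) * flipOp) ∧
      IsInversion δA δB τ ∧
      IsTwistedComul δA δB τ δτ ∧
      IsCStarBialgebra (spatialTensor (algA n lam) (algHatOp n lam)) δτ :=
  ⟨coe_algA n lam, coe_algHatOp n lam, deltaA n lam, deltaB n lam, tauIso n lam, deltaTau n lam,
    deltaA_apply n lam, deltaB_apply n lam, tauIso_apply n lam, isInversion_tauIso n lam,
    isTwistedComul_deltaTau n lam, isCStarBialgebra_deltaTau n lam⟩
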